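/- **Conventions.** Let $G$ be a (finite-dimensional, real) Lie group with Lie algebra $\mathfrak g$, let $\theta^L,\theta^R\in\Omega^1(G,\mathfrak g)$ be its Maurer–Cartan forms and $\xi^L,\xi^R$ the left/right-invariant vector fields of $\xi\in\mathfrak g$. Let $\kappa,\kappa_1,\kappa_2$ be Lie group automorphisms of $G$ (the same letters denote the induced automorphisms of $\mathfrak g$), and let $B(\xi,\zeta)=\xi\cdot\zeta$ be a symmetric non-degenerate bilinear form on $\mathfrak g$ invariant under $\mathrm{Ad}(G)$ and under $\kappa,\kappa_1,\kappa_2$ (for instance an $\mathrm{Aut}(G)$-invariant one). For $\mathfrak g$-valued 1-forms put $(\alpha\cdot\beta)(u,v)=\alpha(u)\cdot\beta(v)-\alpha(v)\cdot\beta(u)$. Let $\eta=\frac1{12}[\theta^L,\theta^L]\cdot\theta^L\in\Omega^3(G)$. Write $G\kappa$ for $G$ with the action $\mathrm{Ad}^\kappa_g(h)=gh\kappa(g^{-1})$. A *$\chi$-twisted Dirac structure* on a manifold $M$ with closed $\chi\in\Omega^3(M)$ is a smooth subbundle $E\subset TM\oplus T^*M$ with $E=E^\perp$ for $\langle X\oplus\alpha,Y\oplus\beta\rangle=\beta(X)+\alpha(Y)$,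 whose sections are closed under $[\![X\oplus\alpha,Y\oplus\beta]\!]_\chi=[X,Y]\oplus(\mathcal L_X\beta-\iota_Yd\alpha+\iota_X\iota_Y\chi)$. Given Dirac structures $(M_i,E_i,\chi_i)$, a *strong Dirac morphism* $(\Phi,\omega):(M_1,E_1,\chi_1)\dashrightarrow(M_2,E_2,\chi_2)$ consists of a smooth map $\Phi:M_1\to M_2$ and $\omega\in\Omega^2(M_1)$ such that $\Phi^*\chi_2=\chi_1+d\omega$ and, for all $x\in M_1$ and $v_2\oplus\alpha_2\in E_2|_{\Phi(x)}$, there is a unique $v_1\oplus\alpha_1\in E_1|_x$ with $v_2=\Phi_*v_1$ and $\Phi^*\alpha_2=\alpha_1+\iota_{v_1}\omega$. Let $$E_G^\kappa=\Big\{(\kappa(\xi)^L-\xi^R)\oplus\tfrac12\big(\theta^L\cdot\kappa(\xi)+\theta^R\cdot\xi\big)\ \Big|\ \xi\in\mathfrak g\Big\}$$ be the twisted Cartan–Dirac structure, and put $E^\top=\{X\oplus-\alpha\mid X\oplus\alpha\in E\}$. A *$G\kappa$-valued tq-Hamiltonian space* is a triple $(M,\omega,\Phi)$ of a manifold with a smooth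 $G$-action, an invariant $\omega\in\Omega^2(M)$ and a smooth map $\Phi:M\to G$ with: (i) $\Phi(g\cdot x)=\mathrm{Ad}^\kappa_g(\Phi(x))$; (ii) $d\omega=\Phi^*\eta$; (iii) $\iota_{\xi_M}\omega=\frac12\Phi^*(\theta^L\cdot\kappa(\xi)+\theta^R\cdot\xi)$ for all $\xi\in\mathfrak g$, where $\xi_M(x)=\frac{d}{dt}\big|_{t=0}\exp(-t\xi)\cdot x$; (iv) $\ker\omega_x\cap\ker(\Phi_*|_x)=0$ for all $x$. **Statement.** 1. (Multiplication) The map $\mathrm{Mult}^{\kappa_1}:G\kappa_1\times G\kappa_2\to G\kappa_1\kappa_2$, $(a,b)\mapsto a\kappa_1(b)$, is equivariant for the (diagonal) twisted conjugation actions of $G$. With $\varsigma=-\frac12\,\mathrm{pr}_1^*\theta^L\cdot\mathrm{pr}_2^*\theta^R$ and $\varsigma^{\kappa_1}=(1\times\kappa_1)^*\varsigma$, $$(\mathrm{Mult}^{\kappa_1},\varsigma^{\kappa_1}):\big(G\kappa_1\times G\kappa_2,\;E_G^{\kappa_1}\oplus E_G^{\kappa_2},\;\mathrm{pr}_1^*\eta+\mathrm{pr}_2^*\eta\big)\dashrightarrow\big(G\kappa_1\kappa_2,\;E_G^{\kappa_1\kappa_2},\;\eta\big)$$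 is a strong Dirac morphism (in particular, both sides are Dirac structures). 2. (Inversion map) The map $\mathrm{Inv}^\kappa:G\kappa\to G\kappa^{-1}$, $a\mapsto\kappa^{-1}(a^{-1})$, is equivariant, and $(\mathrm{Inv}^\kappa,0):(G\kappa,E_G^\kappa,\eta)\dashrightarrow(G\kappa^{-1},(E_G^{\kappa^{-1}})^\top,-\eta)$ is a strong Dirac morphism. 3. (Internal fusion) Let $H$ be a Lie group with an automorphism $\tau$ and a symmetric non-degenerate bilinear form on its Lie algebra invariant under $\mathrm{Ad}(H)$ and $\tau$; equip $\mathfrak g\oplus\mathfrak g\oplus\mathfrak h$ and $\mathfrak g\oplus\mathfrak h$ with the direct sums of the given forms. If $(M,\omega,\Phi)$, $\Phi=(\Phi_1,\Phi_2,\Phi_3)$, is a $G\kappa_1\times G\kappa_2\times H\tau$-valued tq-Hamiltonian $G\times G\times H$-space, then $M$ with the $G\times H$-action in which $G$ acts diagonally, with $$\omega_{\mathrm{fus}}=\omega-\tfrac12\,\Phi_1^*\theta^L\cdot\Phi_2^*\kappa_1^*\theta^R,\qquad\Phi_{\mathrm{fus}}=\big(\Phi_1\cdot\kappa_1(\Phi_2),\,\Phi_3\big),$$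 is a $G\kappa_1\kappa_2\times H\tau$-valued tq-Hamiltonian $G\times H$-space. 4. (Fusion product) If $(M_i,\omega_i,\Phi_i)$ is a $G\kappa_i$-valued tq-Hamiltonian $G$-space for $i=1,2$, then $M_1\times M_2$ with the diagonal $G$-action, the 2-form $\omega_1+\omega_2-\frac12\,\Phi_1^*\theta^L\cdot\Phi_2^*\kappa_1^*\theta^R$ (pullbacks from the factors understood) and the map $(x_1,x_2)\mapsto\Phi_1(x_1)\,\kappa_1(\Phi_2(x_2))$ is a $G\kappa_1\kappa_2$-valued tq-Hamiltonian $G$-space. 5. (Inverse) If $(M,\omega,\Phi)$ is a $G\kappa$-valued tq-Hamiltonian $G$-space, then $(M,-\omega,\Phi^-)$ with the same action and $\Phi^-(x)=\kappa^{-1}(\Phi(x)^{-1})$ is a $G\kappa^{-1}$-valued tq-Hamiltonian $G$-space. -/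

import Mathlib

open scoped Manifold ContDiff

noncomputable section

namespace TqHam

section Forms

variable {E : Type*} [NormedAddCommGroup E] [NormedSpace ℝ E]
  {H : Type*} [TopologicalSpace H]
  {E' : Type*} [NormedAddCommGroup E'] [NormedSpace ℝ E']
  {H' : Type*} [TopologicalSpace H']

instance {I : ModelWithCorners ℝ E H} {M : Type*} [TopologicalSpace M] [ChartedSpace H M] {x : M}
    [FiniteDimensional ℝ E] : FiniteDimensional ℝ (TangentSpace I x) :=
  inferInstanceAs (FiniteDimensional ℝ E)

instance {I : ModelWithCorners ℝ E H} {M : Type*} [TopologicalSpace M] [ChartedSpace H M] {x : M} :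
    T2Space (TangentSpace I x) :=
  inferInstanceAs (T2Space E)

/-- Differential `k`-forms on `M` (no smoothness imposed; see `IsSmoothForm`). -/
abbrev DiffForm (I : ModelWithCorners ℝ E H) (M : Type*) [TopologicalSpace M] [ChartedSpace H M]
    (k : ℕ) : Type _ :=
  (x : M) → (TangentSpace I x) [⋀^Fin k]→L[ℝ] ℝ

/-- Differential `1`-forms on `M` with values in a topological vector space `W`. -/
abbrev OneForm (I : ModelWithCorners ℝ E H) (M : Type*) [TopologicalSpace M] [ChartedSpace H M]
    (W : Type*) [TopologicalSpace W] [AddCommGroup W] [Module ℝ W] : Type _ :=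
  (x : M) → TangentSpace I x →L[ℝ] W

variable {I : ModelWithCorners ℝ E H} {M : Type*} [TopologicalSpace M] [ChartedSpace H M]
  {I' : ModelWithCorners ℝ E' H'} {M' : Type*} [TopologicalSpace M'] [ChartedSpace H' M']

/-- The expression of a form in the chart at `x₀`: its pullback under the inverse chart. -/
def inChart {k : ℕ} (ϖ : DiffForm I M k) (x₀ : M) : E → E [⋀^Fin k]→L[ℝ] ℝ := fun y =>
  (ϖ ((extChartAt I x₀).symm y)).compContinuousLinearMap
    (mfderivWithin 𝓘(ℝ, E) I (extChartAt I x₀).symm (Set.range I) y)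

/-- A form is smooth on an (open) set `U` if all its chart expressions are smooth there. -/
def IsSmoothFormOn {k : ℕ} (ϖ : DiffForm I M k) (U : Set M) : Prop :=
  ∀ x₀ : M, ContDiffOn ℝ ∞ (inChart ϖ x₀)
    ((extChartAt I x₀).target ∩ (extChartAt I x₀).symm ⁻¹' U)

/-- Smoothness of a differential form. -/
def IsSmoothForm {k : ℕ} (ϖ : DiffForm I M k) : Prop :=
  IsSmoothFormOn ϖ Set.univ

/-- The exterior derivative, computed at each point in the chart at that point. -/
def extD {k : ℕ} (ϖ : DiffForm I M k) : DiffForm I M (k + 1) := fun x =>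
  (extDerivWithin (inChart ϖ x) (Set.range I) (extChartAt I x x)).compContinuousLinearMap
    (mfderiv I 𝓘(ℝ, E) (extChartAt I x) x)

/-- The pullback `Φ^* ϖ` of a form. -/
def pullback {k : ℕ} (Φ : M → M') (ϖ : DiffForm I' M' k) : DiffForm I M k := fun x =>
  (ϖ (Φ x)).compContinuousLinearMap (mfderiv I I' Φ x)

/-- The pullback of a vector-valued `1`-form. -/
def pullback₁ {W : Type*} [TopologicalSpace W] [AddCommGroup W] [Module ℝ W]
    (Φ : M → M') (α : OneForm I' M' W) : OneForm I M W := fun x =>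
  (α (Φ x)).comp (mfderiv I I' Φ x)

/-- A real-valued `1`-form, viewed as an alternating form of degree one. -/
def oneForm (α : OneForm I M ℝ) : DiffForm I M 1 := fun x =>
  ContinuousAlternatingMap.ofSubsingleton ℝ (TangentSpace I x) ℝ (0 : Fin 1) (α x)

/-- The contraction `ι_v ϖ = ϖ(v, ·)` of a `2`-form at a point. -/
def contract₂ {x : M} (ϖ : (TangentSpace I x) [⋀^Fin 2]→L[ℝ] ℝ) (v : TangentSpace I x) :
    TangentSpace I x →L[ℝ] ℝ :=
  ϖ.toContinuousMultilinearMap.toContinuousLinearMap ![v, 0] 1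

/-- The contraction `ι_v ι_u χ = χ(u, v, ·)` of a `3`-form at a point. -/
def contract₃ {x : M} (χ : (TangentSpace I x) [⋀^Fin 3]→L[ℝ] ℝ) (u v : TangentSpace I x) :
    TangentSpace I x →L[ℝ] ℝ :=
  χ.toContinuousMultilinearMap.toContinuousLinearMap ![u, v, 0] 2

theorem contract₂_apply {x : M} (ϖ : (TangentSpace I x) [⋀^Fin 2]→L[ℝ] ℝ)
    (v w : TangentSpace I x) : contract₂ ϖ v w = ϖ ![v, w] := by
  have : Function.update ![v, 0] 1 w = ![v, w] := by ext i; fin_cases i <;> rfl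
  change ϖ (Function.update ![v, 0] 1 w) = _
  rw [this]

theorem contract₃_apply {x : M} (χ : (TangentSpace I x) [⋀^Fin 3]→L[ℝ] ℝ)
    (u v w : TangentSpace I x) : contract₃ χ u v w = χ ![u, v, w] := by
  have : Function.update ![u, v, 0] 2 w = ![u, v, w] := by ext i; fin_cases i <;> rfl
  change χ (Function.update ![u, v, 0] 2 w) = _
  rw [this]

/-- A bilinear map on a finite-dimensional space is jointly continuous. -/
theorem continuous_bilin {W F : Type*} [TopologicalSpace W] [AddCommGroup W] [Module ℝ W]
    [IsTopologicalAddGroup W] [ContinuousSMul ℝ W] [T2Space W] [FiniteDimensional ℝ W]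
    [TopologicalSpace F] [AddCommGroup F] [Module ℝ F] [IsTopologicalAddGroup F]
    [ContinuousSMul ℝ F] (b : W →ₗ[ℝ] W →ₗ[ℝ] F) :
    Continuous fun p : W × W => b p.1 p.2 := by
  let e := Module.finBasis ℝ W
  have h : (fun p : W × W => b p.1 p.2) = fun p => ∑ i, e.coord i p.1 • b (e i) p.2 := by
    funext p
    have h₁ : b p.1 = ∑ i, e.repr p.1 i • b (e i) := by
      conv_lhs => rw [← e.sum_repr p.1]
      rw [map_sum]
      simp only [map_smul]
    rw [h₁]
    simp [LinearMap.sum_apply]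
  rw [h]
  refine continuous_finsetSum _ fun i _ => ?_
  exact ((LinearMap.continuous_of_finiteDimensional (e.coord i)).comp continuous_fst).smul
    ((LinearMap.continuous_of_finiteDimensional (b (e i))).comp continuous_snd)

/-- For a bilinear form `B` on `W` and `W`-valued `1`-forms `α, β`, the `2`-form `α · β`,
`(α · β)(u, v) = B (α u) (β v) - B (α v) (β u)`. -/
def dotWedge {W : Type*} [TopologicalSpace W] [AddCommGroup W] [Module ℝ W]
    [IsTopologicalAddGroup W] [ContinuousSMul ℝ W] [T2Space W] [FiniteDimensional ℝ W]
    (B : LinearMap.BilinForm ℝ W) (α β : OneForm I M W) : DiffForm I M 2 := fun x =>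
  ContinuousMultilinearMap.alternatization (ι := Fin 2)
    { toFun := fun u => B (α x (u 0)) (β x (u 1))
      map_update_add' := by
        intro _ m i a b
        fin_cases i <;> simp
      map_update_smul' := by
        intro _ m i c a
        fin_cases i <;> simp
      cont := (continuous_bilin B).comp
        (((α x).continuous.comp (continuous_apply 0)).prodMk
          ((β x).continuous.comp (continuous_apply 1))) }

end Forms

section Dirac

variable {E : Type*} [NormedAddCommGroup E] [NormedSpace ℝ E]
  {H : Type*} [TopologicalSpace H] {I : ModelWithCorners ℝ E H}
  {M : Type*} [TopologicalSpace M] [ChartedSpace H M] [IsManifold I ∞ M]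
  {E' : Type*} [NormedAddCommGroup E'] [NormedSpace ℝ E']
  {H' : Type*} [TopologicalSpace H'] {I' : ModelWithCorners ℝ E' H'}
  {M' : Type*} [TopologicalSpace M'] [ChartedSpace H' M'] [IsManifold I' ∞ M']

/-- The fibre `T_x M ⊕ T_x^* M` of the generalized tangent bundle. -/
abbrev Pont (I : ModelWithCorners ℝ E H) {M : Type*} [TopologicalSpace M] [ChartedSpace H M]
    (x : M) : Type _ :=
  TangentSpace I x × (TangentSpace I x →L[ℝ] ℝ)

/-- The split symmetric form `⟨X ⊕ α, Y ⊕ β⟩ = β(X) + α(Y)`. -/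
def pairing {x : M} (p q : Pont I x) : ℝ := q.2 p.1 + p.2 q.1

/-- A section `X ⊕ α` of `TM ⊕ T^*M` is smooth on the open set `U`. -/
def IsSmoothSectionOn (σ : (x : M) → Pont I x) (U : Set M) : Prop :=
  ContMDiffOn I I.tangent ∞ (fun x => (⟨x, (σ x).1⟩ : TangentBundle I M)) U ∧
    IsSmoothFormOn (oneForm fun x => (σ x).2) U

/-- The `χ`-twisted Courant bracket
`⟦X ⊕ α, Y ⊕ β⟧ = [X, Y] ⊕ (L_X β - ι_Y dα + ι_X ι_Y χ)`,
where `L_X β = ι_X dβ + d(β(X))`. -/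
def courant (χ : DiffForm I M 3) (σ τ : (x : M) → Pont I x) (x : M) : Pont I x :=
  (VectorField.mlieBracket I (fun y => (σ y).1) (fun y => (τ y).1) x,
    (contract₂ (extD (oneForm fun y => (τ y).2) x) (σ x).1
        + mvfderiv I (fun y => (τ y).2 (σ y).1) x)
      - contract₂ (extD (oneForm fun y => (σ y).2) x) (τ x).1
      + contract₃ (χ x) (τ x).1 (σ x).1)

/-- `L` is a `χ`-twisted Dirac structure on `M`: the `3`-form `χ` is closed, and `L` is a smooth
Lagrangian subbundle of `TM ⊕ T^*M` whose sections are closed under the Courant bracket. -/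
structure IsDiracStructure (χ : DiffForm I M 3) (L : (x : M) → Submodule ℝ (Pont I x)) :
    Prop where
  smooth_form : IsSmoothForm χ
  closed : extD χ = 0
  subbundle : ∀ x₀ : M, ∃ U : Set M, IsOpen U ∧ x₀ ∈ U ∧
    ∃ (r : ℕ) (σ : Fin r → (x : M) → Pont I x), (∀ i, IsSmoothSectionOn (σ i) U) ∧
      ∀ x ∈ U, LinearIndependent ℝ (fun i => σ i x) ∧
        Submodule.span ℝ (Set.range fun i => σ i x) = L x
  lagrangian : ∀ (x : M) (p : Pont I x), p ∈ L x ↔ ∀ q ∈ L x, pairing p q = 0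
  involutive : ∀ σ τ : (x : M) → Pont I x,
    IsSmoothSectionOn σ Set.univ → IsSmoothSectionOn τ Set.univ →
    (∀ x, σ x ∈ L x) → (∀ x, τ x ∈ L x) → ∀ x, courant χ σ τ x ∈ L x

/-- `(Φ, ϖ) : (M, L, χ) ⇢ (M', L', χ')` is a strong Dirac morphism of Dirac manifolds. -/
structure IsDiracMorphism (L : (x : M) → Submodule ℝ (Pont I x)) (χ : DiffForm I M 3)
    (L' : (x : M') → Submodule ℝ (Pont I' x)) (χ' : DiffForm I' M' 3)
    (Φ : M → M') (ϖ : DiffForm I M 2) : Prop where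
  source : IsDiracStructure χ L
  target : IsDiracStructure χ' L'
  smooth_map : ContMDiff I I' ∞ Φ
  smooth_form : IsSmoothForm ϖ
  pullback_form : pullback Φ χ' = χ + extD ϖ
  lift : ∀ (x : M), ∀ p' ∈ L' (Φ x), ∃! p : Pont I x, p ∈ L x ∧
    p'.1 = mfderiv I I' Φ x p.1 ∧
    p'.2.comp (mfderiv I I' Φ x) = p.2 + contract₂ (ϖ x) p.1

/-- The exterior sum `X ⊕ α, Y ⊕ β ↦ (X, Y) ⊕ (pr₁^* α + pr₂^* β)`. -/
def pontProd (x : M) (y : M') :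
    Pont I x × Pont I' y →ₗ[ℝ] Pont (I.prod I') ((x, y) : M × M') where
  toFun p := (mfderiv I (I.prod I') (fun a => (a, y)) x p.1.1
        + mfderiv I' (I.prod I') (fun b => (x, b)) y p.2.1,
      p.1.2.comp (mfderiv (I.prod I') I (Prod.fst : M × M' → M) (x, y))
        + p.2.2.comp (mfderiv (I.prod I') I' (Prod.snd : M × M' → M') (x, y)))
  map_add' p q := by
    refine Prod.ext ?_ ?_
    · simp only [Prod.fst_add, Prod.snd_add, map_add]
      abel
    · simp only [Prod.fst_add, Prod.snd_add, ContinuousLinearMap.add_comp]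
      abel
  map_smul' c p := by
    refine Prod.ext ?_ ?_
    · simp only [Prod.smul_fst, Prod.smul_snd, map_smul, RingHom.id_apply, smul_add]
    · simp only [Prod.smul_fst, Prod.smul_snd, ContinuousLinearMap.smul_comp, RingHom.id_apply,
        smul_add]

/-- The direct sum `L ⊕ L'` of subbundles, over `M × M'`. -/
def directSum (L : (x : M) → Submodule ℝ (Pont I x)) (L' : (x : M') → Submodule ℝ (Pont I' x)) :
    (z : M × M') → Submodule ℝ (Pont (I.prod I') z) := fun z =>
  ((L z.1).prod (L' z.2)).map (pontProd z.1 z.2)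

/-- The subbundle `L^⊤ = {X ⊕ -α | X ⊕ α ∈ L}`. -/
def transpose (L : (x : M) → Submodule ℝ (Pont I x)) : (x : M) → Submodule ℝ (Pont I x) :=
  fun x => (L x).map (LinearMap.prodMap LinearMap.id (-LinearMap.id))

end Dirac

section LieGroups

variable {E : Type*} [NormedAddCommGroup E] [NormedSpace ℝ E]
  {H : Type*} [TopologicalSpace H] {I : ModelWithCorners ℝ E H}
  {G : Type*} [TopologicalSpace G] [ChartedSpace H G] [Group G]
  {E' : Type*} [NormedAddCommGroup E'] [NormedSpace ℝ E']
  {H' : Type*} [TopologicalSpace H'] {J : ModelWithCorners ℝ E' H'}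
  {K : Type*} [TopologicalSpace K] [ChartedSpace H' K] [Group K]

variable (I) in
/-- `κ` is an automorphism of the Lie group `G`. -/
structure IsLieAut (κ : MulAut G) : Prop where
  smooth : ContMDiff I I ∞ κ
  smooth_symm : ContMDiff I I ∞ (κ⁻¹ : MulAut G)

variable (I) in
/-- The automorphism of the Lie algebra induced by an automorphism of `G`. -/
def lieAut (κ : MulAut G) : GroupLieAlgebra I G →L[ℝ] GroupLieAlgebra I G :=
  (mfderiv I I κ 1 : TangentSpace I (1 : G) →L[ℝ] TangentSpace I (κ 1))

/-- `B` is invariant under the automorphism `κ`. -/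
def InvariantUnder (B : LinearMap.BilinForm ℝ (GroupLieAlgebra I G)) (κ : MulAut G) : Prop :=
  ∀ ξ ζ : GroupLieAlgebra I G, B (lieAut I κ ξ) (lieAut I κ ζ) = B ξ ζ

/-- `B` is symmetric, non-degenerate and `Ad`-invariant. -/
structure IsInvariantForm (B : LinearMap.BilinForm ℝ (GroupLieAlgebra I G)) : Prop where
  symm : B.IsSymm
  nondegenerate : B.Nondegenerate
  ad_invariant : ∀ g : G, InvariantUnder B (MulAut.conj g)

variable (I G) in
/-- The left-invariant Maurer-Cartan form `θ^L`. -/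
def thetaL : OneForm I G (GroupLieAlgebra I G) := fun g =>
  (mfderiv I I (fun h => g⁻¹ * h) g : TangentSpace I g →L[ℝ] TangentSpace I (g⁻¹ * g))

variable (I G) in
/-- The right-invariant Maurer-Cartan form `θ^R`. -/
def thetaR : OneForm I G (GroupLieAlgebra I G) := fun g =>
  (mfderiv I I (fun h => h * g⁻¹) g : TangentSpace I g →L[ℝ] TangentSpace I (g * g⁻¹))

/-- The value at `g` of the left-invariant vector field `ξ^L`. -/
def leftField (g : G) : GroupLieAlgebra I G →L[ℝ] TangentSpace I g :=
  (mfderiv I I (fun h => g * h) 1 : TangentSpace I (1 : G) →L[ℝ] TangentSpace I (g * 1))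

/-- The value at `g` of the right-invariant vector field `ξ^R`. -/
def rightField (g : G) : GroupLieAlgebra I G →L[ℝ] TangentSpace I g :=
  (mfderiv I I (fun h => h * g) 1 : TangentSpace I (1 : G) →L[ℝ] TangentSpace I (1 * g))

/-- The `κ`-twisted conjugation `Ad_g^κ(h) = g h κ(g⁻¹)`. -/
def twConj (κ : MulAut G) (g h : G) : G := g * h * κ g⁻¹

/-- The twisted multiplication `(a, b) ↦ a κ(b)`. -/
def twMult (κ : MulAut G) : G × G → G := fun p => p.1 * κ p.2

/-- The twisted inversion `a ↦ κ⁻¹(a⁻¹)`. -/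
def twInv (κ : MulAut G) : G → G := fun a => (κ⁻¹ : MulAut G) a⁻¹

variable [FiniteDimensional ℝ E] [FiniteDimensional ℝ E']

variable (I G) in
/-- The Lie bracket as a bilinear map. -/
def lieBilin [LieGroup I ∞ G] :
    GroupLieAlgebra I G →ₗ[ℝ] GroupLieAlgebra I G →ₗ[ℝ] GroupLieAlgebra I G :=
  haveI : CompleteSpace E := FiniteDimensional.complete ℝ E
  haveI : LieGroup I (minSmoothness ℝ 3) G := by
    rw [minSmoothness_of_isRCLikeNormedField]; infer_instance
  LinearMap.mk₂ ℝ (fun v w => ⁅v, w⁆) add_lie smul_lie lie_add lie_smul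

/-- The Cartan `3`-form `η = 1/12 [θ^L, θ^L] · θ^L`. -/
def cartanForm [LieGroup I ∞ G] (B : LinearMap.BilinForm ℝ (GroupLieAlgebra I G)) :
    DiffForm I G 3 := fun g =>
  (1 / 12 : ℝ) • ContinuousMultilinearMap.alternatization (ι := Fin 3)
    { toFun := fun u =>
        B (lieBilin I G (thetaL I G g (u 0)) (thetaL I G g (u 1))) (thetaL I G g (u 2))
      map_update_add' := by
        intro _ m i a b
        fin_cases i <;> simp [Fin.ext_iff]
      map_update_smul' := by
        intro _ m i c a
        fin_cases i <;> simp [Fin.ext_iff]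
      cont := (continuous_bilin B).comp
        (((continuous_bilin (lieBilin I G)).comp
          (((thetaL I G g).continuous.comp (continuous_apply 0)).prodMk
            ((thetaL I G g).continuous.comp (continuous_apply 1)))).prodMk
          ((thetaL I G g).continuous.comp (continuous_apply 2))) }

/-- The map `e^κ(ξ)|_g = (κ(ξ)^L - ξ^R) ⊕ 1/2 (θ^L · κ(ξ) + θ^R · ξ)`. -/
def eMap (B : LinearMap.BilinForm ℝ (GroupLieAlgebra I G)) (κ : MulAut G) (g : G) :
    GroupLieAlgebra I G →ₗ[ℝ] Pont I g where
  toFun ξ := (leftField g (lieAut I κ ξ) - rightField g ξ,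
    (1 / 2 : ℝ) • ((B.flip (lieAut I κ ξ)).toContinuousLinearMap.comp (thetaL I G g)
      + (B.flip ξ).toContinuousLinearMap.comp (thetaR I G g)))
  map_add' ξ ζ := by
    refine Prod.ext ?_ ?_
    · simp only [map_add, Prod.fst_add]
      abel
    · ext v
      simp
      ring
  map_smul' c ξ := by
    refine Prod.ext ?_ ?_
    · simp [smul_sub]
    · ext v
      simp
      ring

/-- The `κ`-twisted Cartan-Dirac structure `E_G^κ`. -/
def cartanDirac (B : LinearMap.BilinForm ℝ (GroupLieAlgebra I G)) (κ : MulAut G) :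
    (g : G) → Submodule ℝ (Pont I g) := fun g =>
  LinearMap.range (eMap B κ g)

/-- The `2`-form `ς = -1/2 θ^{L,1} · θ^{R,2}` on `G × G`. -/
def sigmaForm (B : LinearMap.BilinForm ℝ (GroupLieAlgebra I G)) : DiffForm (I.prod I) (G × G) 2 :=
  (-(1 / 2) : ℝ) • dotWedge B (pullback₁ Prod.fst (thetaL I G)) (pullback₁ Prod.snd (thetaR I G))

/-- The `2`-form `ς^κ = (1 × κ)^* ς` on `G × G`. -/
def sigmaTw (B : LinearMap.BilinForm ℝ (GroupLieAlgebra I G)) (κ : MulAut G) :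
    DiffForm (I.prod I) (G × G) 2 :=
  pullback (Prod.map id κ) (sigmaForm B)

/-- The orthogonal direct sum of forms on `Lie (G × K) = Lie G ⊕ Lie K`. -/
def prodForm (B : LinearMap.BilinForm ℝ (GroupLieAlgebra I G))
    (B' : LinearMap.BilinForm ℝ (GroupLieAlgebra J K)) :
    LinearMap.BilinForm ℝ (GroupLieAlgebra (I.prod J) (G × K)) :=
  B.compl₁₂ (mfderiv (I.prod J) I (Prod.fst : G × K → G) 1).toLinearMap
      (mfderiv (I.prod J) I (Prod.fst : G × K → G) 1).toLinearMap
    + B'.compl₁₂ (mfderiv (I.prod J) J (Prod.snd : G × K → K) 1).toLinearMap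
      (mfderiv (I.prod J) J (Prod.snd : G × K → K) 1).toLinearMap

/-- The automorphism `κ × τ` of `G × K`. -/
def prodAut (κ : MulAut G) (τ : MulAut K) : MulAut (G × K) := MulEquiv.prodCongr κ τ

variable {EM : Type*} [NormedAddCommGroup EM] [NormedSpace ℝ EM]
  {HM : Type*} [TopologicalSpace HM] {IM : ModelWithCorners ℝ EM HM}
  {M : Type*} [TopologicalSpace M] [ChartedSpace HM M]

variable (I IM) in
/-- The generating vector field `ξ_M(x) = d/dt|_{t=0} exp(-tξ) · x` of an action of `G`. -/
def fundField [MulAction G M] (ξ : GroupLieAlgebra I G) (x : M) : TangentSpace IM x :=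
  -((mfderiv I IM (fun g : G => g • x) 1 :
    TangentSpace I (1 : G) →L[ℝ] TangentSpace IM ((1 : G) • x)) ξ)

/-- `(M, ϖ, Φ)` is a `Gκ`-valued twisted quasi-Hamiltonian `G`-space. -/
structure IsTqHamiltonian [LieGroup I ∞ G] [MulAction G M]
    (B : LinearMap.BilinForm ℝ (GroupLieAlgebra I G)) (κ : MulAut G)
    (ϖ : DiffForm IM M 2) (Φ : M → G) : Prop where
  smooth_action : ContMDiffSMul I IM ∞ G M
  smooth_form : IsSmoothForm ϖ
  smooth_moment : ContMDiff IM I ∞ Φ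
  invariant : ∀ g : G, pullback (fun x : M => g • x) ϖ = ϖ
  equivariant : ∀ (g : G) (x : M), Φ (g • x) = twConj κ g (Φ x)
  differential : extD ϖ = pullback Φ (cartanForm B)
  moment : ∀ (ξ : GroupLieAlgebra I G) (x : M) (v : TangentSpace IM x),
    ϖ x ![fundField I IM ξ x, v] =
      1 / 2 * (B (pullback₁ Φ (thetaL I G) x v) (lieAut I κ ξ)
        + B (pullback₁ Φ (thetaR I G) x v) ξ)
  nondegenerate : ∀ (x : M) (v : TangentSpace IM x),
    (∀ w : TangentSpace IM x, ϖ x ![v, w] = 0) → mfderiv IM I Φ x v = 0 → v = 0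

/-- The action of `G × K` on a `G × G × K`-space in which `G` acts diagonally. -/
abbrev fusedAction (G K M : Type*) [Group G] [Group K] [MulAction (G × G × K) M] :
    MulAction (G × K) M :=
  MulAction.compHom M
    ((MonoidHom.fst G K).prod ((MonoidHom.fst G K).prod (MonoidHom.snd G K)))

end LieGroups

end TqHam

end

open TqHam
open scoped Manifold ContDiff

/-!
# Multiplicative properties of twisted Cartan–Dirac structures

All parts of the theorem rest on one property of the sections
`e^κ(ξ) = (κ(ξ)^L - ξ^R) ⊕ ½ (θ^L · κ(ξ) + θ^R · ξ)` (`eMap`) which span the twisted Cartan–Dirac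
structure: they are compatible with twisted multiplication.

**Calculus.** Differential forms are handled in charts. The exterior derivative commutes with
pull-backs (`extD_pullback`), satisfies Cartan's formula on vector fields
(`extD_oneForm_vectorField`) and the Leibniz rule for the product of vector-valued one-forms
(`extD_dotWedge`). On a Lie group this gives the Maurer–Cartan equations (`extD_thetaL`,
`extD_thetaR`). Comparing them with `μ^* θ^L = Ad_{b⁻¹} pr₁^* θ^L + pr₂^* θ^L` identifies the
derivative of `Ad` with the bracket (`mvfderiv_covector_adj_inv`), so that an `Ad`-invariant form
`B` is also `ad`-invariant (`IsInvariantForm.ad`). The Cartan form `η` is closed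
(`extD_cartanForm`): it is invariant under translations and changes sign under inversion, while
inversion acts on invariant four-forms by `+1`. The form `η` is multiplicative up to an exact term,
`μ^* η = pr₁^* η + pr₂^* η + d ς` (`pullback_mul_cartanForm`). Composing with `1 × κ₁` gives the
twisted version (`pullback_twMult_cartanForm`).

**The Dirac structure.** The subspace spanned by the `e^κ(ξ)` is isotropic by invariance of `B`,
and it is its own orthogonal because `B` is non-degenerate (`mem_cartanDirac_iff`). For Lagrangian
subbundles the expression `⟨⟦e₁, e₂⟧, e₃⟩` is tensorial, so that involutivity may be tested on a
frame (`courant_mem_of_frame`). On the frame `e^κ(ξ)` it vanishes (`courantTriple_eMap`). The direct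
sum of two such structures is the Cartan–Dirac structure of the product group
(`directSum_cartanDirac`), so it needs no separate treatment.

**Dirac morphisms.** The section `e^{κ₁}(ξ) ⊕ e^{κ₂}(ξ)` of the direct sum is related to
`e^{κ₁κ₂}(ξ)` by twisted multiplication and the two-form `ς^{κ₁}`. This is an identity between
values of Maurer–Cartan forms (`thetaL_eMap_mul_fst`, `eMap_mul_snd`). It provides the lifts
required of a strong Dirac morphism, and the two conditions on a lift determine its parameters
`(ξ₁, ξ₂)` (`existsUnique_lift_twMult`). Inversion exchanges `θ^L` and `θ^R`
up to sign, and maps `e^κ(ξ)` to the opposite of a section of the same kind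
(`isDiracMorphism_twInv`).

**Quasi-Hamiltonian spaces.** Equivariance of a moment map `Φ` says that `Φ_*` takes the generating
field `ξ_M` to the vector part of `e^κ(ξ)` (`IsTqHamiltonian.mfderiv_fundField`), and the moment
condition says that `ι_{ξ_M} ω` is the pull-back of its covector part. The moment condition of a
fusion is therefore the pull-back of the fusion identity (`eMap_fusion`), and its condition on
`d ω` is the pull-back of the multiplicativity of `η` (`pullback_fusion_cartanForm`).
For non-degeneracy, let `v` lie in the kernel of both the fused form and the fused moment map.
Contracting with the generating vectors of the first factor `G` alone gives `Φ₁_* v = 0`, hence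
`Φ₂_* v = 0`, and then the correction term of the fused form vanishes on `v`, so that `v` lies in
both kernels for the original space (`fusion_nondegenerate`). The fusion product is treated by
the same lemmas, on the product of the two spaces.
-/

set_option linter.unusedSectionVars false

noncomputable section

namespace TqHam

/-! ### Smooth families of alternating forms -/

section AlternatingSmooth

variable {E F : Type*} [NormedAddCommGroup E] [NormedSpace ℝ E] [FiniteDimensional ℝ E]
  [NormedAddCommGroup F] [NormedSpace ℝ F] {k : ℕ}

theorem contDiffWithinAt_alternating_iff {f : F → E [⋀^Fin k]→L[ℝ] ℝ} {s : Set F} {x : F}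
    {n : ℕ∞ω} :
    ContDiffWithinAt ℝ n f s x ↔ ∀ v : Fin k → E, ContDiffWithinAt ℝ n (fun y => f y v) s x := by
  constructor
  · intro h v
    exact (ContinuousAlternatingMap.apply ℝ E ℝ v).contDiff.comp_contDiffWithinAt h
  · intro h
    let b := Module.finBasis ℝ E
    let J : (E [⋀^Fin k]→L[ℝ] ℝ) →ₗ[ℝ] ((Fin k → Fin (Module.finrank ℝ E)) → ℝ) :=
      { toFun := fun f s => f (fun i => b (s i))
        map_add' := fun _ _ => rfl
        map_smul' := fun _ _ => rfl }
    have hJ : Function.Injective J := by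
      intro f g hfg
      have : f.toAlternatingMap = g.toAlternatingMap := by
        refine Module.Basis.ext_alternating b fun v _ => ?_
        exact congrFun hfg v
      ext v
      exact congrArg (fun a : E [⋀^Fin k]→ₗ[ℝ] ℝ => a v) this
    have : FiniteDimensional ℝ (E [⋀^Fin k]→L[ℝ] ℝ) := FiniteDimensional.of_injective J hJ
    obtain ⟨K, hK⟩ := J.exists_leftInverse_of_injective (LinearMap.ker_eq_bot.2 hJ)
    have h2 : f = fun y => K.toContinuousLinearMap (J (f y)) := by
      funext y
      exact (congrArg (fun L => L (f y)) hK).symm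
    rw [h2]
    refine K.toContinuousLinearMap.contDiff.comp_contDiffWithinAt ?_
    exact contDiffWithinAt_pi.2 fun s => h _

theorem ContDiffWithinAt.alternating_apply {f : F → E [⋀^Fin k]→L[ℝ] ℝ} {g : Fin k → F → E}
    {s : Set F} {x : F} {n : ℕ∞ω} (hf : ContDiffWithinAt ℝ n f s x)
    (hg : ∀ i, ContDiffWithinAt ℝ n (g i) s x) :
    ContDiffWithinAt ℝ n (fun y => f y (fun i => g i y)) s x := by
  let b := Module.finBasis ℝ E
  have key : (fun y => f y (fun i => g i y)) = fun y =>
      ∑ r : Fin k → Fin (Module.finrank ℝ E),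
        (∏ i, b.coord (r i) (g i y)) • f y (fun i => b (r i)) := by
    funext y
    have h1 : (fun i => g i y) = fun i => ∑ j, b.coord j (g i y) • b j := by
      funext i
      exact (b.sum_repr (g i y)).symm
    conv_lhs => rw [h1]
    have := (f y).toMultilinearMap.map_sum (fun i j => b.coord j (g i y) • b j)
    refine this.trans (Finset.sum_congr rfl fun r _ => ?_)
    exact (f y).toMultilinearMap.map_smul_univ _ _
  rw [key]
  refine ContDiffWithinAt.sum fun r _ => ContDiffWithinAt.fun_smul ?_
    (contDiffWithinAt_alternating_iff.1 hf _)
  refine contDiffWithinAt_prod fun i _ => ?_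
  exact (LinearMap.toContinuousLinearMap (b.coord (r i))).contDiff.comp_contDiffWithinAt (hg i)

theorem contDiffOn_alternating_iff {f : F → E [⋀^Fin k]→L[ℝ] ℝ} {s : Set F} {n : ℕ∞ω} :
    ContDiffOn ℝ n f s ↔ ∀ v : Fin k → E, ContDiffOn ℝ n (fun y => f y v) s :=
  ⟨fun h v x hx => contDiffWithinAt_alternating_iff.1 (h x hx) v,
    fun h x hx => contDiffWithinAt_alternating_iff.2 fun v => h v x hx⟩

end AlternatingSmooth

/-! ### Differential forms in charts -/

section Charts

variable {E : Type*} [NormedAddCommGroup E] [NormedSpace ℝ E]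
  {H : Type*} [TopologicalSpace H] {I : ModelWithCorners ℝ E H}
  {M : Type*} [TopologicalSpace M] [ChartedSpace H M]
  {E' : Type*} [NormedAddCommGroup E'] [NormedSpace ℝ E']
  {H' : Type*} [TopologicalSpace H'] {I' : ModelWithCorners ℝ E' H'}
  {M' : Type*} [TopologicalSpace M'] [ChartedSpace H' M']

theorem isSmoothForm_iff {k : ℕ} {ϖ : DiffForm I M k} :
    IsSmoothForm ϖ ↔ ∀ x₀ : M, ContDiffOn ℝ ∞ (inChart ϖ x₀) (extChartAt I x₀).target := by
  simp [IsSmoothForm, IsSmoothFormOn]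

theorem isSmoothForm_iff_apply [FiniteDimensional ℝ E] {k : ℕ} {ϖ : DiffForm I M k} :
    IsSmoothForm ϖ ↔ ∀ (x₀ : M) (v : Fin k → E),
      ContDiffOn ℝ ∞ (fun y => inChart ϖ x₀ y v) (extChartAt I x₀).target := by
  rw [isSmoothForm_iff]
  exact forall_congr' fun x₀ => contDiffOn_alternating_iff

/-- All tangent spaces are the model space `E`, so `v` may be used at either of two equal points. -/
theorem form_congr_point {k : ℕ} (ϖ : DiffForm I M k) {x x' : M} (h : x = x') (v : Fin k → E) :
    ϖ x v = ϖ x' v := by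
  subst h; rfl

/-- The differential of the inverse chart at `x₀`. -/
def chartSymmDeriv (I : ModelWithCorners ℝ E H) (x₀ : M) (y : E) :
    E →L[ℝ] TangentSpace I ((extChartAt I x₀).symm y) :=
  mfderiv 𝓘(ℝ, E) I (extChartAt I x₀).symm y

theorem inChart_apply [I.Boundaryless] {k : ℕ} (ϖ : DiffForm I M k) (x₀ : M) (y : E)
    (v : Fin k → E) :
    inChart ϖ x₀ y v = ϖ ((extChartAt I x₀).symm y) fun i => chartSymmDeriv I x₀ y (v i) := by
  unfold inChart chartSymmDeriv
  rw [I.range_eq_univ, mfderivWithin_univ]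
  rfl

variable [IsManifold I ∞ M] [IsManifold I' ∞ M']

theorem mdifferentiableAt_extChartAt_symm [I.Boundaryless] {x₀ : M} {y : E}
    (hy : y ∈ (extChartAt I x₀).target) :
    MDifferentiableAt 𝓘(ℝ, E) I (extChartAt I x₀).symm y :=
  ((contMDiffOn_extChartAt_symm (n := ∞) x₀).contMDiffAt
    ((isOpen_extChartAt_target x₀).mem_nhds hy)).mdifferentiableAt (by simp)

theorem contDiffAt_writtenInCharts [I.Boundaryless] {Φ : M → M'} (hΦ : ContMDiff I I' ∞ Φ)
    {x₀ : M} {x₀' : M'} {y : E} (hy : y ∈ (extChartAt I x₀).target)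
    (hy' : Φ ((extChartAt I x₀).symm y) ∈ (extChartAt I' x₀').source) :
    ContDiffAt ℝ ∞ (extChartAt I' x₀' ∘ Φ ∘ (extChartAt I x₀).symm) y := by
  rw [← contMDiffAt_iff_contDiffAt]
  have h1 : ContMDiffAt 𝓘(ℝ, E) I ∞ (extChartAt I x₀).symm y :=
    (contMDiffOn_extChartAt_symm (n := ∞) x₀).contMDiffAt
      ((isOpen_extChartAt_target x₀).mem_nhds hy)
  have h2 : ContMDiffAt I' 𝓘(ℝ, E') ∞ (extChartAt I' x₀') (Φ ((extChartAt I x₀).symm y)) :=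
    contMDiffAt_extChartAt' (by rwa [← extChartAt_source I'])
  exact h2.comp y (hΦ.contMDiffAt.comp y h1)

theorem mfderiv_chartSymmDeriv [I.Boundaryless] [I'.Boundaryless] {Φ : M → M'}
    (hΦ : ContMDiff I I' ∞ Φ)
    {x₀ : M} {x₀' : M'} {y : E} (hy : y ∈ (extChartAt I x₀).target)
    (hy' : Φ ((extChartAt I x₀).symm y) ∈ (extChartAt I' x₀').source) (v : E) :
    (mfderiv I I' Φ ((extChartAt I x₀).symm y) (chartSymmDeriv I x₀ y v) : E') =
      chartSymmDeriv I' x₀' ((extChartAt I' x₀' ∘ Φ ∘ (extChartAt I x₀).symm) y)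
        (fderiv ℝ (extChartAt I' x₀' ∘ Φ ∘ (extChartAt I x₀).symm) y v) := by
  have h1 := mdifferentiableAt_extChartAt_symm hy
  have h3 := contDiffAt_writtenInCharts hΦ hy hy'
  have hΦy : MDifferentiableAt I I' Φ ((extChartAt I x₀).symm y) :=
    hΦ.mdifferentiableAt (by simp)
  have e1 : mfderiv 𝓘(ℝ, E) I' (Φ ∘ (extChartAt I x₀).symm) y v =
      mfderiv I I' Φ ((extChartAt I x₀).symm y) (chartSymmDeriv I x₀ y v) :=
    mfderiv_comp_apply y hΦy h1 v
  have hev : Φ ∘ (extChartAt I x₀).symm =ᶠ[nhds y]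
      (extChartAt I' x₀').symm ∘ (extChartAt I' x₀' ∘ Φ ∘ (extChartAt I x₀).symm) := by
    have hc : ContinuousAt (Φ ∘ (extChartAt I x₀).symm) y :=
      ContinuousAt.comp hΦ.continuous.continuousAt h1.continuousAt
    filter_upwards [hc.preimage_mem_nhds ((isOpen_extChartAt_source x₀').mem_nhds hy')] with z hz
    exact ((extChartAt I' x₀').left_inv hz).symm
  have h4 : MDifferentiableAt 𝓘(ℝ, E') I' (extChartAt I' x₀').symm
      ((extChartAt I' x₀' ∘ Φ ∘ (extChartAt I x₀).symm) y) :=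
    mdifferentiableAt_extChartAt_symm ((extChartAt I' x₀').map_source hy')
  have h5 : MDifferentiableAt 𝓘(ℝ, E) 𝓘(ℝ, E') (extChartAt I' x₀' ∘ Φ ∘ (extChartAt I x₀).symm) y :=
    (h3.differentiableAt (by simp)).mdifferentiableAt
  have e2 := mfderiv_comp_apply y h4 h5 v
  rw [mfderiv_eq_fderiv] at e2
  rw [← e1]
  have e3 := hev.mfderiv_eq (I := 𝓘(ℝ, E)) (I' := I')
  exact (congrArg (fun L : E →L[ℝ] E' => L v) e3).trans e2

/-- In charts, the pullback of forms is the pullback along the coordinate expression of the map. -/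
theorem inChart_pullback [I.Boundaryless] [I'.Boundaryless] {Φ : M → M'} (hΦ : ContMDiff I I' ∞ Φ)
    {k : ℕ} (ϖ : DiffForm I' M' k) {x₀ : M} {x₀' : M'} {y : E}
    (hy : y ∈ (extChartAt I x₀).target)
    (hy' : Φ ((extChartAt I x₀).symm y) ∈ (extChartAt I' x₀').source) :
    inChart (pullback (I := I) Φ ϖ) x₀ y =
      (inChart ϖ x₀' ((extChartAt I' x₀' ∘ Φ ∘ (extChartAt I x₀).symm) y)).compContinuousLinearMap
        (fderiv ℝ (extChartAt I' x₀' ∘ Φ ∘ (extChartAt I x₀).symm) y) := by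
  ext v
  rw [inChart_apply, ContinuousAlternatingMap.compContinuousLinearMap_apply, inChart_apply]
  have hb : Φ ((extChartAt I x₀).symm y) =
      (extChartAt I' x₀').symm ((extChartAt I' x₀' ∘ Φ ∘ (extChartAt I x₀).symm) y) :=
    ((extChartAt I' x₀').left_inv hy').symm
  refine Eq.trans ?_ (form_congr_point ϖ hb _)
  change ϖ _ (fun i => mfderiv I I' Φ _ (chartSymmDeriv I x₀ y (v i))) = _
  congr 1
  funext i
  exact mfderiv_chartSymmDeriv hΦ hy hy' (v i)

theorem eventually_mem_source_of_continuous [I.Boundaryless] {Φ : M → M'}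
    (hΦ : Continuous Φ) {x₀ : M} {x₀' : M'} {y : E} (hy : y ∈ (extChartAt I x₀).target)
    (hy' : Φ ((extChartAt I x₀).symm y) ∈ (extChartAt I' x₀').source) :
    ∀ᶠ z in nhds y, z ∈ (extChartAt I x₀).target ∧
      Φ ((extChartAt I x₀).symm z) ∈ (extChartAt I' x₀').source := by
  have hc : ContinuousAt (Φ ∘ (extChartAt I x₀).symm) y :=
    ContinuousAt.comp hΦ.continuousAt (continuousAt_extChartAt_symm'' hy)
  exact ((isOpen_extChartAt_target x₀).mem_nhds hy |> Filter.eventually_of_mem <| fun _ h => h).and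
    (hc.preimage_mem_nhds ((isOpen_extChartAt_source x₀').mem_nhds hy'))

theorem IsSmoothForm.contDiffAt [I.Boundaryless] {k : ℕ} {ϖ : DiffForm I M k}
    (h : IsSmoothForm ϖ) {x₀ : M} {y : E} (hy : y ∈ (extChartAt I x₀).target) :
    ContDiffAt ℝ ∞ (inChart ϖ x₀) y :=
  (isSmoothForm_iff.1 h x₀).contDiffAt ((isOpen_extChartAt_target x₀).mem_nhds hy)

theorem IsSmoothForm.pullback [I.Boundaryless] [I'.Boundaryless] [FiniteDimensional ℝ E]
    [FiniteDimensional ℝ E'] {Φ : M → M'} (hΦ : ContMDiff I I' ∞ Φ)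
    {k : ℕ} {ϖ : DiffForm I' M' k} (h : IsSmoothForm ϖ) :
    IsSmoothForm (TqHam.pullback (I := I) Φ ϖ) := by
  rw [isSmoothForm_iff_apply]
  intro x₀ v y hy
  have hy' := mem_extChartAt_source (I := I') (Φ ((extChartAt I x₀).symm y))
  have hs := contDiffAt_writtenInCharts hΦ hy hy'
  refine ContDiffAt.contDiffWithinAt ?_
  have hev : (fun z => inChart (TqHam.pullback (I := I) Φ ϖ) x₀ z v) =ᶠ[nhds y] fun z =>
      inChart ϖ (Φ ((extChartAt I x₀).symm y))
        ((extChartAt I' (Φ ((extChartAt I x₀).symm y)) ∘ Φ ∘ (extChartAt I x₀).symm) z)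
        fun i => fderiv ℝ (extChartAt I' (Φ ((extChartAt I x₀).symm y)) ∘ Φ ∘
          (extChartAt I x₀).symm) z (v i) := by
    filter_upwards [eventually_mem_source_of_continuous hΦ.continuous hy hy'] with z hz
    rw [inChart_pullback hΦ ϖ hz.1 hz.2]
    rfl
  refine ContDiffAt.congr_of_eventuallyEq ?_ hev
  have h1 := (h.contDiffAt ((extChartAt I' _).map_source hy')).comp y hs
  have h2 : ∀ i, ContDiffAt ℝ ∞ (fun z => fderiv ℝ (extChartAt I' (Φ ((extChartAt I x₀).symm y)) ∘
      Φ ∘ (extChartAt I x₀).symm) z (v i)) y := fun i =>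
    (hs.fderiv_right (m := ∞) (by simp)).clm_apply contDiffAt_const
  simp only [← contDiffWithinAt_univ] at h1 h2 ⊢
  exact ContDiffWithinAt.alternating_apply h1 h2

theorem extD_apply [I.Boundaryless] {k : ℕ} (ϖ : DiffForm I M k) (x : M)
    (v : Fin (k + 1) → TangentSpace I x) :
    extD ϖ x v = extDeriv (inChart ϖ x) (extChartAt I x x) v := by
  unfold extD
  rw [I.range_eq_univ, extDerivWithin_univ]
  have : IsManifold I 1 M := IsManifold.of_le (n := ∞) (by simp)
  rw [mfderiv_extChartAt_self]
  rfl

/-- The exterior derivative commutes with pullback; in charts this is `extDeriv_pullback`. -/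
theorem extD_pullback [I.Boundaryless] [I'.Boundaryless] {Φ : M → M'} (hΦ : ContMDiff I I' ∞ Φ)
    {k : ℕ} {ϖ : DiffForm I' M' k} (h : IsSmoothForm ϖ) :
    extD (pullback (I := I) Φ ϖ) = pullback Φ (extD ϖ) := by
  funext x
  ext v
  have hx := mem_extChartAt_target (I := I) x
  have hx1 : (extChartAt I x).symm (extChartAt I x x) = x := extChartAt_to_inv x
  have hx' : Φ ((extChartAt I x).symm (extChartAt I x x)) ∈ (extChartAt I' (Φ x)).source := by
    rw [hx1]; exact mem_extChartAt_source _
  have hev : inChart (pullback (I := I) Φ ϖ) x =ᶠ[nhds (extChartAt I x x)] fun z =>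
      (inChart ϖ (Φ x)
        ((extChartAt I' (Φ x) ∘ Φ ∘ (extChartAt I x).symm) z)).compContinuousLinearMap
        (fderiv ℝ (extChartAt I' (Φ x) ∘ Φ ∘ (extChartAt I x).symm) z) := by
    filter_upwards [eventually_mem_source_of_continuous hΦ.continuous hx hx'] with z hz
    exact inChart_pullback hΦ ϖ hz.1 hz.2
  have hpt : (extChartAt I' (Φ x) ∘ Φ ∘ (extChartAt I x).symm) (extChartAt I x x) =
      extChartAt I' (Φ x) (Φ x) := by simp
  have hd : mfderiv I I' Φ x =
      fderiv ℝ (extChartAt I' (Φ x) ∘ Φ ∘ (extChartAt I x).symm) (extChartAt I x x) := by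
    rw [(hΦ.mdifferentiableAt (by simp)).mfderiv, I.range_eq_univ, fderivWithin_univ]
    rfl
  rw [extD_apply, hev.extDeriv_eq, extDeriv_pullback (r := ∞), hpt]
  · change _ = extD ϖ (Φ x) (fun i => mfderiv I I' Φ x (v i))
    rw [extD_apply, hd]
    rfl
  · rw [hpt]
    exact (h.contDiffAt (mem_extChartAt_target _)).differentiableAt (by simp)
  · exact contDiffAt_writtenInCharts hΦ hx hx'
  · rw [minSmoothness_of_isRCLikeNormedField]
    exact ENat.LEInfty.out

end Charts

/-! ### Linear combinations of forms -/

section FormAlgebra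

variable {E : Type*} [NormedAddCommGroup E] [NormedSpace ℝ E]
  {H : Type*} [TopologicalSpace H] {I : ModelWithCorners ℝ E H}
  {M : Type*} [TopologicalSpace M] [ChartedSpace H M] {k : ℕ}

theorem IsSmoothForm.zero : IsSmoothForm (0 : DiffForm I M k) :=
  isSmoothForm_iff.2 fun _ => contDiffOn_const (c := 0)

theorem IsSmoothForm.add {ϖ ϖ' : DiffForm I M k} (h : IsSmoothForm ϖ) (h' : IsSmoothForm ϖ') :
    IsSmoothForm (ϖ + ϖ') :=
  isSmoothForm_iff.2 fun x₀ => (isSmoothForm_iff.1 h x₀).add (isSmoothForm_iff.1 h' x₀)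

theorem IsSmoothForm.const_smul {ϖ : DiffForm I M k} (c : ℝ) (h : IsSmoothForm ϖ) :
    IsSmoothForm (c • ϖ) :=
  isSmoothForm_iff.2 fun x₀ => (isSmoothForm_iff.1 h x₀).const_smul c

theorem IsSmoothForm.neg {ϖ : DiffForm I M k} (h : IsSmoothForm ϖ) : IsSmoothForm (-ϖ) :=
  isSmoothForm_iff.2 fun x₀ => (isSmoothForm_iff.1 h x₀).neg

theorem IsSmoothForm.sum {ι : Type*} {s : Finset ι} {ϖ : ι → DiffForm I M k}
    (h : ∀ i ∈ s, IsSmoothForm (ϖ i)) : IsSmoothForm (∑ i ∈ s, ϖ i) := by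
  classical
  induction s using Finset.induction_on with
  | empty => simpa using IsSmoothForm.zero
  | insert a s ha ih =>
    rw [Finset.sum_insert ha]
    exact (h _ (by simp)).add (ih fun i hi => h i (by simp [hi]))

variable [I.Boundaryless] [IsManifold I ∞ M]

theorem extD_add {ϖ ϖ' : DiffForm I M k} (h : IsSmoothForm ϖ) (h' : IsSmoothForm ϖ') :
    extD (ϖ + ϖ') = extD ϖ + extD ϖ' := by
  funext x
  ext v
  have hx := mem_extChartAt_target (I := I) x
  have e : inChart (ϖ + ϖ') x = inChart ϖ x + inChart ϖ' x := rfl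
  change _ = extD ϖ x v + extD ϖ' x v
  rw [extD_apply, extD_apply, extD_apply, e,
    extDeriv_add ((h.contDiffAt hx).differentiableAt (by simp))
      ((h'.contDiffAt hx).differentiableAt (by simp))]
  rfl

theorem extD_const_smul (c : ℝ) (ϖ : DiffForm I M k) : extD (c • ϖ) = c • extD ϖ := by
  funext x
  ext v
  have e : inChart (c • ϖ) x = c • inChart ϖ x := rfl
  change _ = c * extD ϖ x v
  rw [extD_apply, extD_apply, e, extDeriv_smul]
  rfl

theorem extD_neg (ϖ : DiffForm I M k) : extD (-ϖ) = -extD ϖ := by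
  have e (j : ℕ) (ϖ : DiffForm I M j) : (-1 : ℝ) • ϖ = -ϖ := by
    funext x
    exact neg_one_smul ℝ (ϖ x)
  rw [← e, extD_const_smul, e]

theorem extD_zero : extD (0 : DiffForm I M k) = 0 := by
  have h := extD_const_smul 0 (0 : DiffForm I M k)
  simpa only [zero_smul] using h

theorem extD_sum {ι : Type*} {s : Finset ι} {ϖ : ι → DiffForm I M k}
    (h : ∀ i ∈ s, IsSmoothForm (ϖ i)) : extD (∑ i ∈ s, ϖ i) = ∑ i ∈ s, extD (ϖ i) := by
  classical
  induction s using Finset.induction_on with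
  | empty => simpa using extD_zero
  | insert a s ha ih =>
    rw [Finset.sum_insert ha, Finset.sum_insert ha, extD_add (h _ (by simp))
      (IsSmoothForm.sum fun i hi => h i (by simp [hi])), ih fun i hi => h i (by simp [hi])]

end FormAlgebra

/-! ### Sums over the permutations of two and three letters -/

section Permutations

theorem sum_perm_fin_two (f : Equiv.Perm (Fin 2) → ℝ) :
    ∑ σ, f σ = f 1 + f (Equiv.swap 0 1) := by
  have : (Finset.univ : Finset (Equiv.Perm (Fin 2))) = {1, Equiv.swap 0 1} := by decide
  rw [this, Finset.sum_pair (by decide)]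

theorem sum_perm_fin_three (f : Equiv.Perm (Fin 3) → ℝ) :
    ∑ σ, f σ = f 1 + f (Equiv.swap 0 1) + f (Equiv.swap 0 2) + f (Equiv.swap 1 2) +
      f (Equiv.swap 0 1 * Equiv.swap 1 2) + f (Equiv.swap 1 2 * Equiv.swap 0 1) := by
  have : (Finset.univ : Finset (Equiv.Perm (Fin 3))) = {1, Equiv.swap 0 1, Equiv.swap 0 2,
    Equiv.swap 1 2, Equiv.swap 0 1 * Equiv.swap 1 2, Equiv.swap 1 2 * Equiv.swap 0 1} := by decide
  rw [this, Finset.sum_insert (by decide), Finset.sum_insert (by decide),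
    Finset.sum_insert (by decide), Finset.sum_insert (by decide), Finset.sum_pair (by decide)]
  ring

end Permutations

/-! ### One-forms, vector fields, and Cartan's formula -/

section OneForms

variable {E : Type*} [NormedAddCommGroup E] [NormedSpace ℝ E]
  {H : Type*} [TopologicalSpace H] {I : ModelWithCorners ℝ E H}
  {M : Type*} [TopologicalSpace M] [ChartedSpace H M]

/-- The expression of a `1`-form in the chart at `x₀`. -/
def chartCovector (α : OneForm I M ℝ) (x₀ : M) (y : E) : E →L[ℝ] ℝ :=
  (α ((extChartAt I x₀).symm y)).comp (chartSymmDeriv I x₀ y)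

theorem inChart_oneForm [I.Boundaryless] (α : OneForm I M ℝ) (x₀ : M) (y : E) (v : Fin 1 → E) :
    inChart (oneForm α) x₀ y v = chartCovector α x₀ y (v 0) := by
  rw [inChart_apply]; rfl

theorem dotWedge_apply {W : Type*} [TopologicalSpace W] [AddCommGroup W] [Module ℝ W]
    [IsTopologicalAddGroup W] [ContinuousSMul ℝ W] [T2Space W] [FiniteDimensional ℝ W]
    (B : LinearMap.BilinForm ℝ W) (α β : OneForm I M W) (x : M) (v : Fin 2 → TangentSpace I x) :
    dotWedge B α β x v = B (α x (v 0)) (β x (v 1)) - B (α x (v 1)) (β x (v 0)) := by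
  simp only [dotWedge, ContinuousMultilinearMap.alternatization_apply_apply]
  rw [sum_perm_fin_two]
  change Equiv.Perm.sign (1 : Equiv.Perm (Fin 2)) • B (α x (v 0)) (β x (v 1)) +
    Equiv.Perm.sign (Equiv.swap (0 : Fin 2) 1) • B (α x (v (Equiv.swap (0 : Fin 2) 1 0)))
      (β x (v (Equiv.swap (0 : Fin 2) 1 1))) = _
  simp [sub_eq_add_neg]

theorem chartCovector_contDiffOn [I.Boundaryless] [FiniteDimensional ℝ E] {α : OneForm I M ℝ}
    (h : IsSmoothForm (oneForm α)) (x₀ : M) :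
    ContDiffOn ℝ ∞ (chartCovector α x₀) (extChartAt I x₀).target := by
  rw [contDiffOn_clm_apply]
  intro w
  exact (isSmoothForm_iff_apply.1 h x₀ fun _ => w).congr fun y _ =>
    (inChart_oneForm α x₀ y fun _ => w).symm

theorem isSmoothForm_oneForm_iff [I.Boundaryless] [FiniteDimensional ℝ E] {α : OneForm I M ℝ} :
    IsSmoothForm (oneForm α) ↔ ∀ (x₀ : M) (w : E),
      ContDiffOn ℝ ∞ (fun y => chartCovector α x₀ y w) (extChartAt I x₀).target := by
  rw [isSmoothForm_iff_apply]
  refine forall_congr' fun x₀ => ⟨fun h w => ?_, fun h v => ?_⟩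
  · exact (h fun _ => w).congr fun y _ => (inChart_oneForm α x₀ y fun _ => w).symm
  · exact (h (v 0)).congr fun y _ => inChart_oneForm α x₀ y v

variable [I.Boundaryless] [IsManifold I ∞ M] [FiniteDimensional ℝ E]

theorem chartCovector_differentiableAt {α : OneForm I M ℝ}
    (h : IsSmoothForm (oneForm α)) (x : M) :
    DifferentiableAt ℝ (chartCovector α x) (extChartAt I x x) :=
  ((chartCovector_contDiffOn h x).contDiffAt
    ((isOpen_extChartAt_target x).mem_nhds (mem_extChartAt_target x))).differentiableAt (by simp)

theorem chartSymmDeriv_self (x : M) (v : E) :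
    (chartSymmDeriv I x (extChartAt I x x) v : E) = v := by
  have : IsManifold I 1 M := IsManifold.of_le (n := ∞) (by simp)
  have h := mfderivWithin_range_extChartAt_symm (I := I) (x := x)
  rw [I.range_eq_univ, mfderivWithin_univ] at h
  exact congrArg (fun L : E →L[ℝ] E => L v) h

theorem oneForm_congr_point (α : OneForm I M ℝ) {x x' : M} (h : x = x') (v : E) :
    α x v = α x' v := by
  subst h; rfl

theorem chartCovector_self (α : OneForm I M ℝ) (x : M) (v : E) :
    chartCovector α x (extChartAt I x x) v = α x v := by
  change α _ (chartSymmDeriv I x (extChartAt I x x) v) = _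
  refine (oneForm_congr_point α (extChartAt_to_inv x) _).trans ?_
  exact congrArg (α x) (chartSymmDeriv_self x v)

theorem extD_oneForm_apply {α : OneForm I M ℝ} (h : IsSmoothForm (oneForm α)) (x : M)
    (u v : E) :
    extD (oneForm α) x ![u, v] =
      fderiv ℝ (chartCovector α x) (extChartAt I x x) u v -
        fderiv ℝ (chartCovector α x) (extChartAt I x x) v u := by
  have hd := chartCovector_differentiableAt h x
  refine (extD_apply (oneForm α) x ![u, v]).trans ?_
  refine (extDeriv_apply ((h.contDiffAt (mem_extChartAt_target x)).differentiableAt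
    (by simp)) (![u, v] : Fin 2 → E)).trans ?_
  have e (w : E) : fderiv ℝ (fun y => chartCovector α x y w) (extChartAt I x x) =
      (fderiv ℝ (chartCovector α x) (extChartAt I x x)).flip w := by
    rw [fderiv_clm_apply hd (by fun_prop)]
    ext; simp
  simp only [inChart_oneForm]
  rw [Fin.sum_univ_two]
  have e0 : (Fin.removeNth 0 ![u, v] : Fin 1 → E) 0 = v := rfl
  have e1 : (Fin.removeNth 1 ![u, v] : Fin 1 → E) 0 = u := rfl
  rw [e0, e1, e, e]
  simp [sub_eq_add_neg]

/-- The vector field `X` in the chart at `x₀`. -/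
def chartField (X : (x : M) → TangentSpace I x) (x₀ : M) : E → E :=
  VectorField.mpullbackWithin 𝓘(ℝ, E) I (extChartAt I x₀).symm X (Set.range I)

theorem chartSymmDeriv_chartField (X : (x : M) → TangentSpace I x) (x₀ : M) {y : E}
    (hy : y ∈ (extChartAt I x₀).target) :
    chartSymmDeriv I x₀ y (chartField X x₀ y) = X ((extChartAt I x₀).symm y) := by
  have : IsManifold I 1 M := IsManifold.of_le (n := ∞) (by simp)
  have h := isInvertible_mfderivWithin_extChartAt_symm hy
  have e : chartSymmDeriv I x₀ y =
    mfderivWithin 𝓘(ℝ, E) I (extChartAt I x₀).symm (Set.range I) y := by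
    rw [I.range_eq_univ, mfderivWithin_univ]; rfl
  rw [e]
  exact h.self_apply_inverse _

theorem chartField_contDiffAt {X : (x : M) → TangentSpace I x} {x : M}
    (hX : ContMDiffAt I I.tangent ∞ (fun x => (⟨x, X x⟩ : TangentBundle I M)) x) :
    ContDiffAt ℝ ∞ (chartField X x) (extChartAt I x x) := by
  have : CompleteSpace E := FiniteDimensional.complete ℝ E
  have h := VectorField.contMDiffWithinAt_mpullbackWithin_extChartAt_symm (n := ∞) (m := ∞)
    (s := Set.univ) hX.contMDiffWithinAt uniqueMDiffOn_univ (Set.mem_univ _) (by simp)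
  have h2 := (contMDiff_snd_tangentBundle_modelSpace E 𝓘(ℝ, E)).contMDiffAt.comp_contMDiffWithinAt
    _ h
  rw [contMDiffWithinAt_iff_contDiffWithinAt] at h2
  refine h2.contDiffAt ?_
  simpa using (isOpen_extChartAt_target x).mem_nhds (mem_extChartAt_target x)

theorem oneForm_apply_eq_chart (α : OneForm I M ℝ) (X : (x : M) → TangentSpace I x) (x₀ : M)
    {y : E} (hy : y ∈ (extChartAt I x₀).target) :
    α ((extChartAt I x₀).symm y) (X ((extChartAt I x₀).symm y)) =
      chartCovector α x₀ y (chartField X x₀ y) := by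
  rw [← chartSymmDeriv_chartField X x₀ hy]
  rfl

theorem contDiffAt_chart_apply {α : OneForm I M ℝ} (h : IsSmoothForm (oneForm α))
    {X : (x : M) → TangentSpace I x} {x : M}
    (hX : ContMDiffAt I I.tangent ∞ (fun x => (⟨x, X x⟩ : TangentBundle I M)) x) :
    ContDiffAt ℝ ∞ (fun y => chartCovector α x y (chartField X x y)) (extChartAt I x x) :=
  ((chartCovector_contDiffOn h x).contDiffAt
    ((isOpen_extChartAt_target x).mem_nhds (mem_extChartAt_target x))).clm_apply
      (chartField_contDiffAt hX)

/-- The function `α(X)` is smooth when the `1`-form `α` and the vector field `X` are. -/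
theorem contMDiff_oneForm_apply {α : OneForm I M ℝ} (h : IsSmoothForm (oneForm α))
    {X : (x : M) → TangentSpace I x}
    (hX : ContMDiff I I.tangent ∞ (fun x => (⟨x, X x⟩ : TangentBundle I M))) :
    ContMDiff I 𝓘(ℝ, ℝ) ∞ (fun x => α x (X x)) := by
  intro x
  have h1 : ContMDiffAt I 𝓘(ℝ, ℝ) ∞
      ((fun y => chartCovector α x y (chartField X x y)) ∘ extChartAt I x) x :=
    (contDiffAt_chart_apply h (hX x)).contMDiffAt.comp x contMDiffAt_extChartAt
  refine h1.congr_of_eventuallyEq ?_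
  filter_upwards [extChartAt_source_mem_nhds (I := I) x] with z hz
  have := oneForm_apply_eq_chart α X x ((extChartAt I x).map_source hz)
  rw [(extChartAt I x).left_inv hz] at this
  exact this

theorem mvfderiv_eq_fderiv_chart {f : M → ℝ} (hf : ContMDiff I 𝓘(ℝ, ℝ) ∞ f) (x : M) (v : E) :
    mvfderiv I f x v = fderiv ℝ (f ∘ (extChartAt I x).symm) (extChartAt I x x) v := by
  rw [(hf.mdifferentiableAt (by simp)).mvfderiv, I.range_eq_univ, fderivWithin_univ]
  rfl

theorem mlieBracket_eq_lieBracket (X Y : (x : M) → TangentSpace I x) (x : M) :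
    (VectorField.mlieBracket I X Y x : E) =
      VectorField.lieBracket ℝ (chartField X x) (chartField Y x) (extChartAt I x x) := by
  have : IsManifold I 1 M := IsManifold.of_le (n := ∞) (by simp)
  change (VectorField.mlieBracketWithin I X Y Set.univ x : E) = _
  have key : ∀ L : E →L[ℝ] E, L = ContinuousLinearMap.id ℝ E → ∀ w, L.inverse w = w := by
    rintro _ rfl w
    rw [ContinuousLinearMap.inverse_id]
    rfl
  rw [VectorField.mlieBracketWithin_apply]
  refine (key _ mfderiv_extChartAt_self _).trans ?_
  rw [Set.preimage_univ, Set.univ_inter, I.range_eq_univ]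
  simp only [chartField, I.range_eq_univ]
  exact congrFun VectorField.lieBracketWithin_univ _

theorem chartField_self (X : (x : M) → TangentSpace I x) (x : M) :
    chartField X x (extChartAt I x x) = X x := by
  have h1 := chartSymmDeriv_chartField X x (mem_extChartAt_target x)
  have h2 := chartSymmDeriv_self (I := I) x (chartField X x (extChartAt I x x))
  rw [← h2]
  refine Eq.trans h1 ?_
  congr 1
  exact extChartAt_to_inv x

/-- Cartan's formula `dα(X, Y) = X(α(Y)) - Y(α(X)) - α([X, Y])`. -/
theorem extD_oneForm_vectorField {α : OneForm I M ℝ} (h : IsSmoothForm (oneForm α))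
    {X Y : (x : M) → TangentSpace I x}
    (hX : ContMDiff I I.tangent ∞ (fun x => (⟨x, X x⟩ : TangentBundle I M)))
    (hY : ContMDiff I I.tangent ∞ (fun x => (⟨x, Y x⟩ : TangentBundle I M))) (x : M) :
    extD (oneForm α) x ![X x, Y x] =
      mvfderiv I (fun y => α y (Y y)) x (X x) - mvfderiv I (fun y => α y (X y)) x (Y x)
        - α x (VectorField.mlieBracket I X Y x) := by
  have hα := chartCovector_differentiableAt h x
  have hd (Z : (x : M) → TangentSpace I x)
      (hZ : ContMDiff I I.tangent ∞ (fun x => (⟨x, Z x⟩ : TangentBundle I M))) (u : E) :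
      mvfderiv I (fun y => α y (Z y)) x u =
        fderiv ℝ (chartCovector α x) (extChartAt I x x) u (Z x) +
          chartCovector α x (extChartAt I x x)
            (fderiv ℝ (chartField Z x) (extChartAt I x x) u) := by
    have hZ' : DifferentiableAt ℝ (chartField Z x) (extChartAt I x x) :=
      (chartField_contDiffAt (hZ x)).differentiableAt (by simp)
    rw [mvfderiv_eq_fderiv_chart (contMDiff_oneForm_apply h hZ)]
    have hev : (fun y => α y (Z y)) ∘ (extChartAt I x).symm =ᶠ[nhds (extChartAt I x x)]
        fun y => chartCovector α x y (chartField Z x y) := by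
      filter_upwards [(isOpen_extChartAt_target x).mem_nhds (mem_extChartAt_target x)] with y hy
      exact oneForm_apply_eq_chart α Z x hy
    rw [hev.fderiv_eq, fderiv_clm_apply hα hZ']
    have e := chartField_self Z x
    rw [← e, add_comm]
    rfl
  refine (extD_oneForm_apply h x (X x) (Y x)).trans ?_
  have e1 := hd Y hY (X x)
  have e2 := hd X hX (Y x)
  have e3 : α x (VectorField.mlieBracket I X Y x) =
      chartCovector α x (extChartAt I x x)
        (fderiv ℝ (chartField Y x) (extChartAt I x x) (X x)) -
      chartCovector α x (extChartAt I x x)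
        (fderiv ℝ (chartField X x) (extChartAt I x x) (Y x)) := by
    rw [← map_sub]
    refine (chartCovector_self α x (VectorField.mlieBracket I X Y x)).symm.trans ?_
    rw [mlieBracket_eq_lieBracket X Y x, VectorField.lieBracket, chartField_self,
      chartField_self]
  rw [e1, e2, e3]
  ring

theorem IsSmoothForm.fun_smul {k : ℕ} {ϖ : DiffForm I M k} (h : IsSmoothForm ϖ) {f : M → ℝ}
    (hf : ContMDiff I 𝓘(ℝ, ℝ) ∞ f) : IsSmoothForm (fun x => f x • ϖ x) := by
  rw [isSmoothForm_iff] at h ⊢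
  intro x₀
  have h1 : ContDiffOn ℝ ∞ (f ∘ (extChartAt I x₀).symm) (extChartAt I x₀).target := by
    rw [← contMDiffOn_iff_contDiffOn]
    exact hf.comp_contMDiffOn (contMDiffOn_extChartAt_symm x₀)
  exact h1.smul (h x₀)

theorem extD_fun_smul_oneForm {α : OneForm I M ℝ} (h : IsSmoothForm (oneForm α)) {f : M → ℝ}
    (hf : ContMDiff I 𝓘(ℝ, ℝ) ∞ f) (x : M) (u v : E) :
    extD (oneForm fun y => f y • α y) x ![u, v] =
      mvfderiv I f x u * α x v - mvfderiv I f x v * α x u + f x * extD (oneForm α) x ![u, v] := by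
  have h' : IsSmoothForm (oneForm fun y => f y • α y) := by
    have e : (oneForm fun y => f y • α y) = fun y => f y • oneForm α y := by
      funext y; ext; rfl
    rw [e]
    exact h.fun_smul hf
  have hc : DifferentiableAt ℝ (f ∘ (extChartAt I x).symm) (extChartAt I x x) := by
    have := (hf.comp_contMDiffOn (contMDiffOn_extChartAt_symm x)).contMDiffAt
        ((isOpen_extChartAt_target x).mem_nhds (mem_extChartAt_target x))
    exact (contMDiffAt_iff_contDiffAt.1 this).differentiableAt (by simp)
  have e : chartCovector (fun y => f y • α y) x = fun y => (f ∘ (extChartAt I x).symm) y •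
    chartCovector α x y := rfl
  have e2 := extD_oneForm_apply h' x u v
  have e3 := extD_oneForm_apply h x u v
  rw [e, fderiv_fun_smul hc (chartCovector_differentiableAt h x)] at e2
  refine e2.trans ?_
  refine Eq.trans ?_ (congrArg (fun t => mvfderiv I f x u * α x v - mvfderiv I f x v * α x u +
    f x * t) e3.symm)
  rw [← chartCovector_self α x u, ← chartCovector_self α x v]
  have e4 := mvfderiv_eq_fderiv_chart hf x u
  have e5 := mvfderiv_eq_fderiv_chart hf x v
  rw [e4, e5]
  have e6 : (f ∘ (extChartAt I x).symm) (extChartAt I x x) = f x := by simp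
  rw [e6]
  simp only [add_apply, smul_apply, ContinuousLinearMap.smulRight_apply, smul_eq_mul]
  ring

end OneForms

/-! ### Products of vector-valued one-forms -/

section Wedge

variable {E : Type*} [NormedAddCommGroup E] [NormedSpace ℝ E] [FiniteDimensional ℝ E]
  {H : Type*} [TopologicalSpace H] {I : ModelWithCorners ℝ E H} [I.Boundaryless]
  {M : Type*} [TopologicalSpace M] [ChartedSpace H M] [IsManifold I ∞ M]

theorem inChart_dotWedge_mul (α β : OneForm I M ℝ) (x₀ : M) (y : E) (v : Fin 2 → E) :
    inChart (dotWedge (LinearMap.mul ℝ ℝ) α β) x₀ y v =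
      chartCovector α x₀ y (v 0) * chartCovector β x₀ y (v 1) -
        chartCovector α x₀ y (v 1) * chartCovector β x₀ y (v 0) := by
  rw [inChart_apply, dotWedge_apply]
  rfl

theorem isSmoothForm_dotWedge_mul {α β : OneForm I M ℝ} (hα : IsSmoothForm (oneForm α))
    (hβ : IsSmoothForm (oneForm β)) : IsSmoothForm (dotWedge (LinearMap.mul ℝ ℝ) α β) := by
  rw [isSmoothForm_iff_apply]
  intro x₀ v
  simp only [inChart_dotWedge_mul]
  rw [isSmoothForm_oneForm_iff] at hα hβ
  exact ((hα x₀ _).mul (hβ x₀ _)).sub ((hα x₀ _).mul (hβ x₀ _))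

theorem extD_dotWedge_mul {α β : OneForm I M ℝ} (hα : IsSmoothForm (oneForm α))
    (hβ : IsSmoothForm (oneForm β)) (x : M) (u v w : E) :
    extD (dotWedge (LinearMap.mul ℝ ℝ) α β) x ![u, v, w] =
      extD (oneForm α) x ![u, v] * β x w - extD (oneForm α) x ![u, w] * β x v
        + extD (oneForm α) x ![v, w] * β x u - α x u * extD (oneForm β) x ![v, w]
        + α x v * extD (oneForm β) x ![u, w] - α x w * extD (oneForm β) x ![u, v] := by
  have ha := chartCovector_differentiableAt hα x
  have hb := chartCovector_differentiableAt hβ x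
  have hs := (isSmoothForm_dotWedge_mul hα hβ).contDiffAt (mem_extChartAt_target x)
  have key (p q r : E) : fderiv ℝ (fun y => chartCovector α x y p * chartCovector β x y q -
        chartCovector α x y q * chartCovector β x y p) (extChartAt I x x) r =
      fderiv ℝ (chartCovector α x) (extChartAt I x x) r p * β x q +
        α x p * fderiv ℝ (chartCovector β x) (extChartAt I x x) r q -
      (fderiv ℝ (chartCovector α x) (extChartAt I x x) r q * β x p +
        α x q * fderiv ℝ (chartCovector β x) (extChartAt I x x) r p) := by
    have ha' (s : E) : HasFDerivAt (fun y => chartCovector α x y s)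
        ((fderiv ℝ (chartCovector α x) (extChartAt I x x)).flip s) (extChartAt I x x) := by
      simpa using ha.hasFDerivAt.clm_apply (hasFDerivAt_const s _)
    have hb' (s : E) : HasFDerivAt (fun y => chartCovector β x y s)
        ((fderiv ℝ (chartCovector β x) (extChartAt I x x)).flip s) (extChartAt I x x) := by
      simpa using hb.hasFDerivAt.clm_apply (hasFDerivAt_const s _)
    rw [(((ha' p).fun_mul (hb' q)).fun_sub ((ha' q).fun_mul (hb' p))).fderiv]
    simp only [sub_apply, add_apply, smul_apply, ContinuousLinearMap.flip_apply, smul_eq_mul]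
    have e1 := chartCovector_self α x p
    have e2 := chartCovector_self α x q
    have e3 := chartCovector_self β x p
    have e4 := chartCovector_self β x q
    rw [e1, e2, e3, e4]
    ring
  refine (extD_apply _ x ![u, v, w]).trans ?_
  refine (extDeriv_apply (hs.differentiableAt (by simp)) (![u, v, w] : Fin 3 → E)).trans ?_
  simp only [inChart_dotWedge_mul]
  rw [Fin.sum_univ_three]
  have e00 : (Fin.removeNth 0 ![u, v, w] : Fin 2 → E) 0 = v := rfl
  have e01 : (Fin.removeNth 0 ![u, v, w] : Fin 2 → E) 1 = w := rfl
  have e10 : (Fin.removeNth 1 ![u, v, w] : Fin 2 → E) 0 = u := rfl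
  have e11 : (Fin.removeNth 1 ![u, v, w] : Fin 2 → E) 1 = w := rfl
  have e20 : (Fin.removeNth 2 ![u, v, w] : Fin 2 → E) 0 = u := rfl
  have e21 : (Fin.removeNth 2 ![u, v, w] : Fin 2 → E) 1 = v := rfl
  rw [e00, e01, e10, e11, e20, e21, key, key, key, extD_oneForm_apply hα, extD_oneForm_apply hα,
    extD_oneForm_apply hα, extD_oneForm_apply hβ, extD_oneForm_apply hβ, extD_oneForm_apply hβ]
  simp
  ring

variable {W : Type*} [TopologicalSpace W] [AddCommGroup W] [Module ℝ W]

/-- The scalar `1`-form `l ∘ α`, for a covector `l`. -/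
def covectorComp (l : W →L[ℝ] ℝ) (α : OneForm I M W) : OneForm I M ℝ := fun x => l.comp (α x)

variable [IsTopologicalAddGroup W] [ContinuousSMul ℝ W] [T2Space W] [FiniteDimensional ℝ W]

theorem bilin_eq_sum {W ι : Type*} [AddCommGroup W] [Module ℝ W] [Fintype ι]
    (b : Module.Basis ι ℝ W) (B : LinearMap.BilinForm ℝ W) (p q : W) :
    B p q = ∑ i, b.coord i p * B (b i) q := by
  conv_lhs => rw [← b.sum_repr p]
  simp only [map_sum, LinearMap.sum_apply, map_smul, LinearMap.smul_apply, smul_eq_mul]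
  rfl

theorem dotWedge_eq_sum {ι : Type*} [Fintype ι] (b : Module.Basis ι ℝ W)
    (B : LinearMap.BilinForm ℝ W) (α β : OneForm I M W) :
    dotWedge B α β = ∑ i, dotWedge (LinearMap.mul ℝ ℝ)
      (covectorComp (b.coord i).toContinuousLinearMap α)
      (covectorComp (B (b i)).toContinuousLinearMap β) := by
  have key := bilin_eq_sum b B
  funext x
  ext v
  rw [dotWedge_apply, Finset.sum_apply, ContinuousAlternatingMap.sum_apply, key, key,
    ← Finset.sum_sub_distrib]
  refine Finset.sum_congr rfl fun i _ => ?_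
  rw [dotWedge_apply]
  rfl

theorem isSmoothForm_dotWedge (B : LinearMap.BilinForm ℝ W) {α β : OneForm I M W}
    (hα : ∀ l : W →L[ℝ] ℝ, IsSmoothForm (oneForm (covectorComp l α)))
    (hβ : ∀ l : W →L[ℝ] ℝ, IsSmoothForm (oneForm (covectorComp l β))) :
    IsSmoothForm (dotWedge B α β) := by
  rw [dotWedge_eq_sum (Module.finBasis ℝ W)]
  exact IsSmoothForm.sum fun i _ => isSmoothForm_dotWedge_mul (hα _) (hβ _)

/-- The Leibniz rule `d(α · β) = dα · β - α · dβ`, where the exterior derivatives of the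
vector-valued forms `α` and `β` at `x` are specified by testing against covectors. -/
theorem extD_dotWedge (B : LinearMap.BilinForm ℝ W) {α β : OneForm I M W}
    (hα : ∀ l : W →L[ℝ] ℝ, IsSmoothForm (oneForm (covectorComp l α)))
    (hβ : ∀ l : W →L[ℝ] ℝ, IsSmoothForm (oneForm (covectorComp l β))) (x : M)
    {dα dβ : TangentSpace I x → TangentSpace I x → W}
    (hdα : ∀ (l : W →L[ℝ] ℝ) u v, extD (oneForm (covectorComp l α)) x ![u, v] = l (dα u v))
    (hdβ : ∀ (l : W →L[ℝ] ℝ) u v, extD (oneForm (covectorComp l β)) x ![u, v] = l (dβ u v))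
    (u v w : TangentSpace I x) :
    extD (dotWedge B α β) x ![u, v, w] =
      B (dα u v) (β x w) - B (dα u w) (β x v) + B (dα v w) (β x u)
        - B (α x u) (dβ v w) + B (α x v) (dβ u w) - B (α x w) (dβ u v) := by
  let b := Module.finBasis ℝ W
  have key := bilin_eq_sum b B
  rw [dotWedge_eq_sum b, extD_sum fun i _ => isSmoothForm_dotWedge_mul (hα _) (hβ _),
    Finset.sum_apply, ContinuousAlternatingMap.sum_apply, key, key, key, key, key, key,
    ← Finset.sum_sub_distrib, ← Finset.sum_add_distrib, ← Finset.sum_sub_distrib,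
    ← Finset.sum_add_distrib, ← Finset.sum_sub_distrib]
  refine Finset.sum_congr rfl fun i _ => ?_
  refine (extD_dotWedge_mul (hα _) (hβ _) x u v w).trans ?_
  rw [hdα, hdα, hdα, hdβ, hdβ, hdβ]
  rfl

end Wedge

/-! ### The chain rule in the model spaces -/

section Chain

variable {E : Type*} [NormedAddCommGroup E] [NormedSpace ℝ E]
  {H : Type*} [TopologicalSpace H] {I : ModelWithCorners ℝ E H}
  {M : Type*} [TopologicalSpace M] [ChartedSpace H M]
  {E' : Type*} [NormedAddCommGroup E'] [NormedSpace ℝ E']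
  {H' : Type*} [TopologicalSpace H'] {I' : ModelWithCorners ℝ E' H'}
  {M' : Type*} [TopologicalSpace M'] [ChartedSpace H' M']
  {E'' : Type*} [NormedAddCommGroup E''] [NormedSpace ℝ E'']
  {H'' : Type*} [TopologicalSpace H''] {I'' : ModelWithCorners ℝ E'' H''}
  {M'' : Type*} [TopologicalSpace M''] [ChartedSpace H'' M'']

/-- The chain rule, with the intermediate point and the composite map given only up to
propositional equality; tangent vectors are viewed in the model spaces. -/
theorem mfderiv_chain {f : M → M'} {g : M' → M''} {h : M → M''} {x : M} {y : M'}
    (hg : MDifferentiableAt I' I'' g y) (hf : MDifferentiableAt I I' f x) (hy : f x = y)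
    (hh : ∀ z, g (f z) = h z) (v : E) :
    (mfderiv I I'' h x v : E'') = mfderiv I' I'' g y (mfderiv I I' f x v : E') := by
  subst hy
  obtain rfl : h = g ∘ f := funext fun z => (hh z).symm
  exact mfderiv_comp_apply x hg hf v

theorem mfderiv_apply_of_eq_id {f : M → M} (hf : ∀ z, f z = z) (x : M) (v : E) :
    (mfderiv I I f x v : E) = v := by
  obtain rfl : f = id := funext hf
  rw [mfderiv_id]
  rfl

theorem mfderiv_apply_of_eq_const {f : M → M'} {c : M'} (hf : ∀ z, f z = c) (x : M) (v : E) :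
    (mfderiv I I' f x v : E') = 0 := by
  obtain rfl : f = fun _ => c := funext hf
  rw [mfderiv_const]
  rfl

end Chain

/-! ### Maurer–Cartan forms and the adjoint action -/

section LieGroups

variable {E : Type*} [NormedAddCommGroup E] [NormedSpace ℝ E]
  {H : Type*} [TopologicalSpace H] {I : ModelWithCorners ℝ E H}
  {G : Type*} [TopologicalSpace G] [ChartedSpace H G] [Group G] [LieGroup I ∞ G]
  {E' : Type*} [NormedAddCommGroup E'] [NormedSpace ℝ E']
  {H' : Type*} [TopologicalSpace H'] {J : ModelWithCorners ℝ E' H'}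
  {K : Type*} [TopologicalSpace K] [ChartedSpace H' K] [Group K] [LieGroup J ∞ K]
  {EM : Type*} [NormedAddCommGroup EM] [NormedSpace ℝ EM]
  {HM : Type*} [TopologicalSpace HM] {IM : ModelWithCorners ℝ EM HM}
  {M : Type*} [TopologicalSpace M] [ChartedSpace HM M]

theorem mdifferentiableAt_mulLeft (g x : G) : MDifferentiableAt I I (fun h => g * h) x :=
  (contMDiff_mul_left (n := ∞)).mdifferentiableAt (by simp)

theorem mdifferentiableAt_mulRight (g x : G) : MDifferentiableAt I I (fun h => h * g) x :=
  (contMDiff_mul_right (n := ∞)).mdifferentiableAt (by simp)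

theorem thetaL_leftField (g : G) (x : GroupLieAlgebra I G) :
    thetaL I G g (leftField g x) = x := by
  have h := mfderiv_chain (h := fun h : G => g⁻¹ * (g * h))
    (mdifferentiableAt_mulLeft (I := I) g⁻¹ g)
    (mdifferentiableAt_mulLeft (I := I) g 1) (mul_one g) (fun _ => rfl) x
  exact h.symm.trans (mfderiv_apply_of_eq_id (E := E) (by simp) _ _)

theorem leftField_thetaL (g : G) (v : TangentSpace I g) :
    leftField g (thetaL I G g v) = v := by
  have h := mfderiv_chain (h := fun h : G => g * (g⁻¹ * h)) (mdifferentiableAt_mulLeft (I := I) g 1)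
    (mdifferentiableAt_mulLeft (I := I) g⁻¹ g) (inv_mul_cancel g) (fun _ => rfl) v
  exact h.symm.trans (mfderiv_apply_of_eq_id (E := E) (by simp) _ _)

theorem thetaR_rightField (g : G) (x : GroupLieAlgebra I G) :
    thetaR I G g (rightField g x) = x := by
  have h := mfderiv_chain (h := fun h : G => h * g * g⁻¹)
    (mdifferentiableAt_mulRight (I := I) g⁻¹ g)
    (mdifferentiableAt_mulRight (I := I) g 1) (one_mul g) (fun _ => rfl) x
  exact h.symm.trans (mfderiv_apply_of_eq_id (E := E) (by simp) _ _)

variable (I) in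
/-- The adjoint representation of `G` on its Lie algebra. -/
def adj (g : G) : GroupLieAlgebra I G →L[ℝ] GroupLieAlgebra I G := lieAut I (MulAut.conj g)

variable (I J) in
/-- The map of Lie algebras induced by a homomorphism of Lie groups. -/
def lieHom (f : G →* K) : GroupLieAlgebra I G →L[ℝ] GroupLieAlgebra J K :=
  (mfderiv I J f 1 : TangentSpace I (1 : G) →L[ℝ] TangentSpace J (f 1))

theorem isLieAut_conj (g : G) : IsLieAut I (MulAut.conj g) where
  smooth := (contMDiff_mul_right (I := I) (n := ∞) (a := g⁻¹)).comp
    (contMDiff_mul_left (I := I) (n := ∞) (a := g))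
  smooth_symm := (contMDiff_mul_right (I := I) (n := ∞) (a := g)).comp
    (contMDiff_mul_left (I := I) (n := ∞) (a := g⁻¹))

theorem IsLieAut.mdifferentiableAt {κ : MulAut G} (hκ : IsLieAut I κ) (x : G) :
    MDifferentiableAt I I κ x := hκ.smooth.mdifferentiableAt (by simp)

theorem IsLieAut.mul {κ κ' : MulAut G} (hκ : IsLieAut I κ) (hκ' : IsLieAut I κ') :
    IsLieAut I (κ * κ') where
  smooth := hκ.smooth.comp hκ'.smooth
  smooth_symm := by
    rw [mul_inv_rev]
    exact hκ'.smooth_symm.comp hκ.smooth_symm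

theorem IsLieAut.inv {κ : MulAut G} (hκ : IsLieAut I κ) : IsLieAut I κ⁻¹ where
  smooth := hκ.smooth_symm
  smooth_symm := by
    rw [inv_inv]
    exact hκ.smooth

theorem lieAut_mul {κ κ' : MulAut G} (hκ : IsLieAut I κ) (hκ' : IsLieAut I κ')
    (x : GroupLieAlgebra I G) : lieAut I (κ * κ') x = lieAut I κ (lieAut I κ' x) :=
  mfderiv_chain (hκ.mdifferentiableAt 1) (hκ'.mdifferentiableAt 1) (map_one κ') (fun _ => rfl) x

theorem lieAut_one (x : GroupLieAlgebra I G) : lieAut I (1 : MulAut G) x = x :=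
  mfderiv_apply_of_eq_id (E := E) (fun _ => rfl) 1 x

theorem lieAut_inv_apply {κ : MulAut G} (hκ : IsLieAut I κ) (x : GroupLieAlgebra I G) :
    lieAut I κ⁻¹ (lieAut I κ x) = x := by
  rw [← lieAut_mul hκ.inv hκ, inv_mul_cancel, lieAut_one]

theorem lieAut_apply_inv {κ : MulAut G} (hκ : IsLieAut I κ) (x : GroupLieAlgebra I G) :
    lieAut I κ (lieAut I κ⁻¹ x) = x := by
  rw [← lieAut_mul hκ hκ.inv, mul_inv_cancel, lieAut_one]

theorem adj_mul (g h : G) (x : GroupLieAlgebra I G) : adj I (g * h) x = adj I g (adj I h x) := by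
  rw [adj, map_mul]
  exact lieAut_mul (isLieAut_conj g) (isLieAut_conj h) x

theorem adj_one (x : GroupLieAlgebra I G) : adj I (1 : G) x = x := by
  rw [adj, map_one]
  exact lieAut_one x

theorem adj_inv_adj (g : G) (x : GroupLieAlgebra I G) : adj I g⁻¹ (adj I g x) = x := by
  rw [← adj_mul, inv_mul_cancel, adj_one]

theorem adj_adj_inv (g : G) (x : GroupLieAlgebra I G) : adj I g (adj I g⁻¹ x) = x := by
  rw [← adj_mul, mul_inv_cancel, adj_one]

theorem thetaR_eq_adj (g : G) (v : TangentSpace I g) :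
    thetaR I G g v = adj I g (thetaL I G g v) :=
  mfderiv_chain (h := fun h : G => h * g⁻¹) ((isLieAut_conj (I := I) g).mdifferentiableAt 1)
    (mdifferentiableAt_mulLeft (I := I) g⁻¹ g) (inv_mul_cancel g)
    (fun z => by simp [MulAut.conj_apply]) v

theorem thetaL_eq_adj (g : G) (v : TangentSpace I g) :
    thetaL I G g v = adj I g⁻¹ (thetaR I G g v) := by
  rw [thetaR_eq_adj, adj_inv_adj]

theorem thetaL_rightField (g : G) (x : GroupLieAlgebra I G) :
    thetaL I G g (rightField g x) = adj I g⁻¹ x := by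
  rw [thetaL_eq_adj, thetaR_rightField]

theorem thetaR_leftField (g : G) (x : GroupLieAlgebra I G) :
    thetaR I G g (leftField g x) = adj I g x := by
  rw [thetaR_eq_adj, thetaL_leftField]

theorem thetaL_injective (g : G) : Function.Injective (thetaL I G g) := fun v w h => by
  rw [← leftField_thetaL g v, h, leftField_thetaL]

/-! ### Lie group homomorphisms -/

theorem thetaL_mfderiv_hom {f : G →* K} (hf : ContMDiff I J ∞ f) (g : G) (v : TangentSpace I g) :
    thetaL J K (f g) (mfderiv I J f g v) = lieHom I J f (thetaL I G g v) := by
  have hd (x : G) : MDifferentiableAt I J f x := hf.mdifferentiableAt (by simp)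
  have h1 := mfderiv_chain (h := fun h : G => (f g)⁻¹ * f h)
    (mdifferentiableAt_mulLeft (I := J) (f g)⁻¹ (f g)) (hd g) rfl (fun _ => rfl) v
  have h2 := mfderiv_chain (h := fun h : G => (f g)⁻¹ * f h) (hd 1)
    (mdifferentiableAt_mulLeft (I := I) g⁻¹ g) (inv_mul_cancel g) (fun z => by simp) v
  exact h1.symm.trans h2

theorem thetaR_mfderiv_hom {f : G →* K} (hf : ContMDiff I J ∞ f) (g : G) (v : TangentSpace I g) :
    thetaR J K (f g) (mfderiv I J f g v) = lieHom I J f (thetaR I G g v) := by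
  have hd (x : G) : MDifferentiableAt I J f x := hf.mdifferentiableAt (by simp)
  have h1 := mfderiv_chain (h := fun h : G => f h * (f g)⁻¹)
    (mdifferentiableAt_mulRight (I := J) (f g)⁻¹ (f g)) (hd g) rfl (fun _ => rfl) v
  have h2 := mfderiv_chain (h := fun h : G => f h * (f g)⁻¹) (hd 1)
    (mdifferentiableAt_mulRight (I := I) g⁻¹ g) (mul_inv_cancel g) (fun z => by simp) v
  exact h1.symm.trans h2

theorem mfderiv_hom_leftField {f : G →* K} (hf : ContMDiff I J ∞ f) (g : G)
    (x : GroupLieAlgebra I G) :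
    mfderiv I J f g (leftField g x) = leftField (f g) (lieHom I J f x) := by
  apply thetaL_injective (I := J)
  rw [thetaL_mfderiv_hom hf, thetaL_leftField, thetaL_leftField]

theorem lieHom_adj {f : G →* K} (hf : ContMDiff I J ∞ f) (g : G) (x : GroupLieAlgebra I G) :
    lieHom I J f (adj I g x) = adj J (f g) (lieHom I J f x) := by
  rw [← thetaR_leftField, ← thetaR_mfderiv_hom hf, mfderiv_hom_leftField hf, thetaR_leftField]

theorem thetaL_mfderiv_aut {κ : MulAut G} (hκ : IsLieAut I κ) (g : G) (v : TangentSpace I g) :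
    thetaL I G (κ g) (mfderiv I I κ g v) = lieAut I κ (thetaL I G g v) :=
  thetaL_mfderiv_hom (f := κ.toMonoidHom) hκ.smooth g v

theorem thetaR_mfderiv_aut {κ : MulAut G} (hκ : IsLieAut I κ) (g : G) (v : TangentSpace I g) :
    thetaR I G (κ g) (mfderiv I I κ g v) = lieAut I κ (thetaR I G g v) :=
  thetaR_mfderiv_hom (f := κ.toMonoidHom) hκ.smooth g v

theorem lieAut_adj {κ : MulAut G} (hκ : IsLieAut I κ) (g : G) (x : GroupLieAlgebra I G) :
    lieAut I κ (adj I g x) = adj I (κ g) (lieAut I κ x) :=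
  lieHom_adj (f := κ.toMonoidHom) hκ.smooth g x

/-! ### Products and inverses of group-valued maps -/

theorem mfderiv_mul_apply {a b : M → G} {x : M} (ha : MDifferentiableAt IM I a x)
    (hb : MDifferentiableAt IM I b x) (v : TangentSpace IM x) :
    (mfderiv IM I (fun y => a y * b y) x v : E) =
      (mfderiv I I (fun h => h * b x) (a x) (mfderiv IM I a x v) : E) +
        (mfderiv I I (fun h => a x * h) (b x) (mfderiv IM I b x v) : E) := by
  have hm : MDifferentiableAt (I.prod I) I (fun p : G × G => p.1 * p.2) (a x, b x) :=
    (contMDiff_mul I ∞).mdifferentiableAt (by simp)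
  have h1 := mfderiv_chain (f := fun y => (a y, b y)) (h := fun y => a y * b y) hm
    (ha.prodMk hb) rfl (fun _ => rfl) v
  have h2 := mfderiv_prod_eq_add_apply (v := mfderiv IM (I.prod I) (fun y => (a y, b y)) x v) hm
  rw [h1]
  refine h2.trans ?_
  rw [mfderiv_prodMk ha hb]
  rfl

theorem thetaL_mul {a b : M → G} {x : M} (ha : MDifferentiableAt IM I a x)
    (hb : MDifferentiableAt IM I b x) (v : TangentSpace IM x) :
    thetaL I G (a x * b x) (mfderiv IM I (fun y => a y * b y) x v) =
      adj I (b x)⁻¹ (thetaL I G (a x) (mfderiv IM I a x v)) +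
        thetaL I G (b x) (mfderiv IM I b x v) := by
  have h1 := mfderiv_mul_apply ha hb v
  refine (congrArg (thetaL I G (a x * b x)) h1).trans ?_
  refine (map_add (thetaL I G (a x * b x)) _ _).trans ?_
  have e1 := mfderiv_chain (h := fun h : G => (a x * b x)⁻¹ * (h * b x))
    (mdifferentiableAt_mulLeft (I := I) (a x * b x)⁻¹ (a x * b x))
    (mdifferentiableAt_mulRight (I := I) (b x) (a x)) rfl (fun _ => rfl) (mfderiv IM I a x v)
  have e2 := mfderiv_chain (h := fun h : G => (a x * b x)⁻¹ * (h * b x))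
    ((isLieAut_conj (I := I) (b x)⁻¹).mdifferentiableAt 1)
    (mdifferentiableAt_mulLeft (I := I) (a x)⁻¹ (a x)) (inv_mul_cancel _)
    (fun z => by simp [mul_assoc]) (mfderiv IM I a x v)
  have e3 := mfderiv_chain (h := fun h : G => (b x)⁻¹ * h)
    (mdifferentiableAt_mulLeft (I := I) (a x * b x)⁻¹ (a x * b x))
    (mdifferentiableAt_mulLeft (I := I) (a x) (b x)) rfl (fun _ => by simp [mul_assoc])
    (mfderiv IM I b x v)
  exact congrArg₂ (fun p q : E => p + q) (e1.symm.trans e2) e3.symm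

theorem thetaR_mul {a b : M → G} {x : M} (ha : MDifferentiableAt IM I a x)
    (hb : MDifferentiableAt IM I b x) (v : TangentSpace IM x) :
    thetaR I G (a x * b x) (mfderiv IM I (fun y => a y * b y) x v) =
      thetaR I G (a x) (mfderiv IM I a x v) +
        adj I (a x) (thetaR I G (b x) (mfderiv IM I b x v)) := by
  rw [thetaR_eq_adj, thetaL_mul ha hb, map_add, adj_mul, adj_adj_inv, thetaR_eq_adj (a x),
    thetaR_eq_adj (b x), adj_mul]

theorem MDifferentiableAt.lieInv {a : M → G} {x : M} (ha : MDifferentiableAt IM I a x) :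
    MDifferentiableAt IM I (fun y => (a y)⁻¹) x :=
  ((contMDiff_inv I ∞).mdifferentiableAt (by simp)).comp x ha

theorem thetaR_inv {a : M → G} {x : M} (ha : MDifferentiableAt IM I a x)
    (v : TangentSpace IM x) :
    thetaR I G (a x)⁻¹ (mfderiv IM I (fun y => (a y)⁻¹) x v) =
      -thetaL I G (a x) (mfderiv IM I a x v) := by
  have h1 := thetaR_mul ha ha.lieInv v
  have h2 : thetaR I G (a x * (a x)⁻¹) (mfderiv IM I (fun y => a y * (a y)⁻¹) x v) = 0 :=
    (congrArg (thetaR I G (a x * (a x)⁻¹))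
      (mfderiv_apply_of_eq_const (E := EM) (fun z => mul_inv_cancel (a z)) x v)).trans
      (map_zero _)
  rw [h2, thetaR_eq_adj (a x), ← map_add] at h1
  have h3 := congrArg (adj I (a x)⁻¹) h1
  rw [map_zero, adj_inv_adj] at h3
  exact eq_neg_of_add_eq_zero_right h3.symm

theorem thetaL_inv {a : M → G} {x : M} (ha : MDifferentiableAt IM I a x)
    (v : TangentSpace IM x) :
    thetaL I G (a x)⁻¹ (mfderiv IM I (fun y => (a y)⁻¹) x v) =
      -thetaR I G (a x) (mfderiv IM I a x v) := by
  rw [thetaL_eq_adj, thetaR_inv ha, inv_inv, map_neg, ← thetaR_eq_adj]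

end LieGroups

/-! ### Smoothness of invariant vector fields and of `θ^L` -/

section SmoothFrames

variable {E : Type*} [NormedAddCommGroup E] [NormedSpace ℝ E]
  {H : Type*} [TopologicalSpace H] {I : ModelWithCorners ℝ E H}
  {G : Type*} [TopologicalSpace G] [ChartedSpace H G] [Group G] [LieGroup I ∞ G]

theorem tangentBundle_ext {x y : G} {v w : E} (h : x = y) (h' : v = w) :
    (⟨x, v⟩ : TangentBundle I G) = ⟨y, w⟩ := by
  subst h; subst h'; rfl

/-- The product of two smooth maps into the tangent group `TG` is smooth. Multiplying the zero
section by a fixed vector at the unit gives the invariant vector fields. -/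
theorem contMDiff_tangentMul {V W : G → TangentBundle I G}
    (hV : ContMDiff I I.tangent ∞ V) (hW : ContMDiff I I.tangent ∞ W) :
    ContMDiff I I.tangent ∞ (fun g => tangentMap (I.prod I) I (fun p : G × G => p.1 * p.2)
      ((equivTangentBundleProd I G I G).symm (V g, W g))) := by
  have : IsManifold I 1 G := IsManifold.of_le (n := ∞) (by simp)
  have h1 : ContMDiff (I.prod I).tangent I.tangent ∞
      (tangentMap (I.prod I) I (fun p : G × G => p.1 * p.2)) :=
    (contMDiff_mul I ∞).contMDiff_tangentMap (by simp)
  exact h1.comp (contMDiff_equivTangentBundleProd_symm.comp (hV.prodMk hW))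

theorem contMDiff_leftField (x : GroupLieAlgebra I G) :
    ContMDiff I I.tangent ∞ (fun g : G => (⟨g, leftField g x⟩ : TangentBundle I G)) := by
  have : IsManifold I 1 G := IsManifold.of_le (n := ∞) (by simp)
  have h0 : ContMDiff I I.tangent ∞ (fun g : G => (⟨g, 0⟩ : TangentBundle I G)) :=
    Bundle.contMDiff_zeroSection ℝ (TangentSpace I : G → Type _)
  have h1 : ContMDiff I I.tangent ∞ (fun _ : G => (⟨1, x⟩ : TangentBundle I G)) := contMDiff_const
  refine (contMDiff_tangentMul h0 h1).congr fun g => ?_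
  have hm : MDifferentiableAt (I.prod I) I (fun p : G × G => p.1 * p.2) (g, 1) :=
    (contMDiff_mul I ∞).mdifferentiableAt (by simp)
  let x' : E := x
  have e : mfderiv (I.prod I) I (fun p : G × G => p.1 * p.2) (g, 1) ((0, x') : E × E) =
      leftField g x := by
    refine (mfderiv_prod_eq_add_apply (E := E) (E' := E) (v := ((0, x') : E × E)) hm).trans ?_
    refine (congrArg₂ (fun a b : E => a + b) (map_zero (mfderiv I I (fun z : G => z * 1) g))
      rfl).trans (zero_add (leftField g x : E))
  exact tangentBundle_ext (E := E) (I := I) (mul_one g).symm e.symm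

theorem contMDiff_rightField (x : GroupLieAlgebra I G) :
    ContMDiff I I.tangent ∞ (fun g : G => (⟨g, rightField g x⟩ : TangentBundle I G)) := by
  have : IsManifold I 1 G := IsManifold.of_le (n := ∞) (by simp)
  have h0 : ContMDiff I I.tangent ∞ (fun g : G => (⟨g, 0⟩ : TangentBundle I G)) :=
    Bundle.contMDiff_zeroSection ℝ (TangentSpace I : G → Type _)
  have h1 : ContMDiff I I.tangent ∞ (fun _ : G => (⟨1, x⟩ : TangentBundle I G)) := contMDiff_const
  refine (contMDiff_tangentMul h1 h0).congr fun g => ?_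
  have hm : MDifferentiableAt (I.prod I) I (fun p : G × G => p.1 * p.2) (1, g) :=
    (contMDiff_mul I ∞).mdifferentiableAt (by simp)
  let x' : E := x
  have e : mfderiv (I.prod I) I (fun p : G × G => p.1 * p.2) (1, g) ((x', 0) : E × E) =
      rightField g x := by
    refine (mfderiv_prod_eq_add_apply (E := E) (E' := E) (v := ((x', 0) : E × E)) hm).trans ?_
    refine (congrArg₂ (fun a b : E => a + b) rfl
      (map_zero (mfderiv I I (fun z : G => 1 * z) g))).trans (add_zero (rightField g x : E))
  exact tangentBundle_ext (E := E) (I := I) (one_mul g).symm e.symm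

variable [I.Boundaryless] [FiniteDimensional ℝ E]

theorem isSmoothForm_thetaL (l : GroupLieAlgebra I G →L[ℝ] ℝ) :
    IsSmoothForm (oneForm (covectorComp l (thetaL I G))) := by
  have : IsManifold I 1 G := IsManifold.of_le (n := ∞) (by simp)
  rw [isSmoothForm_oneForm_iff]
  intro x₀ w y hy
  refine ContDiffAt.contDiffWithinAt ?_
  -- in charts, `θ^L` at `y` is the derivative of `F y : z ↦ y⁻¹ z` at `z = y`, so its smoothness
  -- follows from the joint smoothness of `F`
  let F : E → E → E := fun y z =>
    extChartAt I (1 : G) (((extChartAt I x₀).symm y)⁻¹ * (extChartAt I x₀).symm z)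
  have hF : ContDiffAt ℝ ∞ (Function.uncurry F) (y, y) := by
    rw [← contMDiffAt_iff_contDiffAt]
    have hs : ContMDiffAt 𝓘(ℝ, E) I ∞ (extChartAt I x₀).symm y :=
      (contMDiffOn_extChartAt_symm (n := ∞) x₀).contMDiffAt
        ((isOpen_extChartAt_target x₀).mem_nhds hy)
    have h1 : ContMDiffAt 𝓘(ℝ, E × E) I ∞ (fun p : E × E => (extChartAt I x₀).symm p.1) (y, y) :=
      ContMDiffAt.comp (x := ((y, y) : E × E)) (f := Prod.fst) (g := (extChartAt I x₀).symm) hs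
        contDiff_fst.contMDiff.contMDiffAt
    have h2 : ContMDiffAt 𝓘(ℝ, E × E) I ∞ (fun p : E × E => (extChartAt I x₀).symm p.2) (y, y) :=
      ContMDiffAt.comp (x := ((y, y) : E × E)) (f := Prod.snd) (g := (extChartAt I x₀).symm) hs
        contDiff_snd.contMDiff.contMDiffAt
    have h3 := h1.inv.mul h2
    refine ContMDiffAt.comp (x := ((y, y) : E × E)) (g := extChartAt I (1 : G)) ?_ h3
    refine contMDiffAt_extChartAt' ?_
    simp
  have h4 : ContDiffAt ℝ ∞ (fun z => fderiv ℝ (F z) z w) y :=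
    (ContDiffAt.fderiv (m := ∞) (g := fun z => z) hF contDiffAt_id (by simp)).clm_apply
      contDiffAt_const
  let l' : E →L[ℝ] ℝ := l
  have h5 : ContDiffAt ℝ ∞ (fun z => l' (fderiv ℝ (F z) z w)) y :=
    l'.contDiff.contDiffAt.comp y h4
  refine h5.congr_of_eventuallyEq ?_
  filter_upwards [(isOpen_extChartAt_target x₀).mem_nhds hy] with z hz
  have e1 := mfderiv_chain (I := 𝓘(ℝ, E)) (I' := I) (I'' := I)
    (h := fun z' => ((extChartAt I x₀).symm z)⁻¹ * (extChartAt I x₀).symm z')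
    (mdifferentiableAt_mulLeft (I := I) ((extChartAt I x₀).symm z)⁻¹ ((extChartAt I x₀).symm z))
    (mdifferentiableAt_extChartAt_symm hz) rfl (fun _ => rfl) w
  have e2 := mfderiv_chain (I := 𝓘(ℝ, E)) (I' := I) (I'' := 𝓘(ℝ, E)) (h := F z) (y := (1 : G))
    (f := fun z' => ((extChartAt I x₀).symm z)⁻¹ * (extChartAt I x₀).symm z') (x := z)
    (g := extChartAt I (1 : G)) (mdifferentiableAt_extChartAt (by simp))
    ((mdifferentiableAt_mulLeft (I := I) _ _).comp z (mdifferentiableAt_extChartAt_symm hz))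
    (by simp) (fun _ => rfl) w
  rw [mfderiv_eq_fderiv, mfderiv_extChartAt_self] at e2
  exact congrArg l' (e2.trans e1).symm

end SmoothFrames

/-! ### The Maurer–Cartan equations -/

section MaurerCartan

variable {E : Type*} [NormedAddCommGroup E] [NormedSpace ℝ E] [FiniteDimensional ℝ E]
  {H : Type*} [TopologicalSpace H] {I : ModelWithCorners ℝ E H} [I.Boundaryless]
  {G : Type*} [TopologicalSpace G] [ChartedSpace H G] [Group G] [LieGroup I ∞ G]
  {E' : Type*} [NormedAddCommGroup E'] [NormedSpace ℝ E'] [FiniteDimensional ℝ E']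
  {H' : Type*} [TopologicalSpace H'] {J : ModelWithCorners ℝ E' H'} [J.Boundaryless]
  {K : Type*} [TopologicalSpace K] [ChartedSpace H' K] [Group K] [LieGroup J ∞ K]

theorem mlieBracket_leftField (x y : GroupLieAlgebra I G) (g : G) :
    VectorField.mlieBracket I (fun h => leftField h x) (fun h => leftField h y) g =
      leftField g (lieBilin I G x y) := by
  have : CompleteSpace E := FiniteDimensional.complete ℝ E
  have : LieGroup I (minSmoothness ℝ 3) G := by
    rw [minSmoothness_of_isRCLikeNormedField]; infer_instance
  exact (congrFun (mulInvariantVector_mlieBracket (I := I) (G := G) x y) g).symm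

theorem lieBilin_self (x : GroupLieAlgebra I G) : lieBilin I G x x = 0 := by
  have : CompleteSpace E := FiniteDimensional.complete ℝ E
  have : LieGroup I (minSmoothness ℝ 3) G := by
    rw [minSmoothness_of_isRCLikeNormedField]; infer_instance
  exact lie_self x

theorem lieBilin_swap (x y : GroupLieAlgebra I G) : lieBilin I G x y = -lieBilin I G y x := by
  have h := lieBilin_self (x + y)
  simp only [map_add, LinearMap.add_apply, lieBilin_self, zero_add, add_zero] at h
  exact eq_neg_of_add_eq_zero_right h

theorem eq_of_forall_covector {x y : GroupLieAlgebra I G}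
    (h : ∀ l : GroupLieAlgebra I G →L[ℝ] ℝ, l x = l y) : x = y :=
  (Module.finBasis ℝ (GroupLieAlgebra I G)).ext_elem fun i =>
    h ((Module.finBasis ℝ (GroupLieAlgebra I G)).coord i).toContinuousLinearMap

/-- The Maurer–Cartan equation `dθ^L(u, v) = -[θ^L(u), θ^L(v)]`, tested on covectors. -/
theorem extD_thetaL (l : GroupLieAlgebra I G →L[ℝ] ℝ) (g : G) (u v : TangentSpace I g) :
    extD (oneForm (covectorComp l (thetaL I G))) g ![u, v] =
      -l (lieBilin I G (thetaL I G g u) (thetaL I G g v)) := by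
  have h := extD_oneForm_vectorField (isSmoothForm_thetaL l)
    (contMDiff_leftField (thetaL I G g u)) (contMDiff_leftField (thetaL I G g v)) g
  have hc (x y : GroupLieAlgebra I G) :
      mvfderiv I (fun h => covectorComp l (thetaL I G) h (leftField h x)) g (leftField g y) =
        0 := by
    have e : (fun h : G => covectorComp l (thetaL I G) h (leftField h x)) = fun _ => l x := by
      funext h
      exact congrArg l (thetaL_leftField h x)
    rw [e, mvfderiv_const]
    rfl
  rw [hc, hc, mlieBracket_leftField, leftField_thetaL, leftField_thetaL] at h
  rw [h]
  have e : covectorComp l (thetaL I G) g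
      (leftField g (lieBilin I G (thetaL I G g u) (thetaL I G g v))) =
      l (lieBilin I G (thetaL I G g u) (thetaL I G g v)) :=
    congrArg l (thetaL_leftField g _)
  rw [e]
  ring

theorem pullback_thetaL_hom {f : G →* K} (hf : ContMDiff I J ∞ f)
    (l : GroupLieAlgebra J K →L[ℝ] ℝ) :
    pullback (I := I) f (oneForm (covectorComp l (thetaL J K))) =
      oneForm (covectorComp (l.comp (lieHom I J f)) (thetaL I G)) := by
  funext g
  ext v
  exact congrArg l (thetaL_mfderiv_hom hf g (v 0))

/-- The map induced by a smooth homomorphism is a homomorphism of Lie algebras. -/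
theorem lieHom_lieBilin {f : G →* K} (hf : ContMDiff I J ∞ f) (x y : GroupLieAlgebra I G) :
    lieHom I J f (lieBilin I G x y) = lieBilin J K (lieHom I J f x) (lieHom I J f y) := by
  refine eq_of_forall_covector fun l => ?_
  have h := extD_pullback (I := I) hf (isSmoothForm_thetaL l)
  rw [pullback_thetaL_hom hf] at h
  have h1 := congrArg (fun ϖ : DiffForm I G 2 => ϖ 1 ![leftField 1 x, leftField 1 y]) h
  have h2 : pullback f (extD (oneForm (covectorComp l (thetaL J K)))) 1
      ![leftField (I := I) (1 : G) x, leftField 1 y] =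
      extD (oneForm (covectorComp l (thetaL J K))) (f 1)
        ![mfderiv I J f 1 (leftField 1 x), mfderiv I J f 1 (leftField 1 y)] := by
    change extD (oneForm (covectorComp l (thetaL J K))) (f 1) _ = _
    congr 1
    ext i
    fin_cases i <;> rfl
  simp only [h2, extD_thetaL, thetaL_mfderiv_hom hf, thetaL_leftField] at h1
  simpa using h1

theorem lieAut_lieBilin {κ : MulAut G} (hκ : IsLieAut I κ) (x y : GroupLieAlgebra I G) :
    lieAut I κ (lieBilin I G x y) = lieBilin I G (lieAut I κ x) (lieAut I κ y) :=
  lieHom_lieBilin (f := κ.toMonoidHom) hκ.smooth x y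

theorem adj_lieBilin (g : G) (x y : GroupLieAlgebra I G) :
    adj I g (lieBilin I G x y) = lieBilin I G (adj I g x) (adj I g y) :=
  lieAut_lieBilin (isLieAut_conj g) x y

theorem thetaL_mfderiv_inv (g : G) (v : TangentSpace I g) :
    thetaL I G g⁻¹ (mfderiv I I (fun h : G => h⁻¹) g v) = -thetaR I G g v := by
  have h := thetaL_inv (IM := I) (a := fun h : G => h) (x := g) mdifferentiableAt_id v
  exact h.trans (congrArg (fun w => -thetaR I G g w)
    (mfderiv_apply_of_eq_id (E := E) (fun _ => rfl) g v))

theorem oneForm_thetaR_eq_pullback (l : GroupLieAlgebra I G →L[ℝ] ℝ) :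
    oneForm (covectorComp l (thetaR I G)) =
      pullback (fun h : G => h⁻¹) (oneForm (covectorComp (-l) (thetaL I G))) := by
  funext g
  ext v
  refine Eq.symm ((congrArg (-l) (thetaL_mfderiv_inv g (v 0))).trans ?_)
  rw [neg_apply, map_neg, neg_neg]
  rfl

theorem isSmoothForm_thetaR (l : GroupLieAlgebra I G →L[ℝ] ℝ) :
    IsSmoothForm (oneForm (covectorComp l (thetaR I G))) := by
  rw [oneForm_thetaR_eq_pullback]
  exact (isSmoothForm_thetaL (-l)).pullback (contMDiff_inv I ∞)

theorem pullback_apply_two {M M' : Type*} {E E' H H' : Type*} [NormedAddCommGroup E]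
    [NormedSpace ℝ E] [TopologicalSpace H] {I : ModelWithCorners ℝ E H} [TopologicalSpace M]
    [ChartedSpace H M] [NormedAddCommGroup E']
    [NormedSpace ℝ E'] [TopologicalSpace H'] {I' : ModelWithCorners ℝ E' H'} [TopologicalSpace M']
    [ChartedSpace H' M'] (Φ : M → M') (ϖ : DiffForm I' M' 2) (x : M) (u v : TangentSpace I x) :
    pullback Φ ϖ x ![u, v] = ϖ (Φ x) ![mfderiv I I' Φ x u, mfderiv I I' Φ x v] := by
  change ϖ (Φ x) _ = _
  congr 1
  ext i
  fin_cases i <;> rfl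

/-- The Maurer-Cartan equation `dθ^R = [θ^R, θ^R]`, evaluated on two vectors. -/
theorem extD_thetaR (l : GroupLieAlgebra I G →L[ℝ] ℝ) (g : G) (u v : TangentSpace I g) :
    extD (oneForm (covectorComp l (thetaR I G))) g ![u, v] =
      l (lieBilin I G (thetaR I G g u) (thetaR I G g v)) := by
  rw [oneForm_thetaR_eq_pullback, extD_pullback (contMDiff_inv I ∞) (isSmoothForm_thetaL (-l)),
    pullback_apply_two, extD_thetaL, thetaL_mfderiv_inv, thetaL_mfderiv_inv]
  simp

theorem contMDiff_covector_adj_inv (l : GroupLieAlgebra I G →L[ℝ] ℝ) (x : GroupLieAlgebra I G) :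
    ContMDiff I 𝓘(ℝ, ℝ) ∞ (fun b : G => l (adj I b⁻¹ x)) := by
  have h := contMDiff_oneForm_apply (isSmoothForm_thetaL l) (contMDiff_rightField x)
  refine h.congr fun b => ?_
  exact congrArg l (thetaL_rightField b x).symm

end MaurerCartan

/-! ### The derivative of the adjoint action -/

section AdjointDerivative

variable {E : Type*} [NormedAddCommGroup E] [NormedSpace ℝ E] [FiniteDimensional ℝ E]
  {H : Type*} [TopologicalSpace H] {I : ModelWithCorners ℝ E H} [I.Boundaryless]
  {G : Type*} [TopologicalSpace G] [ChartedSpace H G] [Group G] [LieGroup I ∞ G]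

theorem mfderiv_fst_apply {E E' H H' M M' : Type*} [NormedAddCommGroup E]
    [NormedSpace ℝ E] [TopologicalSpace H] {I : ModelWithCorners ℝ E H} [TopologicalSpace M]
    [ChartedSpace H M] [NormedAddCommGroup E']
    [NormedSpace ℝ E'] [TopologicalSpace H'] {I' : ModelWithCorners ℝ E' H'} [TopologicalSpace M']
    [ChartedSpace H' M'] (z : M × M') (v : E × E') :
    (mfderiv (I.prod I') I (Prod.fst : M × M' → M) z v : E) = v.1 := by
  rw [mfderiv_fst]; rfl

theorem mfderiv_snd_apply {E E' H H' M M' : Type*} [NormedAddCommGroup E]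
    [NormedSpace ℝ E] [TopologicalSpace H] {I : ModelWithCorners ℝ E H} [TopologicalSpace M]
    [ChartedSpace H M] [NormedAddCommGroup E']
    [NormedSpace ℝ E'] [TopologicalSpace H'] {I' : ModelWithCorners ℝ E' H'} [TopologicalSpace M']
    [ChartedSpace H' M'] (z : M × M') (v : E × E') :
    (mfderiv (I.prod I') I' (Prod.snd : M × M' → M') z v : E') = v.2 := by
  rw [mfderiv_snd]; rfl

/-- The left Maurer-Cartan form of a product: `μ^* θ^L = Ad_{b⁻¹} (θ^L)_a + (θ^L)_b`. -/
theorem thetaL_mfderiv_mul (z : G × G) (v : E × E) :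
    thetaL I G (z.1 * z.2) (mfderiv (I.prod I) I (fun p : G × G => p.1 * p.2) z v) =
      adj I z.2⁻¹ (thetaL I G z.1 v.1) + thetaL I G z.2 v.2 := by
  have h := thetaL_mul (IM := I.prod I) (a := (Prod.fst : G × G → G)) (b := Prod.snd) (x := z)
    mdifferentiableAt_fst mdifferentiableAt_snd v
  refine h.trans ?_
  exact congrArg₂ (fun p q => adj I z.2⁻¹ (thetaL I G z.1 p) + thetaL I G z.2 q)
    (mfderiv_fst_apply (I := I) (I' := I) z v) (mfderiv_snd_apply (I := I) (I' := I) z v)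

/-- The identity `μ^* θ^L = Ad_{b⁻¹} pr₁^* θ^L + pr₂^* θ^L` for the multiplication
`μ (a, b) = a b`, tested on a covector `l` and expanded in a basis. -/
theorem pullback_mul_thetaL {ι : Type*} [Fintype ι] (e : Module.Basis ι ℝ (GroupLieAlgebra I G))
    (l : GroupLieAlgebra I G →L[ℝ] ℝ) :
    pullback (fun p : G × G => p.1 * p.2) (oneForm (covectorComp l (thetaL I G))) =
      (∑ i, oneForm (I := I.prod I) fun p : G × G => l (adj I p.2⁻¹ (e i)) •
        pullback₁ (I := I.prod I) Prod.fst
          (covectorComp (e.coord i).toContinuousLinearMap (thetaL I G)) p) +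
      pullback Prod.snd (oneForm (covectorComp l (thetaL I G))) := by
  funext z
  ext v
  refine (congrArg l (thetaL_mfderiv_mul z (v 0))).trans ?_
  rw [map_add]
  rw [Pi.add_apply, Finset.sum_apply, ContinuousAlternatingMap.add_apply,
    ContinuousAlternatingMap.sum_apply]
  refine congrArg₂ (· + ·) ?_ (congrArg (fun q : E => l (thetaL I G z.2 q))
    (mfderiv_snd_apply (I := I) (I' := I) z (v 0)).symm)
  have h1 := e.sum_repr (thetaL I G z.1 (v 0).1)
  conv_lhs => rw [← h1]
  rw [map_sum, map_sum]
  refine Finset.sum_congr rfl fun i _ => ?_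
  rw [map_smul, map_smul, smul_eq_mul, mul_comm]
  exact congrArg (fun q : E => l (adj I z.2⁻¹ (e i)) * e.repr (thetaL I G z.1 q) i)
    (mfderiv_fst_apply (I := I) (I' := I) z (v 0)).symm

theorem mvfderiv_comp_snd {E' H' N : Type*} [NormedAddCommGroup E']
    [NormedSpace ℝ E'] [TopologicalSpace H'] {I' : ModelWithCorners ℝ E' H'} [TopologicalSpace N]
    [ChartedSpace H' N] {f : G → ℝ} (z : N × G) (hf : MDifferentiableAt I 𝓘(ℝ, ℝ) f z.2)
    (v : E' × E) : mvfderiv (I'.prod I) (fun p : N × G => f p.2) z v = mvfderiv I f z.2 v.2 := by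
  refine (mvfderiv_comp_apply z (f := Prod.snd) hf mdifferentiableAt_snd v).trans ?_
  exact congrArg (mvfderiv I f z.2) (mfderiv_snd_apply z v)

theorem isSmoothForm_pullback₁ {E₁ E₂ H₁ H₂ M₁ M₂ : Type*} [NormedAddCommGroup E₁]
    [NormedSpace ℝ E₁] [FiniteDimensional ℝ E₁] [TopologicalSpace H₁]
    {I₁ : ModelWithCorners ℝ E₁ H₁} [I₁.Boundaryless] [TopologicalSpace M₁]
    [ChartedSpace H₁ M₁] [IsManifold I₁ ∞ M₁] [NormedAddCommGroup E₂]
    [NormedSpace ℝ E₂] [FiniteDimensional ℝ E₂] [TopologicalSpace H₂]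
    {I₂ : ModelWithCorners ℝ E₂ H₂} [I₂.Boundaryless] [TopologicalSpace M₂]
    [ChartedSpace H₂ M₂] [IsManifold I₂ ∞ M₂] {Φ : M₁ → M₂} (hΦ : ContMDiff I₁ I₂ ∞ Φ)
    {α : OneForm I₂ M₂ ℝ} (hα : IsSmoothForm (oneForm α)) :
    IsSmoothForm (oneForm (pullback₁ (I := I₁) Φ α)) :=
  hα.pullback hΦ

theorem IsSmoothForm.fun_smul_oneForm {E₁ H₁ M₁ : Type*} [NormedAddCommGroup E₁]
    [NormedSpace ℝ E₁] [FiniteDimensional ℝ E₁] [TopologicalSpace H₁]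
    {I₁ : ModelWithCorners ℝ E₁ H₁} [I₁.Boundaryless] [TopologicalSpace M₁]
    [ChartedSpace H₁ M₁] [IsManifold I₁ ∞ M₁] {f : M₁ → ℝ} {α : OneForm I₁ M₁ ℝ}
    (hα : IsSmoothForm (oneForm α)) (hf : ContMDiff I₁ 𝓘(ℝ, ℝ) ∞ f) :
    IsSmoothForm (oneForm fun y => f y • α y) := by
  have e : (oneForm fun y => f y • α y) = fun y => f y • oneForm α y := by
    funext y; ext; rfl
  rw [e]
  exact hα.fun_smul hf

/-- The derivative of `b ↦ Ad_{b⁻¹} e_j`, obtained by evaluating `d(μ^* θ^L) = μ^* dθ^L` for the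
multiplication `μ` at `(1, b)` on the vectors `(e_j, 0)` and `(0, w)`. -/
theorem mvfderiv_covector_adj_inv_basis {ι : Type*} [Fintype ι]
    (e : Module.Basis ι ℝ (GroupLieAlgebra I G)) (l : GroupLieAlgebra I G →L[ℝ] ℝ) (b : G) (j : ι)
    (w : E) : mvfderiv I (fun b : G => l (adj I b⁻¹ (e j))) b w =
      l (lieBilin I G (adj I b⁻¹ (e j)) (thetaL I G b w)) := by
  have h := extD_pullback (contMDiff_mul I ∞) (isSmoothForm_thetaL (I := I) (G := G) l)
  have hf (i : ι) : ContMDiff (I.prod I) 𝓘(ℝ, ℝ) ∞ (fun p : G × G => l (adj I p.2⁻¹ (e i))) :=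
    (contMDiff_covector_adj_inv l (e i)).comp contMDiff_snd
  have hα (i : ι) : IsSmoothForm (oneForm (pullback₁ (I := I.prod I) (Prod.fst : G × G → G)
      (covectorComp (e.coord i).toContinuousLinearMap (thetaL I G)))) :=
    isSmoothForm_pullback₁ contMDiff_fst (isSmoothForm_thetaL _)
  have hfα (i : ι) := (hα i).fun_smul_oneForm (hf i)
  rw [pullback_mul_thetaL e l, extD_add (IsSmoothForm.sum fun i _ => hfα i)
    ((isSmoothForm_thetaL l).pullback contMDiff_snd), extD_sum fun i _ => hfα i,
    extD_pullback contMDiff_snd (isSmoothForm_thetaL l)] at h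
  let u : E × E := (leftField (I := I) (1 : G) (e j), 0)
  let v : E × E := (0, w)
  have h1 := congrArg (fun ϖ : DiffForm (I.prod I) (G × G) 2 => ϖ (1, b) ![u, v]) h
  simp only [Pi.add_apply, Finset.sum_apply, ContinuousAlternatingMap.add_apply,
    ContinuousAlternatingMap.sum_apply] at h1
  have hfst (z : E × E) : (mfderiv (I.prod I) I (Prod.fst : G × G → G) (1, b) z : E) = z.1 :=
    mfderiv_fst_apply (I := I) (I' := I) _ _
  have hθ (z : E × E) : pullback₁ (I := I.prod I) (Prod.fst : G × G → G)
      (thetaL I G) (1, b) z = thetaL I G (1 : G) z.1 :=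
    congrArg (thetaL I G (1 : G)) (hfst z)
  have hA (i : ι) : extD (oneForm (I := I.prod I) fun p : G × G => l (adj I p.2⁻¹ (e i)) •
        pullback₁ (I := I.prod I) Prod.fst
          (covectorComp (e.coord i).toContinuousLinearMap (thetaL I G)) p) (1, b) ![u, v] =
      -(mvfderiv I (fun b : G => l (adj I b⁻¹ (e i))) b w * e.coord i (e j)) := by
    have h2 := extD_fun_smul_oneForm (hα i) (hf i) ((1 : G), b) u v
    have h3 : extD (oneForm (pullback₁ (I := I.prod I) (Prod.fst : G × G → G)
        (covectorComp (e.coord i).toContinuousLinearMap (thetaL I G)))) (1, b) ![u, v] = 0 := by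
      refine (congrArg (fun ϖ : DiffForm (I.prod I) (G × G) 2 => ϖ (1, b) ![u, v])
        (extD_pullback (I := I.prod I) contMDiff_fst (isSmoothForm_thetaL (I := I) (G := G)
          (e.coord i).toContinuousLinearMap))).trans ?_
      refine (pullback_apply_two _ _ _ _ _).trans ?_
      refine (extD_thetaL _ _ _ _).trans ?_
      have h7 : thetaL I G (1 : G) (mfderiv (I.prod I) I (Prod.fst : G × G → G) (1, b) v) = 0 :=
        (congrArg (thetaL I G (1 : G)) (hfst v)).trans (map_zero _)
      refine (congrArg (fun z => -(e.coord i).toContinuousLinearMap (lieBilin I G _ z)) h7).trans ?_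
      simp
    have h4 (z : E × E) := mvfderiv_comp_snd (I' := I) ((1 : G), b)
      ((contMDiff_covector_adj_inv l (e i)).mdifferentiableAt (by simp)) z
    have h5 (z : E × E) : pullback₁ (I := I.prod I) (Prod.fst : G × G → G)
      (covectorComp (e.coord i).toContinuousLinearMap (thetaL I G)) (1, b) z =
      e.coord i (thetaL I G (1 : G) z.1) := congrArg (e.coord i) (hθ z)
    rw [h3, h4, h4, h5, h5] at h2
    refine h2.trans ?_
    have h6 : thetaL I G (1 : G) u.1 = e j := thetaL_leftField 1 (e j)
    rw [h6]
    have h7 : mvfderiv I (fun b : G => l (adj I b⁻¹ (e i))) b u.2 = 0 := map_zero _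
    rw [h7]
    ring
  have hB : pullback (I := I.prod I) (Prod.snd : G × G → G)
      (extD (oneForm (covectorComp l (thetaL I G)))) (1, b) ![u, v] = 0 := by
    refine (pullback_apply_two _ _ _ _ _).trans ?_
    refine (extD_thetaL _ _ _ _).trans ?_
    have h7 : thetaL I G b (mfderiv (I.prod I) I (Prod.snd : G × G → G) (1, b) u) = 0 :=
      (congrArg (thetaL I G b) (mfderiv_snd_apply (I := I) (I' := I) _ _)).trans (map_zero _)
    refine (congrArg (fun z => -l (lieBilin I G z _)) h7).trans ?_
    simp
  have hC : pullback (I := I.prod I) (fun p : G × G => p.1 * p.2)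
      (extD (oneForm (covectorComp l (thetaL I G)))) (1, b) ![u, v] =
      -l (lieBilin I G (adj I b⁻¹ (e j)) (thetaL I G b w)) := by
    refine (pullback_apply_two _ _ _ _ _).trans ?_
    refine (extD_thetaL _ _ _ _).trans ?_
    have h7 := thetaL_mfderiv_mul (I := I) ((1 : G), b) u
    have h8 := thetaL_mfderiv_mul (I := I) ((1 : G), b) v
    have h9 : thetaL I G (1 : G) u.1 = e j := thetaL_leftField 1 (e j)
    have h10 : thetaL I G b u.2 = 0 := map_zero _
    have h11 : thetaL I G (1 : G) v.1 = 0 := map_zero _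
    rw [h9, h10, add_zero] at h7
    rw [h11, map_zero, zero_add] at h8
    exact congrArg₂ (fun p q => -l (lieBilin I G p q)) h7 h8
  rw [hB, hC, Finset.sum_congr rfl fun i _ => hA i, add_zero, Finset.sum_neg_distrib, neg_inj] at h1
  rw [← h1, Finset.sum_eq_single j]
  · simp
  · intro i _ hij
    simp [hij.symm]
  · simp

/-- The derivative of the coadjoint orbit map: `d⟨l, Ad_{b⁻¹} x⟩ = ⟨l, [Ad_{b⁻¹} x, θ^L]⟩`. -/
theorem mvfderiv_covector_adj_inv (l : GroupLieAlgebra I G →L[ℝ] ℝ) (b : G)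
    (x : GroupLieAlgebra I G) (w : TangentSpace I b) :
    mvfderiv I (fun b : G => l (adj I b⁻¹ x)) b w =
      l (lieBilin I G (adj I b⁻¹ x) (thetaL I G b w)) := by
  have hd (x : GroupLieAlgebra I G) :
      MDifferentiableAt I 𝓘(ℝ, ℝ) (fun b : G => l (adj I b⁻¹ x)) b :=
    (contMDiff_covector_adj_inv l x).mdifferentiableAt (by simp)
  let L : GroupLieAlgebra I G →ₗ[ℝ] ℝ :=
    { toFun := fun x => mvfderiv I (fun b : G => l (adj I b⁻¹ x)) b w
      map_add' := fun x y => by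
        have e : (fun b : G => l (adj I b⁻¹ (x + y))) =
            (fun b : G => l (adj I b⁻¹ x)) + fun b : G => l (adj I b⁻¹ y) := by
          funext b; simp
        rw [e, mvfderiv_add (hd x) (hd y)]
        rfl
      map_smul' := fun c x => by
        have e : (fun b : G => l (adj I b⁻¹ (c • x))) =
            (fun _ : G => c) • fun b : G => l (adj I b⁻¹ x) := by
          funext b; simp
        rw [e, mvfderiv_smul mdifferentiableAt_const (hd x), mvfderiv_const]
        simp }
  let L' : GroupLieAlgebra I G →ₗ[ℝ] ℝ :=
    l.toLinearMap ∘ₗ (lieBilin I G).flip (thetaL I G b w) ∘ₗ (adj I b⁻¹).toLinearMap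
  have h : L = L' := (Module.finBasis ℝ (GroupLieAlgebra I G)).ext fun j =>
    mvfderiv_covector_adj_inv_basis _ l b j w
  exact LinearMap.congr_fun h x

theorem IsInvariantForm.adj {B : LinearMap.BilinForm ℝ (GroupLieAlgebra I G)}
    (hB : IsInvariantForm B) (g : G) (x y : GroupLieAlgebra I G) :
    B (adj I g x) (adj I g y) = B x y := hB.ad_invariant g x y

theorem IsInvariantForm.comm {B : LinearMap.BilinForm ℝ (GroupLieAlgebra I G)}
    (hB : IsInvariantForm B) (x y : GroupLieAlgebra I G) : B x y = B y x :=
  hB.symm.eq x y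

/-- An `Ad`-invariant form is `ad`-invariant. -/
theorem IsInvariantForm.ad {B : LinearMap.BilinForm ℝ (GroupLieAlgebra I G)}
    (hB : IsInvariantForm B) (c z w : GroupLieAlgebra I G) :
    B c (lieBilin I G z w) = -B z (lieBilin I G c w) := by
  have hd (l : GroupLieAlgebra I G →L[ℝ] ℝ) (b : G) (x : GroupLieAlgebra I G) :
      MDifferentiableAt I 𝓘(ℝ, ℝ) (fun b : G => l (TqHam.adj I b⁻¹ x)) b :=
    (contMDiff_covector_adj_inv l x).mdifferentiableAt (by simp)
  -- both sides of this identity are differentiated at `b = 1`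
  have e : (fun b : G => (B c).toContinuousLinearMap (TqHam.adj I b⁻¹ z)) =
      (fun b : G => (B z).toContinuousLinearMap (TqHam.adj I b⁻¹ c)) ∘ fun b => b⁻¹ := by
    funext b
    change B c (TqHam.adj I b⁻¹ z) = B z (TqHam.adj I b⁻¹⁻¹ c)
    rw [inv_inv, ← hB.adj b, adj_adj_inv, hB.comm]
  have h1 := mvfderiv_covector_adj_inv (B c).toContinuousLinearMap 1 z (leftField (1 : G) w)
  rw [e, mvfderiv_comp_apply (f := fun b : G => b⁻¹) (1 : G) (hd _ _ _)
    ((contMDiff_inv I ∞).mdifferentiableAt (by simp)), mvfderiv_covector_adj_inv,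
    thetaL_mfderiv_inv, thetaR_leftField, thetaL_leftField] at h1
  simp only [inv_one, adj_one, map_neg] at h1
  exact h1.symm

end AdjointDerivative

/-! ### The Cartan `3`-form -/

section CartanForm

variable {E : Type*} [NormedAddCommGroup E] [NormedSpace ℝ E] [FiniteDimensional ℝ E]
  {H : Type*} [TopologicalSpace H] {I : ModelWithCorners ℝ E H} [I.Boundaryless]
  {G : Type*} [TopologicalSpace G] [ChartedSpace H G] [Group G] [LieGroup I ∞ G]
  {B : LinearMap.BilinForm ℝ (GroupLieAlgebra I G)}

theorem IsInvariantForm.lieBilin_cyclic (hB : IsInvariantForm B) (x y z : GroupLieAlgebra I G) :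
    B (lieBilin I G x y) z = B (lieBilin I G y z) x := by
  rw [hB.comm, hB.ad, lieBilin_swap z y, map_neg, neg_neg, hB.comm]

theorem bilin_lieBilin_swap (B : LinearMap.BilinForm ℝ (GroupLieAlgebra I G))
    (x y z : GroupLieAlgebra I G) : B (lieBilin I G x y) z = -B (lieBilin I G y x) z := by
  rw [lieBilin_swap, map_neg, LinearMap.neg_apply]

/-- By `ad`-invariance of `B`, the six terms of the alternatization agree up to sign. -/
theorem cartanForm_apply (hB : IsInvariantForm B) (g : G) (v : Fin 3 → TangentSpace I g) :
    cartanForm B g v = 1 / 2 * B (lieBilin I G (thetaL I G g (v 0)) (thetaL I G g (v 1)))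
      (thetaL I G g (v 2)) := by
  simp only [cartanForm, ContinuousAlternatingMap.smul_apply,
    ContinuousMultilinearMap.alternatization_apply_apply]
  rw [sum_perm_fin_three]
  have e3 : Equiv.Perm.sign (Equiv.swap (0 : Fin 3) 1 * Equiv.swap 1 2) = 1 := by decide
  have e4 : Equiv.Perm.sign (Equiv.swap (1 : Fin 3) 2 * Equiv.swap 0 1) = 1 := by decide
  rw [e3, e4, Equiv.Perm.sign_one, Equiv.Perm.sign_swap (by decide),
    Equiv.Perm.sign_swap (by decide), Equiv.Perm.sign_swap (by decide)]
  set x := thetaL I G g (v 0) with hx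
  set y := thetaL I G g (v 1) with hy
  set z := thetaL I G g (v 2) with hz
  change (1 / 12 : ℝ) • ((1 : ℤˣ) • B (lieBilin I G x y) z + (-1 : ℤˣ) • B (lieBilin I G y x) z +
    (-1 : ℤˣ) • B (lieBilin I G z y) x + (-1 : ℤˣ) • B (lieBilin I G x z) y +
    (1 : ℤˣ) • B (lieBilin I G y z) x + (1 : ℤˣ) • B (lieBilin I G z x) y) = _
  simp only [one_smul, Units.neg_smul, smul_eq_mul]
  have h1 := hB.lieBilin_cyclic x y z
  have h2 := hB.lieBilin_cyclic y z x
  have h3 := bilin_lieBilin_swap B x y z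
  have h4 := bilin_lieBilin_swap B y z x
  have h5 := bilin_lieBilin_swap B z x y
  linarith

theorem isSmoothForm_cartanForm (hB : IsInvariantForm B) : IsSmoothForm (cartanForm B) := by
  rw [isSmoothForm_iff_apply]
  intro x₀ v
  let e := Module.finBasis ℝ (GroupLieAlgebra I G)
  have hs (l : GroupLieAlgebra I G →L[ℝ] ℝ) (w : E) : ContDiffOn ℝ ∞ (fun y =>
      l (thetaL I G ((extChartAt I x₀).symm y) (chartSymmDeriv I x₀ y w)))
        (extChartAt I x₀).target :=
    isSmoothForm_oneForm_iff.1 (isSmoothForm_thetaL l) x₀ w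
  have key (p q r : GroupLieAlgebra I G) : 1 / 2 * B (lieBilin I G p q) r =
      1 / 2 * ∑ i, ∑ j, (e.coord i).toContinuousLinearMap p *
        ((e.coord j).toContinuousLinearMap q *
          (B (lieBilin I G (e i) (e j))).toContinuousLinearMap r) := by
    congr 1
    conv_lhs => rw [← e.sum_repr p, ← e.sum_repr q]
    simp only [map_sum, LinearMap.sum_apply, map_smul, LinearMap.smul_apply, smul_eq_mul,
      Finset.mul_sum]
    rw [Finset.sum_comm]
    exact Finset.sum_congr rfl fun i _ => Finset.sum_congr rfl fun j _ => mul_left_comm _ _ _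
  have h : ContDiffOn ℝ ∞ (fun y => 1 / 2 * ∑ i, ∑ j,
      (e.coord i).toContinuousLinearMap
        (thetaL I G ((extChartAt I x₀).symm y) (chartSymmDeriv I x₀ y (v 0))) *
      ((e.coord j).toContinuousLinearMap
        (thetaL I G ((extChartAt I x₀).symm y) (chartSymmDeriv I x₀ y (v 1))) *
      (B (lieBilin I G (e i) (e j))).toContinuousLinearMap
        (thetaL I G ((extChartAt I x₀).symm y) (chartSymmDeriv I x₀ y (v 2)))))
      (extChartAt I x₀).target :=
    contDiffOn_const.mul (ContDiffOn.sum fun i _ => ContDiffOn.sum fun j _ =>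
      (hs _ _).mul ((hs _ _).mul (hs _ _)))
  refine h.congr fun y _ => ?_
  rw [inChart_apply, cartanForm_apply hB]
  exact key _ _ _

section Pullback

variable {EM : Type*} [NormedAddCommGroup EM] [NormedSpace ℝ EM]
  {HM : Type*} [TopologicalSpace HM] {IM : ModelWithCorners ℝ EM HM}
  {M : Type*} [TopologicalSpace M] [ChartedSpace HM M]
  {E' : Type*} [NormedAddCommGroup E'] [NormedSpace ℝ E']
  {H' : Type*} [TopologicalSpace H'] {I' : ModelWithCorners ℝ E' H'}
  {M' : Type*} [TopologicalSpace M'] [ChartedSpace H' M']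
  {E'' : Type*} [NormedAddCommGroup E''] [NormedSpace ℝ E'']
  {H'' : Type*} [TopologicalSpace H''] {I'' : ModelWithCorners ℝ E'' H''}
  {M'' : Type*} [TopologicalSpace M''] [ChartedSpace H'' M'']

theorem pullback_pullback {k : ℕ} {Φ : M → M'} {Ψ : M' → M''} (hΨ : MDifferentiable I' I'' Ψ)
    (hΦ : MDifferentiable IM I' Φ) (ϖ : DiffForm I'' M'' k) :
    pullback (I := IM) Φ (pullback (I := I') Ψ ϖ) = pullback (fun x => Ψ (Φ x)) ϖ := by
  funext x
  ext v
  refine congrArg (ϖ (Ψ (Φ x))) (funext fun i => ?_)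
  exact (mfderiv_chain (hΨ (Φ x)) (hΦ x) rfl (fun _ => rfl) (v i)).symm

theorem pullback_add {k : ℕ} (Φ : M → M') (ϖ ϖ' : DiffForm I' M' k) :
    pullback (I := IM) Φ (ϖ + ϖ') = pullback Φ ϖ + pullback Φ ϖ' := rfl

theorem pullback_neg {k : ℕ} (Φ : M → M') (ϖ : DiffForm I' M' k) :
    pullback (I := IM) Φ (-ϖ) = -pullback Φ ϖ := rfl

end Pullback

theorem pullback_aut_cartanForm (hB : IsInvariantForm B) {κ : MulAut G} (hκ : IsLieAut I κ)
    (hBκ : InvariantUnder B κ) : pullback κ (cartanForm B) = cartanForm B := by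
  funext g
  ext v
  refine (cartanForm_apply hB _ _).trans ?_
  rw [cartanForm_apply hB]
  have h (i : Fin 3) := thetaL_mfderiv_aut hκ g (v i)
  refine (congrArg₂ (fun p q => 1 / 2 * B p q)
    (congrArg₂ (fun p q => lieBilin I G p q) (h 0) (h 1)) (h 2)).trans ?_
  rw [← lieAut_lieBilin hκ, hBκ]

theorem pullback_inv_cartanForm (hB : IsInvariantForm B) :
    pullback (fun g : G => g⁻¹) (cartanForm B) = -cartanForm B := by
  funext g
  ext v
  refine (cartanForm_apply hB _ _).trans ?_
  rw [Pi.neg_apply, ContinuousAlternatingMap.neg_apply, cartanForm_apply hB]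
  have h (i : Fin 3) := thetaL_mfderiv_inv g (v i)
  refine (congrArg₂ (fun p q => 1 / 2 * B p q)
    (congrArg₂ (fun p q => lieBilin I G p q) (h 0) (h 1)) (h 2)).trans ?_
  simp only [map_neg, LinearMap.neg_apply, neg_neg, thetaR_eq_adj]
  rw [← adj_lieBilin, hB.adj]
  ring

theorem thetaL_mfderiv_mulLeft (g h : G) (v : TangentSpace I h) :
    thetaL I G (g * h) (mfderiv I I (fun h => g * h) h v) = thetaL I G h v := by
  have h1 := mfderiv_chain (h := fun x : G => h⁻¹ * x)
    (mdifferentiableAt_mulLeft (I := I) (g * h)⁻¹ (g * h))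
    (mdifferentiableAt_mulLeft (I := I) g h) rfl (fun _ => by group) v
  exact h1.symm

theorem pullback_mulLeft_cartanForm (hB : IsInvariantForm B) (g : G) :
    pullback (fun h : G => g * h) (cartanForm B) = cartanForm B := by
  funext h
  ext v
  refine (cartanForm_apply hB _ _).trans ?_
  rw [cartanForm_apply hB]
  have h (i : Fin 3) := thetaL_mfderiv_mulLeft g h (v i)
  exact (congrArg₂ (fun p q => 1 / 2 * B p q)
    (congrArg₂ (fun p q => lieBilin I G p q) (h 0) (h 1)) (h 2))

/-- All tangent spaces are the model space `E`, so `v` may be used at either of two equal points. -/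
theorem thetaL_congr_point {g g' : G} (h : g = g') (v : E) :
    thetaL I G g v = thetaL I G g' v := by
  subst h; rfl

theorem mfderiv_inv_one (v : E) : (mfderiv I I (fun g : G => g⁻¹) 1 v : E) = -v := by
  have h (v : TangentSpace I (1 : G)) :
      thetaL I G (1 : G)⁻¹ (mfderiv I I (fun g : G => g⁻¹) 1 v) = thetaL I G 1 (-v) := by
    rw [thetaL_mfderiv_inv, thetaR_eq_adj, adj_one, map_neg]
  exact thetaL_injective (I := I) (1 : G) ((thetaL_congr_point inv_one.symm _).trans (h v))

/-- The Cartan form is closed: `dη` is left-invariant, and inversion, whose differential at the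
identity is `-1`, both fixes the `4`-covector `dη` at `1` and changes its sign. -/
theorem extD_cartanForm (hB : IsInvariantForm B) : extD (cartanForm B) = 0 := by
  have hs := isSmoothForm_cartanForm hB
  have h1 (v : Fin 4 → E) : extD (cartanForm B) (1 : G) v = 0 := by
    have h := extD_pullback (I := I) (I' := I) (Φ := fun g : G => g⁻¹) (contMDiff_inv I ∞) hs
    rw [pullback_inv_cartanForm hB, extD_neg] at h
    have h2 := congrArg (fun ϖ : DiffForm I G 4 => ϖ 1 v) h
    have h3 : pullback (I := I) (fun g : G => g⁻¹) (extD (cartanForm B)) 1 v =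
        extD (cartanForm B) (1 : G) fun i => -v i := by
      refine (form_congr_point (extD (cartanForm B)) (inv_one : (1 : G)⁻¹ = 1) _).trans ?_
      refine congrArg (extD (cartanForm B) (1 : G)) (funext fun i => ?_)
      exact mfderiv_inv_one (v i)
    have h5 : extD (cartanForm B) (1 : G) (fun i => -v i) = extD (cartanForm B) (1 : G) v := by
      have := (extD (cartanForm B) (1 : G)).toMultilinearMap.map_smul_univ (fun _ => (-1 : ℝ)) v
      have e : (fun i => -v i) = fun i => (-1 : ℝ) • v i :=
        funext fun i => (neg_one_smul ℝ (v i)).symm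
      rw [e]
      refine Eq.trans this ?_
      rw [Finset.prod_const, Finset.card_univ, Fintype.card_fin, show (-1 : ℝ) ^ 4 = 1 by norm_num,
        one_smul]
      rfl
    have h6 : -extD (cartanForm B) (1 : G) v = extD (cartanForm B) (1 : G) v :=
      h2.trans (h3.trans h5)
    linarith
  funext g
  ext v
  have h := extD_pullback (contMDiff_mul_left (I := I) (n := ∞) (a := g⁻¹)) hs
  rw [pullback_mulLeft_cartanForm hB] at h
  rw [h]
  exact (form_congr_point (extD (cartanForm B)) (inv_mul_cancel g) _).trans (h1 _)

end CartanForm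

/-! ### The multiplicative property of the Cartan form -/

section MultiplicativeProperty

variable {E : Type*} [NormedAddCommGroup E] [NormedSpace ℝ E] [FiniteDimensional ℝ E]
  {H : Type*} [TopologicalSpace H] {I : ModelWithCorners ℝ E H} [I.Boundaryless]
  {G : Type*} [TopologicalSpace G] [ChartedSpace H G] [Group G] [LieGroup I ∞ G]
  {B : LinearMap.BilinForm ℝ (GroupLieAlgebra I G)}

theorem pullback₁_fst_apply (z : G × G) (v : E × E) :
    pullback₁ (I := I.prod I) Prod.fst (thetaL I G) z v = thetaL I G z.1 v.1 :=
  congrArg (thetaL I G z.1) (mfderiv_fst_apply (I := I) (I' := I) z v)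

theorem pullback₁_snd_apply (z : G × G) (v : E × E) :
    pullback₁ (I := I.prod I) Prod.snd (thetaR I G) z v = thetaR I G z.2 v.2 :=
  congrArg (thetaR I G z.2) (mfderiv_snd_apply (I := I) (I' := I) z v)

theorem isSmoothForm_fst_thetaL (l : GroupLieAlgebra I G →L[ℝ] ℝ) :
    IsSmoothForm (oneForm (covectorComp l (pullback₁ (I := I.prod I) (Prod.fst : G × G → G)
      (thetaL I G)))) :=
  isSmoothForm_pullback₁ contMDiff_fst (isSmoothForm_thetaL l)

theorem isSmoothForm_snd_thetaR (l : GroupLieAlgebra I G →L[ℝ] ℝ) :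
    IsSmoothForm (oneForm (covectorComp l (pullback₁ (I := I.prod I) (Prod.snd : G × G → G)
      (thetaR I G)))) :=
  isSmoothForm_pullback₁ contMDiff_snd (isSmoothForm_thetaR l)

theorem extD_fst_thetaL (l : GroupLieAlgebra I G →L[ℝ] ℝ) (z : G × G) (u v : E × E) :
    extD (oneForm (covectorComp l (pullback₁ (I := I.prod I) (Prod.fst : G × G → G)
      (thetaL I G)))) z ![u, v] = l (-lieBilin I G (thetaL I G z.1 u.1) (thetaL I G z.1 v.1)) := by
  refine (congrArg (fun ϖ : DiffForm (I.prod I) (G × G) 2 => ϖ z ![u, v])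
    (extD_pullback (I := I.prod I) contMDiff_fst (isSmoothForm_thetaL (I := I) l))).trans ?_
  refine (pullback_apply_two _ _ _ _ _).trans ((extD_thetaL _ _ _ _).trans ?_)
  rw [map_neg]
  exact congrArg₂ (fun p q => -l (lieBilin I G p q)) (pullback₁_fst_apply z u)
    (pullback₁_fst_apply z v)

theorem extD_snd_thetaR (l : GroupLieAlgebra I G →L[ℝ] ℝ) (z : G × G) (u v : E × E) :
    extD (oneForm (covectorComp l (pullback₁ (I := I.prod I) (Prod.snd : G × G → G)
      (thetaR I G)))) z ![u, v] = l (lieBilin I G (thetaR I G z.2 u.2) (thetaR I G z.2 v.2)) := by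
  refine (congrArg (fun ϖ : DiffForm (I.prod I) (G × G) 2 => ϖ z ![u, v])
    (extD_pullback (I := I.prod I) contMDiff_snd (isSmoothForm_thetaR (I := I) l))).trans ?_
  refine (pullback_apply_two _ _ _ _ _).trans ((extD_thetaR _ _ _ _).trans ?_)
  exact congrArg₂ (fun p q => l (lieBilin I G p q)) (pullback₁_snd_apply z u)
    (pullback₁_snd_apply z v)

theorem isSmoothForm_sigmaForm (B : LinearMap.BilinForm ℝ (GroupLieAlgebra I G)) :
    IsSmoothForm (sigmaForm B) :=
  (isSmoothForm_dotWedge B isSmoothForm_fst_thetaL isSmoothForm_snd_thetaR).const_smul _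

theorem sigmaForm_apply (B : LinearMap.BilinForm ℝ (GroupLieAlgebra I G)) (z : G × G)
    (u : Fin 2 → E × E) :
    sigmaForm B z u = -(1 / 2) * (B (thetaL I G z.1 (u 0).1) (thetaR I G z.2 (u 1).2) -
      B (thetaL I G z.1 (u 1).1) (thetaR I G z.2 (u 0).2)) := by
  have h := dotWedge_apply B (pullback₁ (I := I.prod I) (Prod.fst : G × G → G) (thetaL I G))
    (pullback₁ (I := I.prod I) (Prod.snd : G × G → G) (thetaR I G)) z u
  refine (congrArg (fun r : ℝ => -(1 / 2) * r) h).trans ?_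
  exact congrArg₂ (fun r s : ℝ => -(1 / 2) * (r - s))
    (congrArg₂ (fun p q => B p q) (pullback₁_fst_apply z (u 0)) (pullback₁_snd_apply z (u 1)))
    (congrArg₂ (fun p q => B p q) (pullback₁_fst_apply z (u 1)) (pullback₁_snd_apply z (u 0)))

theorem extD_sigmaForm (B : LinearMap.BilinForm ℝ (GroupLieAlgebra I G)) (z : G × G)
    (u v w : E × E) :
    extD (sigmaForm B) z ![u, v, w] = 1 / 2 *
      (B (lieBilin I G (thetaL I G z.1 u.1) (thetaL I G z.1 v.1)) (thetaR I G z.2 w.2)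
      - B (lieBilin I G (thetaL I G z.1 u.1) (thetaL I G z.1 w.1)) (thetaR I G z.2 v.2)
      + B (lieBilin I G (thetaL I G z.1 v.1) (thetaL I G z.1 w.1)) (thetaR I G z.2 u.2)
      + B (thetaL I G z.1 u.1) (lieBilin I G (thetaR I G z.2 v.2) (thetaR I G z.2 w.2))
      - B (thetaL I G z.1 v.1) (lieBilin I G (thetaR I G z.2 u.2) (thetaR I G z.2 w.2))
      + B (thetaL I G z.1 w.1) (lieBilin I G (thetaR I G z.2 u.2) (thetaR I G z.2 v.2))) := by
  have h := extD_dotWedge (I := I.prod I) B (isSmoothForm_fst_thetaL (I := I) (G := G))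
    isSmoothForm_snd_thetaR z
    (dα := fun u v => -lieBilin I G (thetaL I G z.1 u.1) (thetaL I G z.1 v.1))
    (dβ := fun u v => lieBilin I G (thetaR I G z.2 u.2) (thetaR I G z.2 v.2))
    (fun l u v => extD_fst_thetaL l z u v) (fun l u v => extD_snd_thetaR l z u v) u v w
  have h2 : extD (sigmaForm B) z ![u, v, w] = -(1 / 2) * extD (dotWedge B
      (pullback₁ (I := I.prod I) (Prod.fst : G × G → G) (thetaL I G))
      (pullback₁ (I := I.prod I) (Prod.snd : G × G → G) (thetaR I G))) z ![u, v, w] :=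
    congrArg (fun ϖ : DiffForm (I.prod I) (G × G) 3 => ϖ z ![u, v, w])
      (extD_const_smul (I := I.prod I) (-(1 / 2)) _)
  have e1 (u : E × E) := pullback₁_fst_apply (I := I) z u
  have e2 (u : E × E) := pullback₁_snd_apply (I := I) z u
  rw [e1, e1, e1, e2, e2, e2] at h
  rw [h2, h]
  simp only [map_neg, LinearMap.neg_apply]
  ring

/-- The identity `μ^* η = pr₁^* η + pr₂^* η + dς` for the group multiplication `μ`. -/
theorem pullback_mul_cartanForm (hB : IsInvariantForm B) :
    pullback (fun z : G × G => z.1 * z.2) (cartanForm B) =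
      pullback (I := I.prod I) Prod.fst (cartanForm B) +
        pullback (I := I.prod I) Prod.snd (cartanForm B) + extD (sigmaForm B) := by
  funext z
  refine ContinuousAlternatingMap.ext fun v' => ?_
  -- tangent vectors of `G × G` are viewed as elements of `E × E`
  let v : Fin 3 → E × E := v'
  change pullback (fun z : G × G => z.1 * z.2) (cartanForm B) z v =
    (pullback (I := I.prod I) Prod.fst (cartanForm B) +
        pullback (I := I.prod I) Prod.snd (cartanForm B) + extD (sigmaForm B) :
        DiffForm (I.prod I) (G × G) 3) z v
  clear_value v
  have hθ (w : E × E) : thetaL I G z.2 w.2 = adj I z.2⁻¹ (thetaR I G z.2 w.2) :=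
    thetaL_eq_adj z.2 w.2
  have hv : v = ![v 0, v 1, v 2] := by
    funext i; fin_cases i <;> rfl
  have e1 : pullback (I := I.prod I) (Prod.fst : G × G → G) (cartanForm B) z v =
      1 / 2 * B (lieBilin I G (thetaL I G z.1 (v 0).1) (thetaL I G z.1 (v 1).1))
        (thetaL I G z.1 (v 2).1) := by
    refine (cartanForm_apply hB _ _).trans ?_
    have h (i : Fin 3) := pullback₁_fst_apply (I := I) z (v i)
    exact (congrArg₂ (fun p q => 1 / 2 * B p q)
      (congrArg₂ (fun p q => lieBilin I G p q) (h 0) (h 1)) (h 2))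
  have e2 : pullback (I := I.prod I) (Prod.snd : G × G → G) (cartanForm B) z v =
      1 / 2 * B (lieBilin I G (thetaR I G z.2 (v 0).2) (thetaR I G z.2 (v 1).2))
        (thetaR I G z.2 (v 2).2) := by
    refine (cartanForm_apply hB _ _).trans ?_
    have h (i : Fin 3) : thetaL I G z.2 (mfderiv (I.prod I) I (Prod.snd : G × G → G) z (v i)) =
      adj I z.2⁻¹ (thetaR I G z.2 (v i).2) := by
      rw [← hθ]
      exact congrArg (thetaL I G z.2) (mfderiv_snd_apply (I := I) (I' := I) z (v i))
    refine (congrArg₂ (fun p q => 1 / 2 * B p q)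
      (congrArg₂ (fun p q => lieBilin I G p q) (h 0) (h 1)) (h 2)).trans ?_
    rw [← adj_lieBilin, hB.adj]
  -- with `p = pr₁^* θ^L` and `q = pr₂^* θ^R`, the pullback of `θ^L` under the multiplication is
  -- `p + q` up to the adjoint action, which `B` and the bracket do not see
  have e3 : pullback (I := I.prod I) (fun z : G × G => z.1 * z.2) (cartanForm B) z v =
      1 / 2 * B (lieBilin I G (thetaL I G z.1 (v 0).1 + thetaR I G z.2 (v 0).2)
        (thetaL I G z.1 (v 1).1 + thetaR I G z.2 (v 1).2))
        (thetaL I G z.1 (v 2).1 + thetaR I G z.2 (v 2).2) := by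
    refine (cartanForm_apply hB _ _).trans ?_
    have h (i : Fin 3) : thetaL I G (z.1 * z.2)
        (mfderiv (I.prod I) I (fun z : G × G => z.1 * z.2) z (v i)) =
        adj I z.2⁻¹ (thetaL I G z.1 (v i).1 + thetaR I G z.2 (v i).2) := by
      rw [map_add, ← hθ]
      exact thetaL_mfderiv_mul z (v i)
    refine (congrArg₂ (fun p q => 1 / 2 * B p q)
      (congrArg₂ (fun p q => lieBilin I G p q) (h 0) (h 1)) (h 2)).trans ?_
    rw [← adj_lieBilin, hB.adj]
  have e4 := (congrArg (fun v : Fin 3 → E × E => extD (sigmaForm B) z v) hv).trans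
    (extD_sigmaForm B z (v 0) (v 1) (v 2))
  refine e3.trans (Eq.trans ?_ (congrArg₂ HAdd.hAdd (congrArg₂ HAdd.hAdd e1 e2) e4).symm)
  generalize thetaL I G z.1 (v 0).1 = p₁
  generalize thetaL I G z.1 (v 1).1 = p₂
  generalize thetaL I G z.1 (v 2).1 = p₃
  generalize thetaR I G z.2 (v 0).2 = q₁
  generalize thetaR I G z.2 (v 1).2 = q₂
  generalize thetaR I G z.2 (v 2).2 = q₃
  simp only [map_add, LinearMap.add_apply]
  have c1 := hB.lieBilin_cyclic p₂ p₃ q₁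
  have c2 := hB.lieBilin_cyclic p₁ q₂ p₃
  have c3 := bilin_lieBilin_swap B p₃ p₁ q₂
  have c4 := hB.lieBilin_cyclic q₁ p₂ p₃
  have c5 := hB.lieBilin_cyclic p₁ q₂ q₃
  have c6 := hB.comm p₁ (lieBilin I G q₂ q₃)
  have c7 := hB.comm p₂ (lieBilin I G q₁ q₃)
  have c8 := hB.comm p₃ (lieBilin I G q₁ q₂)
  have c9 := hB.lieBilin_cyclic p₂ q₃ q₁
  have c10 := bilin_lieBilin_swap B q₃ q₁ p₂
  have c11 := hB.lieBilin_cyclic q₁ p₂ q₃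
  have c12 := hB.lieBilin_cyclic q₂ p₃ q₁
  have c13 := hB.lieBilin_cyclic q₂ p₃ p₁
  have c14 := hB.lieBilin_cyclic q₂ q₃ p₁
  linarith

end MultiplicativeProperty

/-! ### Twisted multiplication -/

section TwistedMultiplication

variable {E : Type*} [NormedAddCommGroup E] [NormedSpace ℝ E] [FiniteDimensional ℝ E]
  {H : Type*} [TopologicalSpace H] {I : ModelWithCorners ℝ E H} [I.Boundaryless]
  {G : Type*} [TopologicalSpace G] [ChartedSpace H G] [Group G] [LieGroup I ∞ G]
  {B : LinearMap.BilinForm ℝ (GroupLieAlgebra I G)} {κ : MulAut G}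
  {EM : Type*} [NormedAddCommGroup EM] [NormedSpace ℝ EM]
  {HM : Type*} [TopologicalSpace HM] {IM : ModelWithCorners ℝ EM HM}
  {M : Type*} [TopologicalSpace M] [ChartedSpace HM M]

theorem contMDiff_prodMap_aut (hκ : IsLieAut I κ) :
    ContMDiff (I.prod I) (I.prod I) ∞ (Prod.map (id : G → G) κ) :=
  contMDiff_id.prodMap hκ.smooth

theorem contMDiff_twMult (hκ : IsLieAut I κ) : ContMDiff (I.prod I) I ∞ (twMult κ) :=
  contMDiff_fst.mul (hκ.smooth.comp contMDiff_snd)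

theorem contMDiff_twInv (hκ : IsLieAut I κ) : ContMDiff I I ∞ (twInv κ) :=
  hκ.smooth_symm.comp (contMDiff_inv I ∞)

theorem mfderiv_aut_comp (hκ : IsLieAut I κ) {a : M → G} {x : M} (ha : MDifferentiableAt IM I a x)
    (v : TangentSpace IM x) :
    (mfderiv IM I (fun y => κ (a y)) x v : E) = mfderiv I I κ (a x) (mfderiv IM I a x v) :=
  mfderiv_chain (hκ.mdifferentiableAt _) ha rfl (fun _ => rfl) v

theorem thetaL_aut_comp (hκ : IsLieAut I κ) {a : M → G} {x : M} (ha : MDifferentiableAt IM I a x)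
    (v : TangentSpace IM x) :
    thetaL I G (κ (a x)) (mfderiv IM I (fun y => κ (a y)) x v) =
      lieAut I κ (thetaL I G (a x) (mfderiv IM I a x v)) :=
  (congrArg (thetaL I G (κ (a x))) (mfderiv_aut_comp hκ ha v)).trans (thetaL_mfderiv_aut hκ _ _)

theorem thetaL_mul_aut (hκ : IsLieAut I κ) {a b : M → G} {x : M}
    (ha : MDifferentiableAt IM I a x) (hb : MDifferentiableAt IM I b x) (v : TangentSpace IM x) :
    thetaL I G (a x * κ (b x)) (mfderiv IM I (fun y => a y * κ (b y)) x v) =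
      adj I (κ (b x))⁻¹ (thetaL I G (a x) (mfderiv IM I a x v)) +
        lieAut I κ (thetaL I G (b x) (mfderiv IM I b x v)) := by
  rw [thetaL_mul (b := fun y => κ (b y)) ha ((hκ.mdifferentiableAt _).comp x hb) v,
    thetaL_aut_comp hκ hb]

theorem isSmoothForm_sigmaTw (B : LinearMap.BilinForm ℝ (GroupLieAlgebra I G))
    (hκ : IsLieAut I κ) : IsSmoothForm (sigmaTw B κ) :=
  (isSmoothForm_sigmaForm B).pullback (contMDiff_prodMap_aut hκ)

theorem mfderiv_prodMap_aut (hκ : IsLieAut I κ) (z : G × G) (v : E × E) :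
    (mfderiv (I.prod I) (I.prod I) (Prod.map (id : G → G) κ) z v : E × E) =
      (v.1, (mfderiv I I κ z.2 v.2 : E)) := by
  have h := mfderiv_prodMap (I := I) (I' := I) (J := I) (J' := I) (p := z) (f := (id : G → G))
    (g := κ) mdifferentiableAt_id (hκ.mdifferentiableAt _)
  refine (congrArg (fun L : E × E →L[ℝ] E × E => L v) h).trans ?_
  rw [mfderiv_id]
  rfl

theorem sigmaTw_apply (B : LinearMap.BilinForm ℝ (GroupLieAlgebra I G)) (hκ : IsLieAut I κ)
    (z : G × G) (u : Fin 2 → E × E) :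
    sigmaTw B κ z u =
      -(1 / 2) * (B (thetaL I G z.1 (u 0).1) (lieAut I κ (thetaR I G z.2 (u 1).2)) -
        B (thetaL I G z.1 (u 1).1) (lieAut I κ (thetaR I G z.2 (u 0).2))) := by
  refine (sigmaForm_apply B (Prod.map id κ z) _).trans ?_
  have h (i : Fin 2) := mfderiv_prodMap_aut hκ z (u i)
  have h1 (i : Fin 2) := congrArg (fun w : E × E => thetaL I G z.1 w.1) (h i)
  have h2 (i : Fin 2) :=
    (congrArg (fun w : E × E => thetaR I G (κ z.2) w.2) (h i)).trans
      (thetaR_mfderiv_aut hκ z.2 (u i).2)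
  exact congrArg₂ (fun r s : ℝ => -(1 / 2) * (r - s))
    (congrArg₂ (fun p q => B p q) (h1 0) (h2 1)) (congrArg₂ (fun p q => B p q) (h1 1) (h2 0))

/-- The twisted multiplicative property `(Mult^κ)^* η = pr₁^* η + pr₂^* η + dς^κ`. -/
theorem pullback_twMult_cartanForm (hB : IsInvariantForm B) (hκ : IsLieAut I κ)
    (hBκ : InvariantUnder B κ) :
    pullback (twMult κ) (cartanForm B) =
      pullback (I := I.prod I) Prod.fst (cartanForm B) +
        pullback (I := I.prod I) Prod.snd (cartanForm B) + extD (sigmaTw B κ) := by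
  have hs := contMDiff_prodMap_aut hκ
  have hd : MDifferentiable (I.prod I) (I.prod I) (Prod.map (id : G → G) κ) :=
    hs.mdifferentiable (by simp)
  have h1 : pullback (I := I.prod I) (Prod.map id κ)
      (pullback (I := I.prod I) (fun z : G × G => z.1 * z.2) (cartanForm B)) =
      pullback (twMult κ) (cartanForm B) :=
    pullback_pullback ((contMDiff_mul I ∞).mdifferentiable (by simp)) hd _
  rw [sigmaTw, extD_pullback hs (isSmoothForm_sigmaForm B), ← h1, pullback_mul_cartanForm hB,
    pullback_add, pullback_add]
  congr 2
  · exact pullback_pullback (I' := I.prod I) (I'' := I) (Ψ := Prod.fst) mdifferentiable_fst hd _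
  · refine (pullback_pullback (I' := I.prod I) (I'' := I) (Ψ := Prod.snd) mdifferentiable_snd hd
      _).trans ?_
    refine (pullback_pullback (I' := I) (I'' := I) (Φ := Prod.snd) (Ψ := κ)
      (hκ.smooth.mdifferentiable (by simp)) mdifferentiable_snd _).symm.trans ?_
    exact congrArg _ (pullback_aut_cartanForm hB hκ hBκ)

theorem mfderiv_prodMk_apply {a b : M → G} {x : M} (ha : MDifferentiableAt IM I a x)
    (hb : MDifferentiableAt IM I b x) (v : TangentSpace IM x) :
    (mfderiv IM (I.prod I) (fun y => (a y, b y)) x v : E × E) =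
      ((mfderiv IM I a x v : E), (mfderiv IM I b x v : E)) := by
  rw [mfderiv_prodMk ha hb]
  rfl

/-- The `2`-form `-1/2 Φ₁^* θ^L · Φ₂^* κ^* θ^R` of the fusion construction is the pullback of `ς^κ`
under `(Φ₁, Φ₂)`. -/
theorem pullback_prodMk_sigmaTw (B : LinearMap.BilinForm ℝ (GroupLieAlgebra I G))
    (hκ : IsLieAut I κ) {Φ₁ Φ₂ : M → G} (h₁ : MDifferentiable IM I Φ₁)
    (h₂ : MDifferentiable IM I Φ₂) :
    pullback (I := IM) (fun x => (Φ₁ x, Φ₂ x)) (sigmaTw B κ) =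
      -((1 / 2 : ℝ) • dotWedge B (pullback₁ (I' := I) Φ₁ (thetaL I G))
          (pullback₁ (I' := I) Φ₂ (pullback₁ (I := I) (I' := I) κ (thetaR I G)))) := by
  funext x
  ext v
  refine (sigmaTw_apply B hκ (Φ₁ x, Φ₂ x) _).trans ?_
  have h (i : Fin 2) := mfderiv_prodMk_apply (h₁ x) (h₂ x) (v i)
  have e1 (i : Fin 2) := congrArg (fun w : E × E => thetaL I G (Φ₁ x) w.1) (h i)
  have e2 (i : Fin 2) :=
    (congrArg (fun w : E × E => lieAut I κ (thetaR I G (Φ₂ x) w.2)) (h i)).trans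
      (thetaR_mfderiv_aut hκ (Φ₂ x) (mfderiv IM I Φ₂ x (v i))).symm
  refine (congrArg₂ (fun r s : ℝ => -(1 / 2) * (r - s))
    (congrArg₂ (fun p q => B p q) (e1 0) (e2 1))
    (congrArg₂ (fun p q => B p q) (e1 1) (e2 0))).trans ?_
  have e3 := dotWedge_apply B (pullback₁ (I := IM) (I' := I) Φ₁ (thetaL I G))
    (pullback₁ (I' := I) Φ₂ (pullback₁ (I := I) (I' := I) κ (thetaR I G))) x v
  exact (neg_mul _ _).trans (congrArg (fun r : ℝ => -((1 / 2) * r)) e3.symm)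

end TwistedMultiplication

/-! ### The Courant bracket on Lagrangian subbundles -/

section CourantTensor

open VectorField

variable {E : Type*} [NormedAddCommGroup E] [NormedSpace ℝ E] [FiniteDimensional ℝ E]
  {H : Type*} [TopologicalSpace H] {I : ModelWithCorners ℝ E H} [I.Boundaryless]
  {M : Type*} [TopologicalSpace M] [ChartedSpace H M] [IsManifold I ∞ M]

theorem isSmoothSectionOn_univ {σ : (x : M) → Pont I x} : IsSmoothSectionOn σ Set.univ ↔
    ContMDiff I I.tangent ∞ (fun x => (⟨x, (σ x).1⟩ : TangentBundle I M)) ∧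
      IsSmoothForm (oneForm fun x => (σ x).2) := by
  rw [IsSmoothSectionOn, contMDiffOn_univ]
  rfl

theorem IsSmoothSectionOn.vector {σ : (x : M) → Pont I x} (h : IsSmoothSectionOn σ Set.univ) :
    ContMDiff I I.tangent ∞ (fun x => (⟨x, (σ x).1⟩ : TangentBundle I M)) :=
  (isSmoothSectionOn_univ.1 h).1

theorem IsSmoothSectionOn.covector {σ : (x : M) → Pont I x} (h : IsSmoothSectionOn σ Set.univ) :
    IsSmoothForm (oneForm fun x => (σ x).2) :=
  (isSmoothSectionOn_univ.1 h).2

theorem IsSmoothSectionOn.add {σ τ : (x : M) → Pont I x} (h : IsSmoothSectionOn σ Set.univ)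
    (h' : IsSmoothSectionOn τ Set.univ) :
    IsSmoothSectionOn (fun x => σ x + τ x) Set.univ := by
  have : IsManifold I 1 M := IsManifold.of_le (n := ∞) (by simp)
  refine isSmoothSectionOn_univ.2 ⟨h.vector.add_section h'.vector, ?_⟩
  exact h.covector.add h'.covector

theorem IsSmoothSectionOn.fun_smul {σ : (x : M) → Pont I x} (h : IsSmoothSectionOn σ Set.univ)
    {f : M → ℝ} (hf : ContMDiff I 𝓘(ℝ, ℝ) ∞ f) :
    IsSmoothSectionOn (fun x => f x • σ x) Set.univ := by
  have : IsManifold I 1 M := IsManifold.of_le (n := ∞) (by simp)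
  refine isSmoothSectionOn_univ.2 ⟨hf.smul_section h.vector, ?_⟩
  exact h.covector.fun_smul_oneForm hf

/-- The Courant tensor of three sections: the expression `⟨⟦σ, τ⟧, ρ⟩` for `σ` and `τ` orthogonal to
each other, with all exterior derivatives expanded by Cartan's formula. -/
def courantTriple (χ : DiffForm I M 3) (σ τ ρ : (x : M) → Pont I x) (x : M) : ℝ :=
  (ρ x).2 (mlieBracket I (fun y => (σ y).1) (fun y => (τ y).1) x)
    - (τ x).2 (mlieBracket I (fun y => (σ y).1) (fun y => (ρ y).1) x)
    + (σ x).2 (mlieBracket I (fun y => (τ y).1) (fun y => (ρ y).1) x)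
    + mvfderiv I (fun y => (τ y).2 (ρ y).1) x (σ x).1
    - mvfderiv I (fun y => (σ y).2 (ρ y).1) x (τ x).1
    + mvfderiv I (fun y => (σ y).2 (τ y).1) x (ρ x).1
    + χ x ![(τ x).1, (σ x).1, (ρ x).1]

theorem IsSmoothSectionOn.apply {σ τ : (x : M) → Pont I x} (h : IsSmoothSectionOn σ Set.univ)
    (h' : IsSmoothSectionOn τ Set.univ) :
    ContMDiff I 𝓘(ℝ, ℝ) ∞ (fun x => (σ x).2 (τ x).1) :=
  contMDiff_oneForm_apply h.covector h'.vector

/-- For sections `σ` and `τ` orthogonal to each other, `courantTriple` computes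
`⟨⟦σ, τ⟧, ρ⟩`. -/
theorem pairing_courant (χ : DiffForm I M 3) {σ τ ρ : (x : M) → Pont I x}
    (hσ : IsSmoothSectionOn σ Set.univ) (hτ : IsSmoothSectionOn τ Set.univ)
    (hρ : IsSmoothSectionOn ρ Set.univ) (hστ : ∀ x, pairing (σ x) (τ x) = 0) (x : M) :
    pairing (courant χ σ τ x) (ρ x) = courantTriple χ σ τ ρ x := by
  have h1 := extD_oneForm_vectorField hτ.covector hσ.vector hρ.vector x
  have h2 := extD_oneForm_vectorField hσ.covector hτ.vector hρ.vector x
  have h3 : mvfderiv I (fun y => (τ y).2 (σ y).1) x (ρ x).1 =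
      -mvfderiv I (fun y => (σ y).2 (τ y).1) x (ρ x).1 := by
    have e : (fun y => (τ y).2 (σ y).1) = -fun y => (σ y).2 (τ y).1 := by
      funext y
      exact eq_neg_of_add_eq_zero_left (hστ y)
    rw [e, mvfderiv_neg]
    rfl
  have h4 : (courant χ σ τ x).2 (ρ x).1 =
      extD (oneForm fun y => (τ y).2) x ![(σ x).1, (ρ x).1]
        + mvfderiv I (fun y => (τ y).2 (σ y).1) x (ρ x).1
        - extD (oneForm fun y => (σ y).2) x ![(τ x).1, (ρ x).1]
        + χ x ![(τ x).1, (σ x).1, (ρ x).1] := by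
    rw [← contract₂_apply, ← contract₂_apply, ← contract₃_apply]
    rfl
  rw [pairing, h4, h1, h2, h3, courantTriple]
  change (ρ x).2 (mlieBracket I (fun y => (σ y).1) (fun y => (τ y).1) x) + _ = _
  ring

theorem courantTriple_add (χ : DiffForm I M 3) {σ σ' τ ρ : (x : M) → Pont I x}
    (hσ : IsSmoothSectionOn σ Set.univ) (hσ' : IsSmoothSectionOn σ' Set.univ)
    (hτ : IsSmoothSectionOn τ Set.univ) (hρ : IsSmoothSectionOn ρ Set.univ) (x : M) :
    courantTriple χ (fun x => σ x + σ' x) τ ρ x =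
      courantTriple χ σ τ ρ x + courantTriple χ σ' τ ρ x := by
  have : CompleteSpace E := FiniteDimensional.complete ℝ E
  have h0 {ζ : (x : M) → Pont I x} (hζ : IsSmoothSectionOn ζ Set.univ) :
      MDifferentiableAt I I.tangent (fun x => (⟨x, (ζ x).1⟩ : TangentBundle I M)) x :=
    hζ.vector.mdifferentiableAt (by simp)
  have h1 (ζ : (x : M) → Pont I x) :
      mlieBracket I (fun y => (σ y + σ' y).1) (fun y => (ζ y).1) x =
      mlieBracket I (fun y => (σ y).1) (fun y => (ζ y).1) x +
        mlieBracket I (fun y => (σ' y).1) (fun y => (ζ y).1) x :=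
    mlieBracket_add_left (h0 hσ) (h0 hσ')
  have h2 {ζ : (x : M) → Pont I x} (hζ : IsSmoothSectionOn ζ Set.univ) (v : TangentSpace I x) :
      mvfderiv I (fun y => (σ y + σ' y).2 (ζ y).1) x v =
      mvfderiv I (fun y => (σ y).2 (ζ y).1) x v + mvfderiv I (fun y => (σ' y).2 (ζ y).1) x v :=
    congrArg (fun L => L v) (mvfderiv_add ((hσ.apply hζ).mdifferentiableAt (by simp))
      ((hσ'.apply hζ).mdifferentiableAt (by simp)))
  have h3 : χ x ![(τ x).1, (σ x + σ' x).1, (ρ x).1] =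
      χ x ![(τ x).1, (σ x).1, (ρ x).1] + χ x ![(τ x).1, (σ' x).1, (ρ x).1] := by
    have h := (χ x).map_update_add ![(τ x).1, 0, (ρ x).1] 1 (σ x).1 (σ' x).1
    have e (v : TangentSpace I x) : Function.update ![(τ x).1, 0, (ρ x).1] 1 v =
        ![(τ x).1, v, (ρ x).1] := by
      ext i; fin_cases i <;> rfl
    rwa [e, e, e] at h
  simp only [courantTriple]
  rw [h1, h1, h2 hρ, h2 hτ, h3, map_add, map_add]
  simp only [Prod.fst_add, Prod.snd_add, map_add, add_apply]
  ring

/-- The Courant tensor is linear over functions in an argument orthogonal to the other two: the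
derivatives of `f` enter only multiplied by the pairings of `σ` with `τ` and `ρ`. -/
theorem courantTriple_smul (χ : DiffForm I M 3) {σ τ ρ : (x : M) → Pont I x} {f : M → ℝ}
    (hf : ContMDiff I 𝓘(ℝ, ℝ) ∞ f) (hσ : IsSmoothSectionOn σ Set.univ)
    (hτ : IsSmoothSectionOn τ Set.univ) (hρ : IsSmoothSectionOn ρ Set.univ)
    (hστ : ∀ x, pairing (σ x) (τ x) = 0) (hσρ : ∀ x, pairing (σ x) (ρ x) = 0) (x : M) :
    courantTriple χ (fun x => f x • σ x) τ ρ x = f x * courantTriple χ σ τ ρ x := by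
  have : CompleteSpace E := FiniteDimensional.complete ℝ E
  have hfx : MDifferentiableAt I 𝓘(ℝ, ℝ) f x := hf.mdifferentiableAt (by simp)
  have h1 (ζ : (x : M) → Pont I x) :
      mlieBracket I (fun y => (f y • σ y).1) (fun y => (ζ y).1) x =
      -mvfderiv I f x (ζ x).1 • (σ x).1 +
        f x • mlieBracket I (fun y => (σ y).1) (fun y => (ζ y).1) x :=
    mlieBracket_smul_left hfx (hσ.vector.mdifferentiableAt (by simp))
  have h2 {ζ : (x : M) → Pont I x} (hζ : IsSmoothSectionOn ζ Set.univ) (v : TangentSpace I x) :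
      mvfderiv I (fun y => (f y • σ y).2 (ζ y).1) x v =
      f x * mvfderiv I (fun y => (σ y).2 (ζ y).1) x v +
        mvfderiv I f x v * (σ x).2 (ζ x).1 :=
    congrArg (fun L => L v) (mvfderiv_smul hfx ((hσ.apply hζ).mdifferentiableAt (by simp)))
  have h3 : χ x ![(τ x).1, (f x • σ x).1, (ρ x).1] = f x * χ x ![(τ x).1, (σ x).1, (ρ x).1] := by
    have h := (χ x).map_update_smul ![(τ x).1, 0, (ρ x).1] 1 (f x) (σ x).1
    have e (v : TangentSpace I x) : Function.update ![(τ x).1, 0, (ρ x).1] 1 v =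
        ![(τ x).1, v, (ρ x).1] := by
      ext i; fin_cases i <;> rfl
    rwa [e, e] at h
  have h4 := hστ x
  have h5 := hσρ x
  simp only [pairing] at h4 h5
  simp only [courantTriple]
  rw [h1, h1, h2 hρ, h2 hτ, h3, map_add, map_add, map_smul, map_smul, map_smul, map_smul]
  simp only [Prod.smul_fst, Prod.smul_snd, map_smul, smul_apply, smul_eq_mul]
  linear_combination (-mvfderiv I f x (τ x).1) * h5 + mvfderiv I f x (ρ x).1 * h4

theorem courantTriple_swap (χ : DiffForm I M 3) {σ τ ρ : (x : M) → Pont I x}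
    (hστ : ∀ x, pairing (σ x) (τ x) = 0) (x : M) :
    courantTriple χ τ σ ρ x = -courantTriple χ σ τ ρ x := by
  have h3 : mvfderiv I (fun y => (τ y).2 (σ y).1) x (ρ x).1 =
      -mvfderiv I (fun y => (σ y).2 (τ y).1) x (ρ x).1 := by
    have e : (fun y => (τ y).2 (σ y).1) = -fun y => (σ y).2 (τ y).1 := by
      funext y
      exact eq_neg_of_add_eq_zero_left (hστ y)
    rw [e, mvfderiv_neg]
    rfl
  have h4 : χ x ![(τ x).1, (σ x).1, (ρ x).1] = -χ x ![(σ x).1, (τ x).1, (ρ x).1] := by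
    have h := (χ x).map_swap ![(σ x).1, (τ x).1, (ρ x).1] (i := 0) (j := 1) (by decide)
    refine Eq.trans (congrArg (χ x) (funext fun i => ?_)) h
    fin_cases i <;> rfl
  simp only [courantTriple]
  rw [h3, h4, mlieBracket_swap_apply (V := fun y => (τ y).1) (W := fun y => (σ y).1), map_neg]
  ring

theorem isSmoothSectionOn_zero : IsSmoothSectionOn (fun x : M => (0 : Pont I x)) Set.univ := by
  have : IsManifold I 1 M := IsManifold.of_le (n := ∞) (by simp)
  refine isSmoothSectionOn_univ.2 ⟨Bundle.contMDiff_zeroSection ℝ (TangentSpace I : M → Type _), ?_⟩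
  have e : (oneForm fun x : M => (0 : Pont I x).2) = 0 := by
    funext x; ext; rfl
  rw [e]
  exact IsSmoothForm.zero

theorem courantTriple_sum (χ : DiffForm I M 3) {ι : Type*} (t : Finset ι)
    {e : ι → (x : M) → Pont I x} {s : ι → M → ℝ} {τ ρ : (x : M) → Pont I x}
    (he : ∀ i, IsSmoothSectionOn (e i) Set.univ) (hs : ∀ i, ContMDiff I 𝓘(ℝ, ℝ) ∞ (s i))
    (hτ : IsSmoothSectionOn τ Set.univ) (hρ : IsSmoothSectionOn ρ Set.univ)
    (heτ : ∀ i x, pairing (e i x) (τ x) = 0) (heρ : ∀ i x, pairing (e i x) (ρ x) = 0) :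
    IsSmoothSectionOn (fun x => ∑ i ∈ t, s i x • e i x) Set.univ ∧
      ∀ x, courantTriple χ (fun x => ∑ i ∈ t, s i x • e i x) τ ρ x =
        ∑ i ∈ t, s i x * courantTriple χ (e i) τ ρ x := by
  classical
  induction t using Finset.induction_on with
  | empty =>
    have h0 := isSmoothSectionOn_zero (I := I) (M := M)
    refine ⟨by simpa only [Finset.sum_empty] using h0, fun x => ?_⟩
    have h := courantTriple_add χ h0 h0 hτ hρ x
    simp only [add_zero] at h
    simp only [Finset.sum_empty]
    exact left_eq_add.1 h
  | insert a t ha ih =>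
    have h1 := (he a).fun_smul (hs a)
    simp only [Finset.sum_insert ha]
    refine ⟨h1.add ih.1, fun x => ?_⟩
    rw [courantTriple_add χ h1 ih.1 hτ hρ, ih.2,
      courantTriple_smul χ (hs a) (he a) hτ hρ (heτ a) (heρ a)]

/-- A Lagrangian subbundle with a global smooth frame is involutive as soon as the Courant tensor
vanishes on the members of the frame. -/
theorem courant_mem_of_frame {χ : DiffForm I M 3} {L : (x : M) → Submodule ℝ (Pont I x)}
    (hL : ∀ (x : M) (p : Pont I x), p ∈ L x ↔ ∀ q ∈ L x, pairing p q = 0)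
    {ι : Type*} [Fintype ι] {e : ι → (x : M) → Pont I x}
    (he : ∀ i, IsSmoothSectionOn (e i) Set.univ)
    (hspan : ∀ x, Submodule.span ℝ (Set.range fun i => e i x) = L x)
    (hcoef : ∀ σ : (x : M) → Pont I x, IsSmoothSectionOn σ Set.univ → (∀ x, σ x ∈ L x) →
      ∃ s : ι → M → ℝ, (∀ i, ContMDiff I 𝓘(ℝ, ℝ) ∞ (s i)) ∧ ∀ x, σ x = ∑ i, s i x • e i x)
    (hT : ∀ i j k x, courantTriple χ (e i) (e j) (e k) x = 0)
    {σ τ : (x : M) → Pont I x} (hσ : IsSmoothSectionOn σ Set.univ)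
    (hτ : IsSmoothSectionOn τ Set.univ) (hσL : ∀ x, σ x ∈ L x) (hτL : ∀ x, τ x ∈ L x) (x : M) :
    courant χ σ τ x ∈ L x := by
  have heL (i : ι) (x : M) : e i x ∈ L x := by
    rw [← hspan]
    exact Submodule.subset_span ⟨i, rfl⟩
  have key {ζ : (x : M) → Pont I x} (hζ : IsSmoothSectionOn ζ Set.univ) (hζL : ∀ x, ζ x ∈ L x)
      {ζ' : (x : M) → Pont I x} (hζ' : IsSmoothSectionOn ζ' Set.univ) (hζL' : ∀ x, ζ' x ∈ L x)
      (k : ι) (h : ∀ i x, courantTriple χ (e i) ζ' (e k) x = 0) (x : M) :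
      courantTriple χ ζ ζ' (e k) x = 0 := by
    obtain ⟨s, hs, hζs⟩ := hcoef ζ hζ hζL
    obtain rfl : ζ = fun x => ∑ i, s i x • e i x := funext hζs
    rw [(courantTriple_sum χ Finset.univ he hs hζ' (he k)
      (fun i x => (hL x _).1 (heL i x) _ (hζL' x))
      fun i x => (hL x _).1 (heL i x) _ (heL k x)).2]
    exact Finset.sum_eq_zero fun i _ => by rw [h, mul_zero]
  have h1 (k : ι) (x : M) : pairing (courant χ σ τ x) (e k x) = 0 := by
    rw [pairing_courant χ hσ hτ (he k) fun x => (hL x _).1 (hσL x) _ (hτL x)]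
    refine key hσ hσL hτ hτL k (fun i x => ?_) x
    rw [← neg_eq_zero, ← courantTriple_swap χ fun x => (hL x _).1 (heL i x) _ (hτL x)]
    exact key hτ hτL (he i) (heL i) k (fun j x => hT j i k x) x
  rw [hL]
  intro q hq
  rw [← hspan] at hq
  induction hq using Submodule.span_induction with
  | mem q hq =>
    obtain ⟨k, rfl⟩ := hq
    exact h1 k x
  | zero => simp [pairing]
  | add p q _ _ hp hq =>
    simp only [pairing, Prod.fst_add, Prod.snd_add, map_add, add_apply] at hp hq ⊢
    linarith
  | smul c p _ hp =>
    simp only [pairing, Prod.smul_fst, Prod.smul_snd, map_smul, smul_apply, smul_eq_mul] at hp ⊢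
    rw [← mul_add, hp, mul_zero]

end CourantTensor

/-! ### The twisted Cartan–Dirac structure -/

section CartanDirac

open VectorField

variable {E : Type*} [NormedAddCommGroup E] [NormedSpace ℝ E] [FiniteDimensional ℝ E]
  {H : Type*} [TopologicalSpace H] {I : ModelWithCorners ℝ E H} [I.Boundaryless]
  {G : Type*} [TopologicalSpace G] [ChartedSpace H G] [Group G] [LieGroup I ∞ G]
  {B : LinearMap.BilinForm ℝ (GroupLieAlgebra I G)} {κ : MulAut G}

theorem IsInvariantForm.eq_of_forall (hB : IsInvariantForm B) {x y : GroupLieAlgebra I G}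
    (h : ∀ z, B x z = B y z) : x = y := by
  refine sub_eq_zero.1 (hB.nondegenerate.1 _ fun z => ?_)
  rw [map_sub, LinearMap.sub_apply, h, sub_self]

theorem IsInvariantForm.adj_left (hB : IsInvariantForm B) (g : G) (x y : GroupLieAlgebra I G) :
    B (TqHam.adj I g x) y = B x (TqHam.adj I g⁻¹ y) := by
  rw [← hB.adj g x, adj_adj_inv]

theorem thetaL_eMap_fst (B : LinearMap.BilinForm ℝ (GroupLieAlgebra I G)) (κ : MulAut G) (g : G)
    (x : GroupLieAlgebra I G) :
    thetaL I G g (eMap B κ g x).1 = lieAut I κ x - adj I g⁻¹ x := by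
  change thetaL I G g (leftField g (lieAut I κ x) - rightField g x) = _
  rw [map_sub, thetaL_leftField, thetaL_rightField]

theorem eMap_snd_apply (hB : IsInvariantForm B) (κ : MulAut G) (g : G)
    (x : GroupLieAlgebra I G) (v : TangentSpace I g) :
    (eMap B κ g x).2 v = 1 / 2 * B (lieAut I κ x + adj I g⁻¹ x) (thetaL I G g v) := by
  change 1 / 2 * (B (thetaL I G g v) (lieAut I κ x) + B (thetaR I G g v) x) = _
  rw [thetaR_eq_adj, hB.adj_left, map_add, LinearMap.add_apply, hB.comm (lieAut I κ x),
    hB.comm (adj I g⁻¹ x)]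

theorem eMap_apply_leftField (hB : IsInvariantForm B) (κ : MulAut G) (g : G)
    (x y : GroupLieAlgebra I G) :
    (eMap B κ g x).2 (leftField g y) = 1 / 2 * B (lieAut I κ x + adj I g⁻¹ x) y := by
  rw [eMap_snd_apply hB, thetaL_leftField]

theorem pont_ext {g : G} {p q : Pont I g} (h₁ : thetaL I G g p.1 = thetaL I G g q.1)
    (h₂ : ∀ y, p.2 (leftField g y) = q.2 (leftField g y)) : p = q := by
  refine Prod.ext (thetaL_injective g h₁) (ContinuousLinearMap.ext fun v => ?_)
  rw [← leftField_thetaL g v, h₂]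

theorem eMap_injective (hB : IsInvariantForm B) (hκ : IsLieAut I κ) (g : G) :
    Function.Injective (eMap B κ g) := by
  rw [injective_iff_map_eq_zero]
  intro x hx
  have h1 : lieAut I κ x - adj I g⁻¹ x = 0 := by
    rw [← thetaL_eMap_fst B κ g x, hx]
    exact map_zero _
  have h2 : lieAut I κ x + adj I g⁻¹ x = 0 := by
    refine hB.eq_of_forall fun y => ?_
    have h := eMap_apply_leftField hB κ g x y
    rw [hx] at h
    have h' : (0 : ℝ) = 1 / 2 * B (lieAut I κ x + adj I g⁻¹ x) y := h
    rw [map_zero, LinearMap.zero_apply]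
    linarith
  have h3 : (2 : ℝ) • lieAut I κ x = 0 := by
    rw [two_smul, ← add_zero (0 : GroupLieAlgebra I G)]
    nth_rw 1 [← h1]
    rw [← h2]
    abel
  have h4 : lieAut I κ x = 0 := (smul_eq_zero.1 h3).resolve_left two_ne_zero
  rw [← lieAut_inv_apply hκ x, h4, map_zero]

/-- The value of `e^κ(ξ)` paired with `X ⊕ α`, in terms of `θ^L(X)` and the vector dual to `α`. -/
theorem pairing_eMap (hB : IsInvariantForm B) (κ : MulAut G) (g : G) (p : Pont I g)
    (x : GroupLieAlgebra I G) :
    pairing p (eMap B κ g x) = 1 / 2 * B (lieAut I κ x + adj I g⁻¹ x) (thetaL I G g p.1) +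
      p.2 (leftField g (lieAut I κ x - adj I g⁻¹ x)) := by
  rw [pairing, eMap_snd_apply hB, ← thetaL_eMap_fst B, leftField_thetaL]

theorem IsInvariantForm.exists_dual (hB : IsInvariantForm B) (f : GroupLieAlgebra I G →ₗ[ℝ] ℝ) :
    ∃ a, ∀ y, B a y = f y :=
  ⟨(B.toDual hB.nondegenerate).symm f, fun y =>
    LinearMap.BilinForm.apply_toDual_symm_apply (hB := hB.nondegenerate) f y⟩

/-- The subbundle `E_G^κ` is Lagrangian. -/
theorem mem_cartanDirac_iff (hB : IsInvariantForm B) (hκ : IsLieAut I κ)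
    (hBκ : InvariantUnder B κ) (g : G) (p : Pont I g) :
    p ∈ cartanDirac B κ g ↔ ∀ q ∈ cartanDirac B κ g, pairing p q = 0 := by
  constructor
  · rintro ⟨x, rfl⟩ _ ⟨y, rfl⟩
    rw [pairing_eMap hB, thetaL_eMap_fst, eMap_apply_leftField hB]
    simp only [map_add, map_sub, LinearMap.add_apply]
    have h1 := hBκ x y
    have h2 := hB.adj g⁻¹ x y
    have h3 := hB.comm (lieAut I κ x) (lieAut I κ y)
    have h4 := hB.comm (adj I g⁻¹ x) (adj I g⁻¹ y)
    have h5 := hB.comm (adj I g⁻¹ x) (lieAut I κ y)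
    have h6 := hB.comm (lieAut I κ x) (adj I g⁻¹ y)
    linarith
  · intro h
    obtain ⟨a, ha⟩ := hB.exists_dual (p.2.toLinearMap ∘ₗ (leftField (I := I) g).toLinearMap)
    have ha' (y : GroupLieAlgebra I G) : p.2 (leftField g y) = B a y := (ha y).symm
    -- the vector `ξ` is determined by `κ(ξ) = a + θ^L(X) / 2`
    let x := lieAut I κ⁻¹ (a + (1 / 2 : ℝ) • thetaL I G g p.1)
    have hx : lieAut I κ x = a + (1 / 2 : ℝ) • thetaL I G g p.1 := lieAut_apply_inv hκ _
    have hx' : adj I g⁻¹ x = a - (1 / 2 : ℝ) • thetaL I G g p.1 := by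
      refine hB.eq_of_forall fun z => ?_
      have h1 := h _ ⟨adj I g z, rfl⟩
      rw [pairing_eMap hB, ha', adj_inv_adj] at h1
      have h2 : B (adj I g⁻¹ x) z = B (lieAut I κ x) (lieAut I κ (adj I g z)) := by
        rw [hBκ, hB.adj_left, inv_inv]
      rw [h2, hx]
      simp only [map_add, map_sub, LinearMap.add_apply, LinearMap.sub_apply, map_smul,
        LinearMap.smul_apply, smul_eq_mul] at h1 ⊢
      have h3 := hB.comm (lieAut I κ (adj I g z)) (thetaL I G g p.1)
      have h4 := hB.comm z (thetaL I G g p.1)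
      linarith
    refine ⟨x, pont_ext ?_ fun y => ?_⟩
    · rw [thetaL_eMap_fst, hx, hx', add_sub_sub_cancel, ← add_smul]
      norm_num
    · rw [eMap_apply_leftField hB, hx, hx', ha', add_add_sub_cancel, map_add, LinearMap.add_apply]
      ring

theorem isSmoothSectionOn_eMap (B : LinearMap.BilinForm ℝ (GroupLieAlgebra I G)) (κ : MulAut G)
    (x : GroupLieAlgebra I G) : IsSmoothSectionOn (fun g => eMap B κ g x) Set.univ := by
  have : IsManifold I 1 G := IsManifold.of_le (n := ∞) (by simp)
  refine isSmoothSectionOn_univ.2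
    ⟨(contMDiff_leftField (lieAut I κ x)).sub_section (contMDiff_rightField x), ?_⟩
  exact ((isSmoothForm_thetaL (B.flip (lieAut I κ x)).toContinuousLinearMap).add
    (isSmoothForm_thetaR (B.flip x).toContinuousLinearMap)).const_smul (1 / 2)

theorem span_eMap {ι : Type*} (b : Module.Basis ι ℝ (GroupLieAlgebra I G)) (g : G) :
    Submodule.span ℝ (Set.range fun i => eMap B κ g (b i)) = cartanDirac B κ g := by
  have h : (Set.range fun i => eMap B κ g (b i)) = eMap B κ g '' Set.range b := by
    rw [← Set.range_comp]; rfl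
  rw [h, ← Submodule.map_span, b.span_eq, Submodule.map_top]
  rfl

/-- A smooth section of `E_G^κ` is a combination of the sections `e^κ(b_i)` with smooth
coefficients, given by pairing with the dual basis. -/
theorem exists_smooth_coeff (hB : IsInvariantForm B)
    (hBκ : InvariantUnder B κ) {ι : Type*} [Fintype ι] [DecidableEq ι]
    (b : Module.Basis ι ℝ (GroupLieAlgebra I G)) {σ : (g : G) → Pont I g}
    (hσ : IsSmoothSectionOn σ Set.univ) (hσL : ∀ g, σ g ∈ cartanDirac B κ g) :
    ∃ s : ι → G → ℝ, (∀ i, ContMDiff I 𝓘(ℝ, ℝ) ∞ (s i)) ∧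
      ∀ g, σ g = ∑ i, s i g • eMap B κ g (b i) := by
  let d := B.dualBasis hB.nondegenerate b
  refine ⟨fun i g => (σ g).2 (leftField g (lieAut I κ (d i))) +
    1 / 2 * B (lieAut I κ (d i)) (thetaL I G g (σ g).1), fun i => ?_, fun g => ?_⟩
  · have h1 : ContMDiff I 𝓘(ℝ, ℝ) ∞ (fun g => (σ g).2 (leftField g (lieAut I κ (d i)))) :=
      contMDiff_oneForm_apply hσ.covector (contMDiff_leftField _)
    have h2 : ContMDiff I 𝓘(ℝ, ℝ) ∞ (fun g => B (lieAut I κ (d i)) (thetaL I G g (σ g).1)) :=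
      contMDiff_oneForm_apply (isSmoothForm_thetaL (B (lieAut I κ (d i))).toContinuousLinearMap)
        hσ.vector
    exact h1.add ((contMDiff_const (c := (1 / 2 : ℝ))).mul h2)
  · obtain ⟨x, hx⟩ := hσL g
    have h (i : ι) : (σ g).2 (leftField g (lieAut I κ (d i))) +
        1 / 2 * B (lieAut I κ (d i)) (thetaL I G g (σ g).1) = b.repr x i := by
      rw [← hx, eMap_apply_leftField hB, thetaL_eMap_fst]
      have h1 : B (d i) x = b.repr x i := by
        conv_lhs => rw [← b.sum_repr x]
        rw [map_sum, Finset.sum_eq_single i]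
        · rw [map_smul, LinearMap.BilinForm.apply_dualBasis_left, if_pos rfl, smul_eq_mul, mul_one]
        · intro j _ hj
          rw [map_smul, LinearMap.BilinForm.apply_dualBasis_left, if_neg hj, smul_zero]
        · simp
      have h2 := hBκ (d i) x
      rw [hB.comm (lieAut I κ x + adj I g⁻¹ x)]
      rw [map_add, map_sub]
      linarith
    simp only [h]
    simp only [← map_smul, ← map_sum]
    rw [b.sum_repr, hx]

theorem mlieBracket_eMap (B : LinearMap.BilinForm ℝ (GroupLieAlgebra I G)) (κ : MulAut G) (g : G)
    (x y : GroupLieAlgebra I G) :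
    thetaL I G g (mlieBracket I (fun g => (eMap B κ g x).1) (fun g => (eMap B κ g y).1) g) =
      lieBilin I G (lieAut I κ x) (lieAut I κ y) - lieBilin I G (adj I g⁻¹ x) (adj I g⁻¹ y) := by
  refine eq_of_forall_covector fun l => ?_
  have h := extD_oneForm_vectorField (isSmoothForm_thetaL l)
    (isSmoothSectionOn_eMap B κ x).vector (isSmoothSectionOn_eMap B κ y).vector g
  have hd (x : GroupLieAlgebra I G) (v : TangentSpace I g) :
      mvfderiv I (fun g => covectorComp l (thetaL I G) g (eMap B κ g x).1) g v =
        -l (lieBilin I G (adj I g⁻¹ x) (thetaL I G g v)) := by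
    have e : (fun g => covectorComp l (thetaL I G) g (eMap B κ g x).1) =
        (fun _ : G => l (lieAut I κ x)) - fun g : G => l (adj I g⁻¹ x) := by
      funext g
      exact (congrArg l (thetaL_eMap_fst B κ g x)).trans (map_sub l _ _)
    rw [e, mvfderiv_sub mdifferentiableAt_const
      ((contMDiff_covector_adj_inv l x).mdifferentiableAt (by simp)), mvfderiv_const, zero_sub,
      neg_apply, mvfderiv_covector_adj_inv]
  rw [hd, hd, extD_thetaL, thetaL_eMap_fst, thetaL_eMap_fst] at h
  have h' : l (thetaL I G g
      (mlieBracket I (fun g => (eMap B κ g x).1) (fun g => (eMap B κ g y).1) g)) =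
      covectorComp l (thetaL I G) g
        (mlieBracket I (fun g => (eMap B κ g x).1) (fun g => (eMap B κ g y).1) g) := rfl
  rw [h']
  have h1 := congrArg l (lieBilin_swap (lieAut I κ x) (adj I g⁻¹ y))
  have h2 := congrArg l (lieBilin_swap (adj I g⁻¹ x) (adj I g⁻¹ y))
  simp only [map_sub, LinearMap.sub_apply, map_neg] at h h1 h2 ⊢
  linarith

theorem mvfderiv_eMap (hB : IsInvariantForm B) (hBκ : InvariantUnder B κ) (g : G)
    (x y : GroupLieAlgebra I G) (v : TangentSpace I g) :
    mvfderiv I (fun g => (eMap B κ g x).2 (eMap B κ g y).1) g v =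
      1 / 2 * (B (lieAut I κ y) (lieBilin I G (adj I g⁻¹ x) (thetaL I G g v)) -
        B (lieAut I κ x) (lieBilin I G (adj I g⁻¹ y) (thetaL I G g v))) := by
  have e : (fun g => (eMap B κ g x).2 (eMap B κ g y).1) = (fun _ : G => (1 / 2 : ℝ)) •
      ((fun g : G => (B (lieAut I κ y)).toContinuousLinearMap (adj I g⁻¹ x)) -
        fun g : G => (B (lieAut I κ x)).toContinuousLinearMap (adj I g⁻¹ y)) := by
    funext g
    rw [eMap_snd_apply hB, thetaL_eMap_fst]
    change _ = 1 / 2 * (B (lieAut I κ y) (adj I g⁻¹ x) - B (lieAut I κ x) (adj I g⁻¹ y))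
    have h1 := hBκ x y
    have h2 := hB.adj g⁻¹ x y
    have h3 := hB.comm (adj I g⁻¹ x) (lieAut I κ y)
    simp only [map_add, map_sub, LinearMap.add_apply]
    linarith
  have hd (l : GroupLieAlgebra I G →L[ℝ] ℝ) (x : GroupLieAlgebra I G) :=
    (contMDiff_covector_adj_inv l x).mdifferentiableAt (x := g) (by simp)
  rw [e, mvfderiv_smul mdifferentiableAt_const (((hd _ x)).sub (hd _ y)), mvfderiv_const,
    mvfderiv_sub (hd _ x) (hd _ y)]
  simp only [add_apply, smul_apply, sub_apply, mvfderiv_covector_adj_inv]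
  simp

/-- The Courant tensor of `η` vanishes on the sections `e^κ(ξ)`. After `θ^L` is applied it is an
alternating cubic expression in `κ(ξ)` and `Ad_{g⁻¹} ξ`, and the surviving difference of the pure
terms vanishes because `κ` and `Ad_{g⁻¹}` preserve both the bracket and `B`. -/
theorem courantTriple_eMap (hB : IsInvariantForm B) (hκ : IsLieAut I κ) (hBκ : InvariantUnder B κ)
    (g : G) (x y z : GroupLieAlgebra I G) :
    courantTriple (cartanForm B) (fun g => eMap B κ g x) (fun g => eMap B κ g y)
      (fun g => eMap B κ g z) g = 0 := by
  rw [courantTriple, eMap_snd_apply hB, eMap_snd_apply hB, eMap_snd_apply hB, mlieBracket_eMap,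
    mlieBracket_eMap, mlieBracket_eMap, mvfderiv_eMap hB hBκ, mvfderiv_eMap hB hBκ,
    mvfderiv_eMap hB hBκ, cartanForm_apply hB]
  change _ + 1 / 2 * B (lieBilin I G (thetaL I G g (eMap B κ g y).1)
    (thetaL I G g (eMap B κ g x).1)) (thetaL I G g (eMap B κ g z).1) = 0
  rw [thetaL_eMap_fst, thetaL_eMap_fst, thetaL_eMap_fst]
  have e1 : B (lieBilin I G (lieAut I κ x) (lieAut I κ y)) (lieAut I κ z) =
      B (lieBilin I G (adj I g⁻¹ x) (adj I g⁻¹ y)) (adj I g⁻¹ z) := by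
    rw [← lieAut_lieBilin hκ, hBκ, ← adj_lieBilin, hB.adj]
  generalize lieAut I κ x = x₁ at *
  generalize lieAut I κ y = y₁ at *
  generalize lieAut I κ z = z₁ at *
  generalize adj I g⁻¹ x = x₂ at *
  generalize adj I g⁻¹ y = y₂ at *
  generalize adj I g⁻¹ z = z₂ at *
  -- every term is expressed through the totally antisymmetric form `B([·, ·], ·)`
  have hc (a b c : GroupLieAlgebra I G) :
      B c (lieBilin I G a b) = B (lieBilin I G a b) c := hB.comm _ _
  simp only [map_add, map_sub, LinearMap.add_apply, LinearMap.sub_apply, hc]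
  have F (a b c : GroupLieAlgebra I G) :
      B (lieBilin I G b c) a = B (lieBilin I G a b) c ∧
      B (lieBilin I G c a) b = B (lieBilin I G a b) c ∧
      B (lieBilin I G b a) c = -B (lieBilin I G a b) c ∧
      B (lieBilin I G a c) b = -B (lieBilin I G a b) c ∧
      B (lieBilin I G c b) a = -B (lieBilin I G a b) c := by
    have h1 := hB.lieBilin_cyclic a b c
    have h2 := hB.lieBilin_cyclic b c a
    have h3 := bilin_lieBilin_swap B b a c
    have h4 := bilin_lieBilin_swap B a c b
    have h5 := bilin_lieBilin_swap B c b a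
    refine ⟨?_, ?_, ?_, ?_, ?_⟩ <;> linarith
  simp only [F x₁ y₁ z₁, F x₁ y₁ z₂, F x₁ y₂ z₁, F x₁ y₂ z₂, F x₂ y₁ z₁, F x₂ y₁ z₂, F x₂ y₂ z₁,
    F x₂ y₂ z₂]
  linarith

/-- The twisted Cartan-Dirac structure is a Dirac structure. -/
theorem isDiracStructure_cartanDirac (hB : IsInvariantForm B) (hκ : IsLieAut I κ)
    (hBκ : InvariantUnder B κ) : IsDiracStructure (cartanForm B) (cartanDirac B κ) where
  smooth_form := isSmoothForm_cartanForm hB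
  closed := extD_cartanForm hB
  subbundle _ := by
    let b := Module.finBasis ℝ (GroupLieAlgebra I G)
    refine ⟨Set.univ, isOpen_univ, Set.mem_univ _, _, fun i g => eMap B κ g (b i),
      fun i => isSmoothSectionOn_eMap B κ (b i), fun g _ => ⟨?_, span_eMap b g⟩⟩
    exact b.linearIndependent.map' _ (LinearMap.ker_eq_bot.2 (eMap_injective hB hκ g))
  lagrangian := mem_cartanDirac_iff hB hκ hBκ
  involutive _ _ hσ hτ hσL hτL x :=
    courant_mem_of_frame (mem_cartanDirac_iff hB hκ hBκ)
      (fun i => isSmoothSectionOn_eMap B κ (Module.finBasis ℝ (GroupLieAlgebra I G) i))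
      (span_eMap _) (fun _ hσ hσL => exists_smooth_coeff hB hBκ _ hσ hσL)
      (fun _ _ _ g => courantTriple_eMap hB hκ hBκ g _ _ _) hσ hτ hσL hτL x

end CartanDirac

/-! ### Product groups -/

section ProductGroups

variable {E : Type*} [NormedAddCommGroup E] [NormedSpace ℝ E] [FiniteDimensional ℝ E]
  {H : Type*} [TopologicalSpace H] {I : ModelWithCorners ℝ E H} [I.Boundaryless]
  {G : Type*} [TopologicalSpace G] [ChartedSpace H G] [Group G] [LieGroup I ∞ G]
  {E' : Type*} [NormedAddCommGroup E'] [NormedSpace ℝ E'] [FiniteDimensional ℝ E']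
  {H' : Type*} [TopologicalSpace H'] {J : ModelWithCorners ℝ E' H'} [J.Boundaryless]
  {K : Type*} [TopologicalSpace K] [ChartedSpace H' K] [Group K] [LieGroup J ∞ K]
  {B : LinearMap.BilinForm ℝ (GroupLieAlgebra I G)} {κ : MulAut G}
  {B' : LinearMap.BilinForm ℝ (GroupLieAlgebra J K)} {τ : MulAut K}

variable (I J G K) in
/-- The projection of `Lie (G × K)` onto `Lie G`. -/
def lieFst : GroupLieAlgebra (I.prod J) (G × K) →L[ℝ] GroupLieAlgebra I G :=
  lieHom (I.prod J) I (MonoidHom.fst G K)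

variable (I J G K) in
/-- The projection of `Lie (G × K)` onto `Lie K`. -/
def lieSnd : GroupLieAlgebra (I.prod J) (G × K) →L[ℝ] GroupLieAlgebra J K :=
  lieHom (I.prod J) J (MonoidHom.snd G K)

/-- The element of `Lie (G × K)` with components `x` and `y`. -/
def lieMk (x : GroupLieAlgebra I G) (y : GroupLieAlgebra J K) :
    GroupLieAlgebra (I.prod J) (G × K) :=
  ((x, y) : E × E')

theorem lieFst_lieMk (x : GroupLieAlgebra I G) (y : GroupLieAlgebra J K) :
    lieFst I G J K (lieMk x y) = x :=
  mfderiv_fst_apply (I := I) (I' := J) (1 : G × K) _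

theorem lieSnd_lieMk (x : GroupLieAlgebra I G) (y : GroupLieAlgebra J K) :
    lieSnd I G J K (lieMk x y) = y :=
  mfderiv_snd_apply (I := I) (I' := J) (1 : G × K) _

theorem lieMk_eta (x : GroupLieAlgebra (I.prod J) (G × K)) :
    lieMk (lieFst I G J K x) (lieSnd I G J K x) = x :=
  Prod.ext (α := E) (β := E') (mfderiv_fst_apply (I := I) (I' := J) (1 : G × K) x)
    (mfderiv_snd_apply (I := I) (I' := J) (1 : G × K) x)

theorem lie_prod_ext {x y : GroupLieAlgebra (I.prod J) (G × K)}
    (h₁ : lieFst I G J K x = lieFst I G J K y) (h₂ : lieSnd I G J K x = lieSnd I G J K y) :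
    x = y := by
  rw [← lieMk_eta x, h₁, h₂, lieMk_eta]

theorem prodForm_apply (B : LinearMap.BilinForm ℝ (GroupLieAlgebra I G))
    (B' : LinearMap.BilinForm ℝ (GroupLieAlgebra J K))
    (x y : GroupLieAlgebra (I.prod J) (G × K)) :
    prodForm B B' x y = B (lieFst I G J K x) (lieFst I G J K y) +
      B' (lieSnd I G J K x) (lieSnd I G J K y) := rfl

theorem lieFst_thetaL (z : G × K) (v : TangentSpace (I.prod J) z) :
    lieFst I G J K (thetaL (I.prod J) (G × K) z v) =
      thetaL I G z.1 (mfderiv (I.prod J) I Prod.fst z v) :=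
  (thetaL_mfderiv_hom (f := MonoidHom.fst G K) contMDiff_fst z v).symm

theorem lieSnd_thetaL (z : G × K) (v : TangentSpace (I.prod J) z) :
    lieSnd I G J K (thetaL (I.prod J) (G × K) z v) =
      thetaL J K z.2 (mfderiv (I.prod J) J Prod.snd z v) :=
  (thetaL_mfderiv_hom (f := MonoidHom.snd G K) contMDiff_snd z v).symm

theorem lieFst_adj (z : G × K) (x : GroupLieAlgebra (I.prod J) (G × K)) :
    lieFst I G J K (adj (I.prod J) z x) = adj I z.1 (lieFst I G J K x) :=
  lieHom_adj (f := MonoidHom.fst G K) contMDiff_fst z x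

theorem lieSnd_adj (z : G × K) (x : GroupLieAlgebra (I.prod J) (G × K)) :
    lieSnd I G J K (adj (I.prod J) z x) = adj J z.2 (lieSnd I G J K x) :=
  lieHom_adj (f := MonoidHom.snd G K) contMDiff_snd z x

theorem lieFst_lieBilin (x y : GroupLieAlgebra (I.prod J) (G × K)) :
    lieFst I G J K (lieBilin (I.prod J) (G × K) x y) =
      lieBilin I G (lieFst I G J K x) (lieFst I G J K y) :=
  lieHom_lieBilin (f := MonoidHom.fst G K) contMDiff_fst x y

theorem lieSnd_lieBilin (x y : GroupLieAlgebra (I.prod J) (G × K)) :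
    lieSnd I G J K (lieBilin (I.prod J) (G × K) x y) =
      lieBilin J K (lieSnd I G J K x) (lieSnd I G J K y) :=
  lieHom_lieBilin (f := MonoidHom.snd G K) contMDiff_snd x y

theorem IsLieAut.prodAut (hκ : IsLieAut I κ) (hτ : IsLieAut J τ) :
    IsLieAut (I.prod J) (prodAut κ τ) where
  smooth := hκ.smooth.prodMap hτ.smooth
  smooth_symm := hκ.smooth_symm.prodMap hτ.smooth_symm

theorem lieFst_lieAut (hκ : IsLieAut I κ) (hτ : IsLieAut J τ)
    (x : GroupLieAlgebra (I.prod J) (G × K)) :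
    lieFst I G J K (lieAut (I.prod J) (prodAut κ τ) x) = lieAut I κ (lieFst I G J K x) := by
  have h1 := mfderiv_chain (h := fun z : G × K => κ z.1) (f := TqHam.prodAut κ τ) (g := Prod.fst)
    (x := 1) (mdifferentiableAt_fst (I := I) (I' := J))
    ((hκ.prodAut hτ).mdifferentiableAt 1) (map_one _) (fun _ => rfl) x
  have h2 := mfderiv_chain (h := fun z : G × K => κ z.1) (f := Prod.fst) (g := κ)
    (x := 1) (hκ.mdifferentiableAt _) (mdifferentiableAt_fst (I := I) (I' := J)) rfl
    (fun _ => rfl) x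
  exact h1.symm.trans h2

theorem lieSnd_lieAut (hκ : IsLieAut I κ) (hτ : IsLieAut J τ)
    (x : GroupLieAlgebra (I.prod J) (G × K)) :
    lieSnd I G J K (lieAut (I.prod J) (prodAut κ τ) x) = lieAut J τ (lieSnd I G J K x) := by
  have h1 := mfderiv_chain (h := fun z : G × K => τ z.2) (f := TqHam.prodAut κ τ) (g := Prod.snd)
    (x := 1) (mdifferentiableAt_snd (I := I) (I' := J))
    ((hκ.prodAut hτ).mdifferentiableAt 1) (map_one _) (fun _ => rfl) x
  have h2 := mfderiv_chain (h := fun z : G × K => τ z.2) (f := Prod.snd) (g := τ)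
    (x := 1) (hτ.mdifferentiableAt _) (mdifferentiableAt_snd (I := I) (I' := J)) rfl
    (fun _ => rfl) x
  exact h1.symm.trans h2

theorem IsInvariantForm.prodForm (hB : IsInvariantForm B) (hB' : IsInvariantForm B') :
    IsInvariantForm (prodForm B B') where
  symm := ⟨fun x y => by
    rw [prodForm_apply, prodForm_apply, hB.comm, hB'.comm]⟩
  nondegenerate := by
    constructor
    · intro x hx
      refine lie_prod_ext ?_ ?_ <;> rw [map_zero]
      · refine hB.nondegenerate.1 _ fun y => ?_
        have h := hx (lieMk y 0)
        rwa [prodForm_apply, lieFst_lieMk, lieSnd_lieMk, map_zero, add_zero] at h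
      · refine hB'.nondegenerate.1 _ fun y => ?_
        have h := hx (lieMk 0 y)
        rwa [prodForm_apply, lieFst_lieMk, lieSnd_lieMk, map_zero, zero_add] at h
    · intro x hx
      refine lie_prod_ext ?_ ?_ <;> rw [map_zero]
      · refine hB.nondegenerate.2 _ fun y => ?_
        have h := hx (lieMk y 0)
        rwa [prodForm_apply, lieFst_lieMk, lieSnd_lieMk, map_zero, LinearMap.zero_apply,
          add_zero] at h
      · refine hB'.nondegenerate.2 _ fun y => ?_
        have h := hx (lieMk 0 y)
        rwa [prodForm_apply, lieFst_lieMk, lieSnd_lieMk, map_zero, LinearMap.zero_apply,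
          zero_add] at h
  ad_invariant z x y := by
    change TqHam.prodForm B B' (TqHam.adj (I.prod J) z x) (TqHam.adj (I.prod J) z y) = _
    rw [prodForm_apply, prodForm_apply, lieFst_adj, lieFst_adj, lieSnd_adj, lieSnd_adj, hB.adj,
      hB'.adj]

theorem InvariantUnder.prodAut (hκ : IsLieAut I κ) (hτ : IsLieAut J τ) (hBκ : InvariantUnder B κ)
    (hBτ : InvariantUnder B' τ) : InvariantUnder (prodForm B B') (prodAut κ τ) := fun x y => by
  rw [prodForm_apply, prodForm_apply, lieFst_lieAut hκ hτ, lieFst_lieAut hκ hτ,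
    lieSnd_lieAut hκ hτ, lieSnd_lieAut hκ hτ, hBκ, hBτ]

theorem cartanForm_prodForm (hB : IsInvariantForm B) (hB' : IsInvariantForm B') :
    cartanForm (prodForm B B') =
      pullback (I := I.prod J) Prod.fst (cartanForm B) +
        pullback (I := I.prod J) Prod.snd (cartanForm B') := by
  funext z
  ext v
  have h := cartanForm_apply (hB.prodForm hB') z v
  have h1 : pullback (I := I.prod J) (Prod.fst : G × K → G) (cartanForm B) z v = 1 / 2 *
      B (lieBilin I G (thetaL I G z.1 (mfderiv (I.prod J) I Prod.fst z (v 0)))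
        (thetaL I G z.1 (mfderiv (I.prod J) I Prod.fst z (v 1))))
        (thetaL I G z.1 (mfderiv (I.prod J) I Prod.fst z (v 2))) :=
    cartanForm_apply hB z.1 _
  have h2 : pullback (I := I.prod J) (Prod.snd : G × K → K) (cartanForm B') z v = 1 / 2 *
      B' (lieBilin J K (thetaL J K z.2 (mfderiv (I.prod J) J Prod.snd z (v 0)))
        (thetaL J K z.2 (mfderiv (I.prod J) J Prod.snd z (v 1))))
        (thetaL J K z.2 (mfderiv (I.prod J) J Prod.snd z (v 2))) :=
    cartanForm_apply hB' z.2 _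
  rw [prodForm_apply, lieFst_lieBilin, lieSnd_lieBilin, mul_add, lieFst_thetaL, lieFst_thetaL,
    lieFst_thetaL, lieSnd_thetaL, lieSnd_thetaL, lieSnd_thetaL, ← h1, ← h2] at h
  exact h

theorem mfderiv_fst_pontProd {x : G} {y : K} (p : Pont I x × Pont J y) :
    mfderiv (I.prod J) I Prod.fst (x, y) (pontProd x y p).1 = p.1.1 := by
  have h1 := mfderiv_chain (h := fun a : G => a) (f := fun a : G => (a, y)) (g := Prod.fst)
    (x := x) (mdifferentiableAt_fst (I := I) (I' := J))
    (mdifferentiableAt_id.prodMk mdifferentiableAt_const) rfl (fun _ => rfl) p.1.1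
  have h2 := mfderiv_chain (h := fun _ : K => x) (f := fun b : K => (x, b)) (g := Prod.fst)
    (x := y) (mdifferentiableAt_fst (I := I) (I' := J))
    (mdifferentiableAt_const.prodMk mdifferentiableAt_id) rfl (fun _ => rfl) p.2.1
  have h3 := mfderiv_apply_of_eq_id (I := I) (f := fun a : G => a) (fun _ => rfl) x p.1.1
  have h4 := mfderiv_apply_of_eq_const (I := J) (I' := I) (f := fun _ : K => x) (fun _ => rfl) y
    p.2.1
  refine (map_add (mfderiv (I.prod J) I Prod.fst (x, y)) _ _).trans ?_
  exact (congrArg₂ (fun a b : E => a + b) (h1.symm.trans h3) (h2.symm.trans h4)).trans (add_zero _)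

theorem mfderiv_snd_pontProd {x : G} {y : K} (p : Pont I x × Pont J y) :
    mfderiv (I.prod J) J Prod.snd (x, y) (pontProd x y p).1 = p.2.1 := by
  have h1 := mfderiv_chain (h := fun _ : G => y) (f := fun a : G => (a, y)) (g := Prod.snd)
    (x := x) (mdifferentiableAt_snd (I := I) (I' := J))
    (mdifferentiableAt_id.prodMk mdifferentiableAt_const) rfl (fun _ => rfl) p.1.1
  have h2 := mfderiv_chain (h := fun b : K => b) (f := fun b : K => (x, b)) (g := Prod.snd)
    (x := y) (mdifferentiableAt_snd (I := I) (I' := J))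
    (mdifferentiableAt_const.prodMk mdifferentiableAt_id) rfl (fun _ => rfl) p.2.1
  have h3 := mfderiv_apply_of_eq_id (I := J) (f := fun b : K => b) (fun _ => rfl) y p.2.1
  have h4 := mfderiv_apply_of_eq_const (I := I) (I' := J) (f := fun _ : G => y) (fun _ => rfl) x
    p.1.1
  refine (map_add (mfderiv (I.prod J) J Prod.snd (x, y)) _ _).trans ?_
  exact (congrArg₂ (fun a b : E' => a + b) (h1.symm.trans h4) (h2.symm.trans h3)).trans (zero_add _)

/-- Under `Lie (G × K) = Lie G ⊕ Lie K`, the sections `e` of the product group are the exterior sums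
of those of the factors. -/
theorem pontProd_eMap (hB : IsInvariantForm B) (hB' : IsInvariantForm B') (hκ : IsLieAut I κ)
    (hτ : IsLieAut J τ) (z : G × K) (ξ : GroupLieAlgebra (I.prod J) (G × K)) :
    pontProd z.1 z.2 (eMap B κ z.1 (lieFst I G J K ξ), eMap B' τ z.2 (lieSnd I G J K ξ)) =
      eMap (prodForm B B') (prodAut κ τ) z ξ := by
  refine pont_ext ?_ fun y => ?_
  · rw [thetaL_eMap_fst]
    refine lie_prod_ext ?_ ?_
    · rw [map_sub, lieFst_lieAut hκ hτ, lieFst_adj, Prod.fst_inv, ← thetaL_eMap_fst B κ z.1]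
      refine (lieFst_thetaL z _).trans ?_
      exact congrArg (thetaL I G z.1) (mfderiv_fst_pontProd _)
    · rw [map_sub, lieSnd_lieAut hκ hτ, lieSnd_adj, Prod.snd_inv, ← thetaL_eMap_fst B' τ z.2]
      refine (lieSnd_thetaL z _).trans ?_
      exact congrArg (thetaL J K z.2) (mfderiv_snd_pontProd _)
  · rw [eMap_apply_leftField (hB.prodForm hB'), prodForm_apply, map_add (lieFst I G J K),
      map_add (lieSnd I G J K), lieFst_lieAut hκ hτ, lieFst_adj, lieSnd_lieAut hκ hτ, lieSnd_adj,
      Prod.fst_inv, Prod.snd_inv, mul_add,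
      ← eMap_apply_leftField hB κ z.1, ← eMap_apply_leftField hB' τ z.2]
    exact congrArg₂ HAdd.hAdd
      (congrArg (eMap B κ z.1 (lieFst I G J K ξ)).2
        (mfderiv_hom_leftField (f := MonoidHom.fst G K) contMDiff_fst z y))
      (congrArg (eMap B' τ z.2 (lieSnd I G J K ξ)).2
        (mfderiv_hom_leftField (f := MonoidHom.snd G K) contMDiff_snd z y))

/-- The direct sum of twisted Cartan-Dirac structures is the twisted Cartan-Dirac structure of the
product group. -/
theorem directSum_cartanDirac (hB : IsInvariantForm B) (hB' : IsInvariantForm B')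
    (hκ : IsLieAut I κ) (hτ : IsLieAut J τ) :
    directSum (cartanDirac B κ) (cartanDirac B' τ) =
      cartanDirac (prodForm B B') (prodAut κ τ) := by
  funext z
  ext p
  constructor
  · rintro ⟨⟨_, _⟩, ⟨⟨x, rfl⟩, ⟨y, rfl⟩⟩, rfl⟩
    refine ⟨lieMk x y, ?_⟩
    rw [← pontProd_eMap hB hB' hκ hτ, lieFst_lieMk, lieSnd_lieMk]
  · rintro ⟨ξ, rfl⟩
    rw [← pontProd_eMap hB hB' hκ hτ]
    exact ⟨_, ⟨⟨_, rfl⟩, ⟨_, rfl⟩⟩, rfl⟩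

end ProductGroups

/-! ### Equivariance under twisted conjugation -/

section TwistedConjugation

variable {E : Type*} [NormedAddCommGroup E] [NormedSpace ℝ E] [FiniteDimensional ℝ E]
  {H : Type*} [TopologicalSpace H] {I : ModelWithCorners ℝ E H} [I.Boundaryless]
  {G : Type*} [TopologicalSpace G] [ChartedSpace H G] [Group G] [LieGroup I ∞ G]
  {B : LinearMap.BilinForm ℝ (GroupLieAlgebra I G)} {κ κ₁ κ₂ : MulAut G}

theorem twMult_twConj (κ₁ κ₂ : MulAut G) (g a b : G) :
    twMult κ₁ (twConj κ₁ g a, twConj κ₂ g b) = twConj (κ₁ * κ₂) g (twMult κ₁ (a, b)) := by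
  simp only [twMult, twConj, map_mul, MulAut.mul_apply, map_inv]
  group

theorem twInv_twConj (κ : MulAut G) (g a : G) :
    twInv κ (twConj κ g a) = twConj κ⁻¹ g (twInv κ a) := by
  simp only [twInv, twConj, mul_inv_rev, map_mul, map_inv, inv_inv, MulAut.inv_apply_self,
    mul_assoc]

theorem contMDiff_twConj (κ : MulAut G) (g : G) : ContMDiff I I ∞ (twConj κ g) :=
  (contMDiff_const.mul contMDiff_id).mul contMDiff_const

theorem thetaL_mfderiv_twConj (κ : MulAut G) (g a : G) (u : TangentSpace I a) :
    thetaL I G (twConj κ g a) (mfderiv I I (twConj κ g) a u) = adj I (κ g) (thetaL I G a u) := by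
  have hd : MDifferentiableAt I I (fun h : G => g * h) a := mdifferentiableAt_mulLeft g a
  have h := thetaL_mul (I := I) (IM := I) (a := fun h : G => g * h) (b := fun _ => κ g⁻¹) (x := a)
    hd mdifferentiableAt_const u
  have h0 : thetaL I G (κ g⁻¹) (mfderiv I I (fun _ : G => κ g⁻¹) a u) = 0 := by
    rw [mfderiv_const]
    exact map_zero _
  refine h.trans ?_
  rw [h0, add_zero, thetaL_mfderiv_mulLeft, map_inv κ, inv_inv]

theorem thetaR_mfderiv_twConj (κ : MulAut G) (g a : G) (u : TangentSpace I a) :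
    thetaR I G (twConj κ g a) (mfderiv I I (twConj κ g) a u) = adj I g (thetaR I G a u) := by
  rw [thetaR_eq_adj, thetaL_mfderiv_twConj, thetaR_eq_adj, ← adj_mul, ← adj_mul, twConj, map_inv,
    inv_mul_cancel_right]

variable {EM : Type*} [NormedAddCommGroup EM] [NormedSpace ℝ EM]
  {HM : Type*} [TopologicalSpace HM] {IM : ModelWithCorners ℝ EM HM}
  {M : Type*} [TopologicalSpace M] [ChartedSpace HM M]

theorem mfderiv_twConj_comp (κ : MulAut G) (g : G) {a : M → G} {x : M}
    (ha : MDifferentiableAt IM I a x) (v : TangentSpace IM x) :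
    (mfderiv IM I (fun y => twConj κ g (a y)) x v : E) =
      mfderiv I I (twConj κ g) (a x) (mfderiv IM I a x v) :=
  mfderiv_chain ((contMDiff_twConj κ g).mdifferentiableAt (by simp)) ha rfl (fun _ => rfl) v

/-- The form `ς^{κ₁}` is invariant under the diagonal twisted conjugation action. -/
theorem pullback_twConj_sigmaTw (hB : IsInvariantForm B) (hκ₁ : IsLieAut I κ₁) (κ₂ : MulAut G)
    (g : G) {Φ₁ Φ₂ : M → G} (h₁ : MDifferentiable IM I Φ₁) (h₂ : MDifferentiable IM I Φ₂) :
    pullback (I := IM) (fun x => (twConj κ₁ g (Φ₁ x), twConj κ₂ g (Φ₂ x))) (sigmaTw B κ₁) =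
      pullback (fun x => (Φ₁ x, Φ₂ x)) (sigmaTw B κ₁) := by
  have hc (κ : MulAut G) : MDifferentiable I I (twConj κ g) :=
    (contMDiff_twConj κ g).mdifferentiable (by simp)
  rw [pullback_prodMk_sigmaTw B hκ₁ h₁ h₂,
    pullback_prodMk_sigmaTw B hκ₁ (Φ₁ := fun x => twConj κ₁ g (Φ₁ x))
      (Φ₂ := fun x => twConj κ₂ g (Φ₂ x)) ((hc κ₁).comp h₁) ((hc κ₂).comp h₂)]
  congr 2
  funext x
  ext v
  have e1 (v : TangentSpace IM x) :
      pullback₁ (I' := I) (fun x => twConj κ₁ g (Φ₁ x)) (thetaL I G) x v =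
        adj I (κ₁ g) (pullback₁ (I' := I) Φ₁ (thetaL I G) x v) :=
    (congrArg (thetaL I G _) (mfderiv_twConj_comp κ₁ g (h₁ x) v)).trans
      (thetaL_mfderiv_twConj κ₁ g _ _)
  have e2 (v : TangentSpace IM x) : pullback₁ (I' := I) (fun x => twConj κ₂ g (Φ₂ x))
      (pullback₁ (I := I) (I' := I) κ₁ (thetaR I G)) x v = adj I (κ₁ g)
        (pullback₁ (I' := I) Φ₂ (pullback₁ (I := I) (I' := I) κ₁ (thetaR I G)) x v) := by
    refine (thetaR_mfderiv_aut hκ₁ _ _).trans ?_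
    refine (congrArg (fun w => lieAut I κ₁ (thetaR I G _ w))
      (mfderiv_twConj_comp κ₂ g (h₂ x) v)).trans ?_
    refine (congrArg (lieAut I κ₁) (thetaR_mfderiv_twConj κ₂ g _ _)).trans ?_
    rw [lieAut_adj hκ₁]
    exact congrArg (adj I (κ₁ g)) (thetaR_mfderiv_aut hκ₁ _ _).symm
  rw [dotWedge_apply, dotWedge_apply]
  refine (congrArg₂ HSub.hSub (congrArg₂ (fun p q => B p q) (e1 (v 0)) (e2 (v 1)))
    (congrArg₂ (fun p q => B p q) (e1 (v 1)) (e2 (v 0)))).trans ?_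
  rw [hB.adj, hB.adj]

end TwistedConjugation

/-! ### The opposite of a Dirac structure -/

section Transpose

variable {E : Type*} [NormedAddCommGroup E] [NormedSpace ℝ E] [FiniteDimensional ℝ E]
  {H : Type*} [TopologicalSpace H] {I : ModelWithCorners ℝ E H} [I.Boundaryless]
  {M : Type*} [TopologicalSpace M] [ChartedSpace H M] [IsManifold I ∞ M]

/-- The involution `X ⊕ α ↦ X ⊕ -α`. -/
def pontNeg (x : M) : Pont I x →ₗ[ℝ] Pont I x := LinearMap.prodMap LinearMap.id (-LinearMap.id)

theorem pontNeg_apply {x : M} (p : Pont I x) : pontNeg x p = (p.1, -p.2) := rfl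

theorem pontNeg_pontNeg {x : M} (p : Pont I x) : pontNeg x (pontNeg x p) = p := by
  rw [pontNeg_apply, pontNeg_apply, neg_neg]

theorem mem_transpose {L : (x : M) → Submodule ℝ (Pont I x)} {x : M} {p : Pont I x} :
    p ∈ transpose L x ↔ pontNeg x p ∈ L x := by
  constructor
  · rintro ⟨q, hq, rfl⟩
    have h : pontNeg x (pontNeg x q) ∈ L x := by rwa [pontNeg_pontNeg]
    exact h
  · intro h
    exact ⟨_, h, pontNeg_pontNeg p⟩

theorem pairing_pontNeg {x : M} (p q : Pont I x) :
    pairing (pontNeg x p) (pontNeg x q) = -pairing p q := by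
  change -q.2 p.1 + -p.2 q.1 = -(q.2 p.1 + p.2 q.1)
  ring

theorem oneForm_neg (α : OneForm I M ℝ) : (oneForm fun x => -α x) = -oneForm α := by
  funext x; ext; rfl

theorem IsSmoothSectionOn.pontNeg {σ : (x : M) → Pont I x} {U : Set M}
    (h : IsSmoothSectionOn σ U) : IsSmoothSectionOn (fun x => pontNeg x (σ x)) U :=
  ⟨h.1, fun x₀ => by
    have e : (oneForm fun x => (TqHam.pontNeg x (σ x)).2) = -oneForm fun x => (σ x).2 :=
      oneForm_neg _
    rw [e]
    exact (h.2 x₀).neg⟩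

theorem courant_pontNeg (χ : DiffForm I M 3) (σ τ : (x : M) → Pont I x) (x : M) :
    courant χ (fun x => pontNeg x (σ x)) (fun x => pontNeg x (τ x)) x =
      pontNeg x (courant (-χ) σ τ x) := by
  refine Prod.ext rfl (ContinuousLinearMap.ext fun v => ?_)
  simp only [courant, pontNeg_apply]
  have e1 : mvfderiv I (fun y => -(τ y).2 (σ y).1) x v =
      -mvfderiv I (fun y => (τ y).2 (σ y).1) x v := by
    have : (fun y => -(τ y).2 (σ y).1) = -fun y => (τ y).2 (σ y).1 := rfl
    rw [this, mvfderiv_neg]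
    rfl
  have e2 (σ : (x : M) → Pont I x) (w : TangentSpace I x) :
      contract₂ (extD (oneForm fun x => -(σ x).2) x) w v =
        -contract₂ (extD (oneForm fun x => (σ x).2) x) w v := by
    rw [oneForm_neg, extD_neg, contract₂_apply, contract₂_apply]
    rfl
  have e3 (u w : TangentSpace I x) : contract₃ ((-χ) x) u w v = -contract₃ (χ x) u w v := by
    rw [contract₃_apply, contract₃_apply]
    rfl
  simp only [add_apply, sub_apply, neg_apply, e1, e2, e3]
  ring

theorem IsDiracStructure.transpose {χ : DiffForm I M 3} {L : (x : M) → Submodule ℝ (Pont I x)}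
    (h : IsDiracStructure χ L) : IsDiracStructure (-χ) (transpose L) where
  smooth_form := h.smooth_form.neg
  closed := by rw [extD_neg, h.closed, neg_zero]
  subbundle x₀ := by
    obtain ⟨U, hU, hx₀, r, σ, hσ, hL⟩ := h.subbundle x₀
    refine ⟨U, hU, hx₀, r, fun i x => pontNeg x (σ i x), fun i => (hσ i).pontNeg,
      fun x hx => ⟨?_, ?_⟩⟩
    · refine (hL x hx).1.map' (pontNeg x) (LinearMap.ker_eq_bot.2 ?_)
      exact Function.LeftInverse.injective (g := pontNeg x) pontNeg_pontNeg
    · have e : (Set.range fun i => pontNeg x (σ i x)) = pontNeg x '' Set.range fun i => σ i x := by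
        rw [← Set.range_comp]; rfl
      rw [e, ← Submodule.map_span, (hL x hx).2]
      rfl
  lagrangian x p := by
    rw [mem_transpose, h.lagrangian]
    constructor
    · intro h' q hq
      have := h' _ (mem_transpose.1 hq)
      rwa [pairing_pontNeg, neg_eq_zero] at this
    · intro h' q hq
      have := h' (pontNeg x q) (mem_transpose.2 (by rwa [pontNeg_pontNeg]))
      rw [← neg_eq_zero, ← pairing_pontNeg, pontNeg_pontNeg] at this
      exact this
  involutive σ τ hσ hτ hσL hτL x := by
    rw [mem_transpose, ← courant_pontNeg]
    exact h.involutive _ _ hσ.pontNeg hτ.pontNeg (fun x => mem_transpose.1 (hσL x))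
      (fun x => mem_transpose.1 (hτL x)) x

end Transpose

/-! ### Tangent vectors of product manifolds -/

section ProductManifolds

variable {E : Type*} [NormedAddCommGroup E] [NormedSpace ℝ E]
  {H : Type*} [TopologicalSpace H] {I : ModelWithCorners ℝ E H}
  {N : Type*} [TopologicalSpace N] [ChartedSpace H N]
  {E' : Type*} [NormedAddCommGroup E'] [NormedSpace ℝ E']
  {H' : Type*} [TopologicalSpace H'] {J : ModelWithCorners ℝ E' H'}
  {N' : Type*} [TopologicalSpace N'] [ChartedSpace H' N']
  {EM : Type*} [NormedAddCommGroup EM] [NormedSpace ℝ EM]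
  {HM : Type*} [TopologicalSpace HM] {IM : ModelWithCorners ℝ EM HM}
  {M : Type*} [TopologicalSpace M] [ChartedSpace HM M]

theorem tangent_prod_ext {z : N × N'} {u v : TangentSpace (I.prod J) z}
    (h₁ : mfderiv (I.prod J) I Prod.fst z u = mfderiv (I.prod J) I Prod.fst z v)
    (h₂ : mfderiv (I.prod J) J Prod.snd z u = mfderiv (I.prod J) J Prod.snd z v) : u = v := by
  refine Prod.ext (α := E) (β := E') ?_ ?_
  · exact (mfderiv_fst_apply (I := I) (I' := J) z u).symm.trans
      (h₁.trans (mfderiv_fst_apply (I := I) (I' := J) z v))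
  · exact (mfderiv_snd_apply (I := I) (I' := J) z u).symm.trans
      (h₂.trans (mfderiv_snd_apply (I := I) (I' := J) z v))

theorem exists_tangent_prod (z : N × N') (X : TangentSpace I z.1) (Y : TangentSpace J z.2) :
    ∃ u : TangentSpace (I.prod J) z, mfderiv (I.prod J) I Prod.fst z u = X ∧
      mfderiv (I.prod J) J Prod.snd z u = Y :=
  ⟨((X, Y) : E × E'), mfderiv_fst_apply (I := I) (I' := J) z _,
    mfderiv_snd_apply (I := I) (I' := J) z _⟩

theorem mfderiv_fst_comp {Φ : M → N × N'} {x : M} (h : MDifferentiableAt IM (I.prod J) Φ x)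
    (v : TangentSpace IM x) :
    mfderiv IM I (fun y => (Φ y).1) x v =
      mfderiv (I.prod J) I Prod.fst (Φ x) (mfderiv IM (I.prod J) Φ x v) :=
  mfderiv_chain mdifferentiableAt_fst h rfl (fun _ => rfl) v

theorem mfderiv_snd_comp {Φ : M → N × N'} {x : M} (h : MDifferentiableAt IM (I.prod J) Φ x)
    (v : TangentSpace IM x) :
    mfderiv IM J (fun y => (Φ y).2) x v =
      mfderiv (I.prod J) J Prod.snd (Φ x) (mfderiv IM (I.prod J) Φ x v) :=
  mfderiv_chain mdifferentiableAt_snd h rfl (fun _ => rfl) v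

end ProductManifolds

/-! ### The fusion identity for the sections `e^κ(ξ)` -/

section Fusion

variable {E : Type*} [NormedAddCommGroup E] [NormedSpace ℝ E] [FiniteDimensional ℝ E]
  {H : Type*} [TopologicalSpace H] {I : ModelWithCorners ℝ E H} [I.Boundaryless]
  {G : Type*} [TopologicalSpace G] [ChartedSpace H G] [Group G] [LieGroup I ∞ G]
  {B : LinearMap.BilinForm ℝ (GroupLieAlgebra I G)} {κ κ₁ κ₂ : MulAut G}

theorem InvariantUnder.mul (hκ₁ : IsLieAut I κ₁) (hκ₂ : IsLieAut I κ₂)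
    (h₁ : InvariantUnder B κ₁) (h₂ : InvariantUnder B κ₂) : InvariantUnder B (κ₁ * κ₂) :=
  fun x y => by rw [lieAut_mul hκ₁ hκ₂, lieAut_mul hκ₁ hκ₂, h₁, h₂]

theorem InvariantUnder.inv (hκ : IsLieAut I κ) (h : InvariantUnder B κ) :
    InvariantUnder B κ⁻¹ := fun x y => by
  rw [← h, lieAut_apply_inv hκ, lieAut_apply_inv hκ]

theorem thetaR_eMap_fst (B : LinearMap.BilinForm ℝ (GroupLieAlgebra I G)) (κ : MulAut G) (g : G)
    (x : GroupLieAlgebra I G) :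
    thetaR I G g (eMap B κ g x).1 = adj I g (lieAut I κ x) - x := by
  rw [thetaR_eq_adj, thetaL_eMap_fst, map_sub, adj_adj_inv]

theorem eMap_snd_apply_right (hB : IsInvariantForm B) (κ : MulAut G) (g : G)
    (x : GroupLieAlgebra I G) (v : TangentSpace I g) :
    (eMap B κ g x).2 v = 1 / 2 * B (adj I g (lieAut I κ x) + x) (thetaR I G g v) := by
  rw [eMap_snd_apply hB, thetaR_eq_adj, ← hB.adj g, map_add, adj_adj_inv]

variable (I) in
/-- The value `ς^κ((X, Y), (X', Y'))` at `(a, b)`, in terms of the components in `G`. -/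
def sigmaPair (B : LinearMap.BilinForm ℝ (GroupLieAlgebra I G)) (κ : MulAut G) (a b : G)
    (X : TangentSpace I a) (Y : TangentSpace I b) (X' : TangentSpace I a)
    (Y' : TangentSpace I b) : ℝ :=
  -(1 / 2) * (B (thetaL I G a X) (lieAut I κ (thetaR I G b Y')) -
    B (thetaL I G a X') (lieAut I κ (thetaR I G b Y)))

theorem sigmaPair_zero_left (a b : G) (X : TangentSpace I a) (Y : TangentSpace I b) :
    sigmaPair I B κ a b 0 0 X Y = 0 := by
  simp [sigmaPair]

theorem sigmaTw_apply_pair (B : LinearMap.BilinForm ℝ (GroupLieAlgebra I G)) (hκ : IsLieAut I κ)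
    (z : G × G) (u v : TangentSpace (I.prod I) z) :
    sigmaTw B κ z ![u, v] = sigmaPair I B κ z.1 z.2 (mfderiv (I.prod I) I Prod.fst z u)
      (mfderiv (I.prod I) I Prod.snd z u) (mfderiv (I.prod I) I Prod.fst z v)
      (mfderiv (I.prod I) I Prod.snd z v) := by
  refine (sigmaTw_apply B hκ z ![u, v]).trans ?_
  have h1 (u : TangentSpace (I.prod I) z) := mfderiv_fst_apply (I := I) (I' := I) z u
  have h2 (u : TangentSpace (I.prod I) z) := mfderiv_snd_apply (I := I) (I' := I) z u
  exact congrArg₂ (fun r s : ℝ => -(1 / 2) * (r - s))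
    (congrArg₂ (fun p q : E => B (thetaL I G z.1 p) (lieAut I κ (thetaR I G z.2 q)))
      (h1 u).symm (h2 v).symm)
    (congrArg₂ (fun p q : E => B (thetaL I G z.1 p) (lieAut I κ (thetaR I G z.2 q)))
      (h1 v).symm (h2 u).symm)

/-- The value of `e^{κ₁}(ξ₁) ⊕ e^{κ₂}(ξ₂)` on a pair of tangent vectors, corrected by the
contraction of `ς^{κ₁}` with its vector part. -/
theorem eMap_add_sigmaPair (hB : IsInvariantForm B) (hκ₁ : IsLieAut I κ₁)
    (hBκ₁ : InvariantUnder B κ₁) (a b : G) (x₁ x₂ : GroupLieAlgebra I G)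
    (X : TangentSpace I a) (Y : TangentSpace I b) :
    (eMap B κ₁ a x₁).2 X + (eMap B κ₂ b x₂).2 Y +
        sigmaPair I B κ₁ a b (eMap B κ₁ a x₁).1 (eMap B κ₂ b x₂).1 X Y =
      1 / 2 * (B (lieAut I κ₁ x₁ + adj I a⁻¹ x₁ +
            adj I (κ₁ b) (lieAut I κ₁ (lieAut I κ₂ x₂)) - lieAut I κ₁ x₂) (thetaL I G a X) +
        B (adj I (κ₁ b) (lieAut I κ₁ (lieAut I κ₂ x₂)) + lieAut I κ₁ x₂ -
            lieAut I κ₁ x₁ + adj I a⁻¹ x₁) (lieAut I κ₁ (thetaR I G b Y))) := by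
  rw [sigmaPair, thetaL_eMap_fst, thetaR_eMap_fst, eMap_snd_apply hB, eMap_snd_apply_right hB,
    ← hBκ₁ (adj I b (lieAut I κ₂ x₂) + x₂), map_add (lieAut I κ₁), map_sub (lieAut I κ₁),
    lieAut_adj hκ₁]
  rw [hB.comm (thetaL I G a X)]
  simp only [map_add, map_sub, LinearMap.add_apply, LinearMap.sub_apply]
  ring

/-- The diagonal elements `e^{κ₁}(ξ) ⊕ e^{κ₂}(ξ)` are related to `e^{κ₁κ₂}(ξ)` by
`(Mult^{κ₁}, ς^{κ₁})`: the covector part. -/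
theorem eMap_mul_snd (hB : IsInvariantForm B) (hκ₁ : IsLieAut I κ₁) (hκ₂ : IsLieAut I κ₂)
    (hBκ₁ : InvariantUnder B κ₁) (a b : G) (x : GroupLieAlgebra I G)
    (X : TangentSpace I a) (Y : TangentSpace I b) (Z : TangentSpace I (a * κ₁ b))
    (hZ : thetaL I G (a * κ₁ b) Z =
      adj I (κ₁ b)⁻¹ (thetaL I G a X + lieAut I κ₁ (thetaR I G b Y))) :
    (eMap B (κ₁ * κ₂) (a * κ₁ b) x).2 Z =
      (eMap B κ₁ a x).2 X + (eMap B κ₂ b x).2 Y +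
        sigmaPair I B κ₁ a b (eMap B κ₁ a x).1 (eMap B κ₂ b x).1 X Y := by
  rw [eMap_add_sigmaPair hB hκ₁ hBκ₁, eMap_snd_apply hB, hZ, ← hB.adj (κ₁ b), adj_adj_inv,
    lieAut_mul hκ₁ hκ₂, map_add (adj I (κ₁ b)), mul_inv_rev, adj_mul, adj_adj_inv]
  simp only [map_add, map_sub, LinearMap.add_apply, LinearMap.sub_apply]
  ring

/-- The diagonal elements `e^{κ₁}(ξ) ⊕ e^{κ₂}(ξ)` are related to `e^{κ₁κ₂}(ξ)` by
`(Mult^{κ₁}, ς^{κ₁})`: the vector part. -/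
theorem thetaL_eMap_mul_fst (hκ₁ : IsLieAut I κ₁) (hκ₂ : IsLieAut I κ₂)
    (a b : G) (x : GroupLieAlgebra I G) :
    thetaL I G (a * κ₁ b) (eMap B (κ₁ * κ₂) (a * κ₁ b) x).1 =
      adj I (κ₁ b)⁻¹ (thetaL I G a (eMap B κ₁ a x).1 +
        lieAut I κ₁ (thetaR I G b (eMap B κ₂ b x).1)) := by
  rw [thetaL_eMap_fst, thetaL_eMap_fst, thetaR_eMap_fst, lieAut_mul hκ₁ hκ₂, map_sub (lieAut I κ₁),
    lieAut_adj hκ₁, mul_inv_rev, adj_mul, add_comm, sub_add_sub_cancel, map_sub, adj_inv_adj]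

variable {EM : Type*} [NormedAddCommGroup EM] [NormedSpace ℝ EM]
  {HM : Type*} [TopologicalSpace HM] {IM : ModelWithCorners ℝ EM HM}
  {M : Type*} [TopologicalSpace M] [ChartedSpace HM M]

theorem thetaL_fusion (hκ₁ : IsLieAut I κ₁) {Φ₁ Φ₂ : M → G} {x : M}
    (h₁ : MDifferentiableAt IM I Φ₁ x) (h₂ : MDifferentiableAt IM I Φ₂ x)
    (v : TangentSpace IM x) :
    thetaL I G (Φ₁ x * κ₁ (Φ₂ x)) (mfderiv IM I (fun y => Φ₁ y * κ₁ (Φ₂ y)) x v) =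
      adj I (κ₁ (Φ₂ x))⁻¹ (thetaL I G (Φ₁ x) (mfderiv IM I Φ₁ x v) +
        lieAut I κ₁ (thetaR I G (Φ₂ x) (mfderiv IM I Φ₂ x v))) := by
  rw [thetaL_mul_aut hκ₁ h₁ h₂, map_add, thetaL_eq_adj (Φ₂ x), lieAut_adj hκ₁, map_inv]

variable {E' : Type*} [NormedAddCommGroup E'] [NormedSpace ℝ E'] [FiniteDimensional ℝ E']
  {H' : Type*} [TopologicalSpace H'] {J : ModelWithCorners ℝ E' H'} [J.Boundaryless]
  {K : Type*} [TopologicalSpace K] [ChartedSpace H' K] [Group K] [LieGroup J ∞ K]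
  {B' : LinearMap.BilinForm ℝ (GroupLieAlgebra J K)} {τ : MulAut K}

theorem mfderiv_fst_eMap (hB : IsInvariantForm B) (hB' : IsInvariantForm B') (hκ : IsLieAut I κ)
    (hτ : IsLieAut J τ) (z : G × K) (ξ : GroupLieAlgebra (I.prod J) (G × K)) :
    mfderiv (I.prod J) I Prod.fst z (eMap (prodForm B B') (prodAut κ τ) z ξ).1 =
      (eMap B κ z.1 (lieFst I G J K ξ)).1 := by
  rw [← pontProd_eMap hB hB' hκ hτ]
  exact mfderiv_fst_pontProd _

theorem mfderiv_snd_eMap (hB : IsInvariantForm B) (hB' : IsInvariantForm B') (hκ : IsLieAut I κ)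
    (hτ : IsLieAut J τ) (z : G × K) (ξ : GroupLieAlgebra (I.prod J) (G × K)) :
    mfderiv (I.prod J) J Prod.snd z (eMap (prodForm B B') (prodAut κ τ) z ξ).1 =
      (eMap B' τ z.2 (lieSnd I G J K ξ)).1 := by
  rw [← pontProd_eMap hB hB' hκ hτ]
  exact mfderiv_snd_pontProd _

theorem eMap_prod_snd_apply (hB : IsInvariantForm B) (hB' : IsInvariantForm B')
    (hκ : IsLieAut I κ) (hτ : IsLieAut J τ) (z : G × K)
    (ξ : GroupLieAlgebra (I.prod J) (G × K)) (v : TangentSpace (I.prod J) z) :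
    (eMap (prodForm B B') (prodAut κ τ) z ξ).2 v =
      (eMap B κ z.1 (lieFst I G J K ξ)).2 (mfderiv (I.prod J) I Prod.fst z v) +
        (eMap B' τ z.2 (lieSnd I G J K ξ)).2 (mfderiv (I.prod J) J Prod.snd z v) := by
  rw [← pontProd_eMap hB hB' hκ hτ]
  rfl

end Fusion

/-! ### Twisted multiplication and inversion as Dirac morphisms -/

section Morphisms

variable {E : Type*} [NormedAddCommGroup E] [NormedSpace ℝ E] [FiniteDimensional ℝ E]
  {H : Type*} [TopologicalSpace H] {I : ModelWithCorners ℝ E H} [I.Boundaryless]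
  {G : Type*} [TopologicalSpace G] [ChartedSpace H G] [Group G] [LieGroup I ∞ G]
  {B : LinearMap.BilinForm ℝ (GroupLieAlgebra I G)} {κ κ₁ κ₂ : MulAut G}

theorem thetaL_twMult (hκ₁ : IsLieAut I κ₁) (z : G × G) (u : TangentSpace (I.prod I) z) :
    thetaL I G (z.1 * κ₁ z.2) (mfderiv (I.prod I) I (twMult κ₁) z u) =
      adj I (κ₁ z.2)⁻¹ (thetaL I G z.1 (mfderiv (I.prod I) I Prod.fst z u) +
        lieAut I κ₁ (thetaR I G z.2 (mfderiv (I.prod I) I Prod.snd z u))) :=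
  thetaL_fusion (IM := I.prod I) hκ₁ (Φ₁ := (Prod.fst : G × G → G)) (Φ₂ := Prod.snd)
    mdifferentiableAt_fst mdifferentiableAt_snd u

/-- The lift of `e^{κ₁κ₂}(ξ)` is `e^{κ₁}(ξ) ⊕ e^{κ₂}(ξ)`. For uniqueness, the vector part and the
covector part, the latter tested on the tangent spaces of the two factors separately, determine
`Ad_{a⁻¹} ξ₁` and `κ₁(ξ₁) - κ₁(ξ₂)`. -/
theorem existsUnique_lift_twMult (hB : IsInvariantForm B) (hκ₁ : IsLieAut I κ₁)
    (hκ₂ : IsLieAut I κ₂) (hBκ₁ : InvariantUnder B κ₁) (z : G × G)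
    (p' : Pont I (twMult κ₁ z)) (hp' : p' ∈ cartanDirac B (κ₁ * κ₂) (twMult κ₁ z)) :
    ∃! p : Pont (I.prod I) z, p ∈ cartanDirac (prodForm B B) (prodAut κ₁ κ₂) z ∧
      p'.1 = mfderiv (I.prod I) I (twMult κ₁) z p.1 ∧
      p'.2.comp (mfderiv (I.prod I) I (twMult κ₁) z) = p.2 + contract₂ (sigmaTw B κ₁ z) p.1 := by
  obtain ⟨x, rfl⟩ := hp'
  refine ⟨eMap (prodForm B B) (prodAut κ₁ κ₂) z (lieMk x x), ⟨⟨_, rfl⟩, ?_, ?_⟩, ?_⟩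
  · refine thetaL_injective (z.1 * κ₁ z.2) ?_
    refine (thetaL_eMap_mul_fst hκ₁ hκ₂ z.1 z.2 x).trans
      (Eq.trans ?_ (thetaL_twMult hκ₁ z _).symm)
    rw [mfderiv_fst_eMap hB hB hκ₁ hκ₂, mfderiv_snd_eMap hB hB hκ₁ hκ₂, lieFst_lieMk,
      lieSnd_lieMk]
  · ext u
    rw [add_apply, contract₂_apply, sigmaTw_apply_pair B hκ₁, mfderiv_fst_eMap hB hB hκ₁ hκ₂,
      mfderiv_snd_eMap hB hB hκ₁ hκ₂, eMap_prod_snd_apply hB hB hκ₁ hκ₂, lieFst_lieMk,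
      lieSnd_lieMk]
    exact eMap_mul_snd hB hκ₁ hκ₂ hBκ₁ z.1 z.2 x _ _ _ (thetaL_twMult hκ₁ z u)
  · rintro _ ⟨⟨ζ, rfl⟩, h1, h2⟩
    congr 1
    obtain ⟨x₁, hx₁⟩ : ∃ x₁, lieFst I G I G ζ = x₁ := ⟨_, rfl⟩
    obtain ⟨x₂, hx₂⟩ : ∃ x₂, lieSnd I G I G ζ = x₂ := ⟨_, rfl⟩
    have e1 := congrArg (thetaL I G (z.1 * κ₁ z.2)) h1
    have e1' := (thetaL_eMap_mul_fst hκ₁ hκ₂ z.1 z.2 x).symm.trans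
      (e1.trans (thetaL_twMult hκ₁ z _))
    rw [mfderiv_fst_eMap hB hB hκ₁ hκ₂, mfderiv_snd_eMap hB hB hκ₁ hκ₂, hx₁, hx₂] at e1'
    have e1'' := congrArg (adj I (κ₁ z.2)) e1'
    rw [adj_adj_inv, adj_adj_inv, thetaL_eMap_fst, thetaL_eMap_fst, thetaR_eMap_fst,
      thetaR_eMap_fst, map_sub (lieAut I κ₁), map_sub (lieAut I κ₁), lieAut_adj hκ₁,
      lieAut_adj hκ₁] at e1''
    choose u hX hY using fun (X : TangentSpace I z.1) (Y : TangentSpace I z.2) =>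
      exists_tangent_prod (I := I) (J := I) z X Y
    have e2 (X : TangentSpace I z.1) (Y : TangentSpace I z.2) := by
      have h := congrArg (fun l => l (u X Y)) h2
      have h' := (eMap_mul_snd hB hκ₁ hκ₂ hBκ₁ z.1 z.2 x _ _ _
        (thetaL_twMult hκ₁ z (u X Y))).symm.trans h
      rw [add_apply, contract₂_apply, sigmaTw_apply_pair B hκ₁, mfderiv_fst_eMap hB hB hκ₁ hκ₂,
        mfderiv_snd_eMap hB hB hκ₁ hκ₂, eMap_prod_snd_apply hB hB hκ₁ hκ₂, hX, hY, hx₁, hx₂,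
        eMap_add_sigmaPair hB hκ₁ hBκ₁, eMap_add_sigmaPair hB hκ₁ hBκ₁] at h'
      exact h'
    -- the covector equation on vectors `(X, 0)`, and then on vectors `(0, Y)`
    have e3 : lieAut I κ₁ x + adj I z.1⁻¹ x + adj I (κ₁ z.2) (lieAut I κ₁ (lieAut I κ₂ x)) -
          lieAut I κ₁ x = lieAut I κ₁ x₁ + adj I z.1⁻¹ x₁ +
          adj I (κ₁ z.2) (lieAut I κ₁ (lieAut I κ₂ x₂)) - lieAut I κ₁ x₂ := by
      refine hB.eq_of_forall fun X => ?_
      have h := e2 (leftField z.1 X) 0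
      rw [thetaL_leftField, map_zero, map_zero, map_zero, map_zero, add_zero, add_zero] at h
      exact mul_left_cancel₀ (by norm_num) h
    have e4 : adj I (κ₁ z.2) (lieAut I κ₁ (lieAut I κ₂ x)) + lieAut I κ₁ x - lieAut I κ₁ x +
          adj I z.1⁻¹ x = adj I (κ₁ z.2) (lieAut I κ₁ (lieAut I κ₂ x₂)) + lieAut I κ₁ x₂ -
          lieAut I κ₁ x₁ + adj I z.1⁻¹ x₁ := by
      refine hB.eq_of_forall fun Y => ?_
      have h := e2 0 (rightField z.2 (lieAut I κ₁⁻¹ Y))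
      rw [thetaR_rightField, lieAut_apply_inv hκ₁, map_zero, map_zero, map_zero, zero_add,
        zero_add] at h
      exact mul_left_cancel₀ (by norm_num) h
    have two_cancel {a b : GroupLieAlgebra I G} (h : (2 : ℝ) • a = (2 : ℝ) • b) : a = b :=
      smul_right_injective _ two_ne_zero h
    have f1 : adj I z.1⁻¹ x₁ = adj I z.1⁻¹ x := by
      refine two_cancel ?_
      linear_combination (norm := module) e1'' - e3
    have f2 : lieAut I κ₁ x₁ = lieAut I κ₁ x₂ := by
      refine two_cancel ?_
      linear_combination (norm := module) e4 - e3
    have g1 : x₁ = x := by rw [← adj_adj_inv z.1 x₁, f1, adj_adj_inv]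
    have g2 : x₂ = x := by rw [← lieAut_inv_apply hκ₁ x₂, ← f2, lieAut_inv_apply hκ₁, g1]
    rw [← lieMk_eta ζ, hx₁, hx₂, g1, g2]

/-- Twisted multiplication is a strong Dirac morphism. -/
theorem isDiracMorphism_twMult (hB : IsInvariantForm B) (hκ₁ : IsLieAut I κ₁)
    (hκ₂ : IsLieAut I κ₂) (hBκ₁ : InvariantUnder B κ₁) (hBκ₂ : InvariantUnder B κ₂) :
    IsDiracMorphism (directSum (cartanDirac B κ₁) (cartanDirac B κ₂))
      (pullback Prod.fst (cartanForm B) + pullback Prod.snd (cartanForm B))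
      (cartanDirac B (κ₁ * κ₂)) (cartanForm B) (twMult κ₁) (sigmaTw B κ₁) where
  source := by
    rw [directSum_cartanDirac hB hB hκ₁ hκ₂, ← cartanForm_prodForm hB hB]
    exact isDiracStructure_cartanDirac (hB.prodForm hB) (hκ₁.prodAut hκ₂)
      (hBκ₁.prodAut hκ₁ hκ₂ hBκ₂)
  target := isDiracStructure_cartanDirac hB (hκ₁.mul hκ₂) (hBκ₁.mul hκ₁ hκ₂ hBκ₂)
  smooth_map := contMDiff_twMult hκ₁
  smooth_form := isSmoothForm_sigmaTw B hκ₁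
  pullback_form := pullback_twMult_cartanForm hB hκ₁ hBκ₁
  lift z p' hp' := by
    rw [directSum_cartanDirac hB hB hκ₁ hκ₂]
    exact existsUnique_lift_twMult hB hκ₁ hκ₂ hBκ₁ z p' hp'

theorem thetaL_inv_aut (hκ : IsLieAut I κ) {EM : Type*} [NormedAddCommGroup EM] [NormedSpace ℝ EM]
    {HM : Type*} [TopologicalSpace HM] {IM : ModelWithCorners ℝ EM HM}
    {M : Type*} [TopologicalSpace M] [ChartedSpace HM M] {Φ : M → G} {x : M}
    (h : MDifferentiableAt IM I Φ x) (v : TangentSpace IM x) :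
    thetaL I G (twInv κ (Φ x)) (mfderiv IM I (fun y => twInv κ (Φ y)) x v) =
      -lieAut I κ⁻¹ (adj I (Φ x) (thetaL I G (Φ x) (mfderiv IM I Φ x v))) := by
  refine (thetaL_aut_comp hκ.inv (a := fun y => (Φ y)⁻¹) h.lieInv v).trans ?_
  rw [thetaL_inv h, map_neg, thetaR_eq_adj]

theorem thetaL_mfderiv_twInv (hκ : IsLieAut I κ) (a : G) (u : TangentSpace I a) :
    thetaL I G (twInv κ a) (mfderiv I I (twInv κ) a u) =
      -lieAut I κ⁻¹ (adj I a (thetaL I G a u)) := by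
  have h := thetaL_inv_aut hκ (IM := I) (Φ := fun y : G => y) (x := a) mdifferentiableAt_id u
  exact h.trans (congrArg (fun w => -lieAut I κ⁻¹ (adj I a (thetaL I G a w)))
    (mfderiv_apply_of_eq_id (E := E) (fun _ => rfl) a u))

/-- `e^{κ⁻¹}(ξ)` at the twisted inverse is related to `e^κ(ξ)`: the vector part. -/
theorem thetaL_eMap_twInv_fst (hκ : IsLieAut I κ) (a : G) (x : GroupLieAlgebra I G) :
    thetaL I G (twInv κ a) (eMap B κ⁻¹ (twInv κ a) x).1 =
      -lieAut I κ⁻¹ (adj I a (thetaL I G a (eMap B κ a x).1)) := by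
  rw [thetaL_eMap_fst, thetaL_eMap_fst, map_sub, adj_adj_inv, map_sub, lieAut_adj hκ.inv,
    lieAut_inv_apply hκ, neg_sub, twInv, map_inv, inv_inv]

/-- `e^{κ⁻¹}(ξ)` at the twisted inverse is related to `e^κ(ξ)`: the covector part. -/
theorem eMap_twInv_snd (hB : IsInvariantForm B) (hκ : IsLieAut I κ) (hBκ : InvariantUnder B κ)
    (a : G) (x : GroupLieAlgebra I G) (X : TangentSpace I a) (Z : TangentSpace I (twInv κ a))
    (hZ : thetaL I G (twInv κ a) Z = -lieAut I κ⁻¹ (adj I a (thetaL I G a X))) :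
    (eMap B κ⁻¹ (twInv κ a) x).2 Z = -(eMap B κ a x).2 X := by
  rw [eMap_snd_apply hB, eMap_snd_apply hB, hZ, map_neg, ← hBκ, lieAut_apply_inv hκ,
    hB.comm _ (adj I a _), hB.adj_left, hB.comm, mul_neg]
  congr 3
  rw [map_add, map_add, lieAut_apply_inv hκ, lieAut_adj hκ, twInv, map_inv κ⁻¹, inv_inv,
    MulAut.apply_inv_self, adj_inv_adj, add_comm]

theorem pullback_twInv_cartanForm (hB : IsInvariantForm B) (hκ : IsLieAut I κ)
    (hBκ : InvariantUnder B κ) : pullback (twInv κ) (cartanForm B) = -cartanForm B := by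
  have h := pullback_pullback (IM := I) (I' := I) (I'' := I) (Ψ := (κ⁻¹ : MulAut G))
    (Φ := fun g : G => g⁻¹) (hκ.inv.smooth.mdifferentiable (by simp))
    ((contMDiff_inv I ∞).mdifferentiable (by simp)) (cartanForm B)
  refine h.symm.trans ?_
  rw [pullback_aut_cartanForm hB hκ.inv (hBκ.inv hκ), pullback_inv_cartanForm hB]

theorem mfderiv_twInv_injective (hκ : IsLieAut I κ) (a : G) :
    Function.Injective (mfderiv I I (twInv κ) a) := by
  intro u v h
  have h1 := (thetaL_mfderiv_twInv hκ a u).symm.trans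
    ((congrArg (thetaL I G (twInv κ a)) h).trans (thetaL_mfderiv_twInv hκ a v))
  have h2 := congrArg (fun w => adj I a⁻¹ (lieAut I κ w)) (neg_injective h1)
  simp only [lieAut_apply_inv hκ, adj_inv_adj] at h2
  exact thetaL_injective a h2

/-- Twisted inversion is a strong Dirac morphism. -/
theorem isDiracMorphism_twInv (hB : IsInvariantForm B) (hκ : IsLieAut I κ)
    (hBκ : InvariantUnder B κ) :
    IsDiracMorphism (cartanDirac B κ) (cartanForm B) (transpose (cartanDirac B κ⁻¹))
      (-cartanForm B) (twInv κ) 0 where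
  source := isDiracStructure_cartanDirac hB hκ hBκ
  target := (isDiracStructure_cartanDirac hB hκ.inv (hBκ.inv hκ)).transpose
  smooth_map := contMDiff_twInv hκ
  smooth_form := IsSmoothForm.zero
  pullback_form := by
    rw [pullback_neg, pullback_twInv_cartanForm hB hκ hBκ, neg_neg, extD_zero, add_zero]
  lift a p' hp' := by
    obtain ⟨_, ⟨x, rfl⟩, rfl⟩ := hp'
    have h1 : (eMap B κ⁻¹ (twInv κ a) x).1 = mfderiv I I (twInv κ) a (eMap B κ a x).1 :=
      thetaL_injective _ ((thetaL_eMap_twInv_fst hκ a x).trans (thetaL_mfderiv_twInv hκ a _).symm)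
    have h2 (u : TangentSpace I a) :
        (-(eMap B κ⁻¹ (twInv κ a) x).2) (mfderiv I I (twInv κ) a u) = (eMap B κ a x).2 u := by
      have h := eMap_twInv_snd hB hκ hBκ a x u _ (thetaL_mfderiv_twInv hκ a u)
      rw [neg_apply, h, neg_neg]
    have h0 (p : Pont I a) (u : TangentSpace I a) :
        contract₂ ((0 : DiffForm I G 2) a) p.1 u = 0 := by
      rw [contract₂_apply]; rfl
    refine ⟨eMap B κ a x, ⟨⟨x, rfl⟩, h1, ?_⟩, ?_⟩
    · ext u
      rw [add_apply, h0, add_zero]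
      exact h2 u
    · rintro p ⟨-, h3, h4⟩
      refine Prod.ext (mfderiv_twInv_injective hκ a (h3.symm.trans h1)) ?_
      ext u
      have h := congrArg (fun l => l u) h4
      rw [add_apply, h0, add_zero] at h
      exact h.symm.trans (h2 u)

end Morphisms

/-! ### Fusion of group-valued maps -/

section FusionMaps

variable {E : Type*} [NormedAddCommGroup E] [NormedSpace ℝ E] [FiniteDimensional ℝ E]
  {H : Type*} [TopologicalSpace H] {I : ModelWithCorners ℝ E H} [I.Boundaryless]
  {G : Type*} [TopologicalSpace G] [ChartedSpace H G] [Group G] [LieGroup I ∞ G]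
  {B : LinearMap.BilinForm ℝ (GroupLieAlgebra I G)} {κ κ₁ κ₂ : MulAut G}
  {E' : Type*} [NormedAddCommGroup E'] [NormedSpace ℝ E'] [FiniteDimensional ℝ E']
  {H' : Type*} [TopologicalSpace H'] {J : ModelWithCorners ℝ E' H'} [J.Boundaryless]
  {K : Type*} [TopologicalSpace K] [ChartedSpace H' K] [Group K] [LieGroup J ∞ K]
  {EM : Type*} [NormedAddCommGroup EM] [NormedSpace ℝ EM] [FiniteDimensional ℝ EM]
  {HM : Type*} [TopologicalSpace HM] {IM : ModelWithCorners ℝ EM HM} [IM.Boundaryless]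
  {M : Type*} [TopologicalSpace M] [ChartedSpace HM M] [IsManifold IM ∞ M]

theorem pullback_sigmaTw_pair (B : LinearMap.BilinForm ℝ (GroupLieAlgebra I G))
    (hκ : IsLieAut I κ) {Φ₁ Φ₂ : M → G} {x : M} (h₁ : MDifferentiableAt IM I Φ₁ x)
    (h₂ : MDifferentiableAt IM I Φ₂ x) (u v : TangentSpace IM x) :
    pullback (I := IM) (fun x => (Φ₁ x, Φ₂ x)) (sigmaTw B κ) x ![u, v] =
      sigmaPair I B κ (Φ₁ x) (Φ₂ x) (mfderiv IM I Φ₁ x u) (mfderiv IM I Φ₂ x u)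
        (mfderiv IM I Φ₁ x v) (mfderiv IM I Φ₂ x v) := by
  have h : MDifferentiableAt IM (I.prod I) (fun x => (Φ₁ x, Φ₂ x)) x := h₁.prodMk h₂
  rw [pullback_apply_two, sigmaTw_apply_pair B hκ, ← mfderiv_fst_comp h, ← mfderiv_snd_comp h,
    ← mfderiv_fst_comp h, ← mfderiv_snd_comp h]

theorem form_swap {x : M} (ϖ : (TangentSpace IM x) [⋀^Fin 2]→L[ℝ] ℝ) (u v : TangentSpace IM x) :
    ϖ ![u, v] = -ϖ ![v, u] := by
  have h := ϖ.toAlternatingMap.map_swap ![v, u] (i := 0) (j := 1) (by decide)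
  have e : ![v, u] ∘ Equiv.swap (0 : Fin 2) 1 = ![u, v] := by
    ext i; fin_cases i <;> rfl
  rw [e] at h
  exact h

/-- The multiplicative property of `η` along a pair of maps into `G`. -/
theorem pullback_fusion_cartanForm (hB : IsInvariantForm B) (hκ₁ : IsLieAut I κ₁)
    (hBκ₁ : InvariantUnder B κ₁) {Φ₁ Φ₂ : M → G} (h₁ : ContMDiff IM I ∞ Φ₁)
    (h₂ : ContMDiff IM I ∞ Φ₂) :
    pullback (I := IM) (fun x => Φ₁ x * κ₁ (Φ₂ x)) (cartanForm B) =
      pullback Φ₁ (cartanForm B) + pullback Φ₂ (cartanForm B) +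
        extD (pullback (I := IM) (fun x => (Φ₁ x, Φ₂ x)) (sigmaTw B κ₁)) := by
  have h : ContMDiff IM (I.prod I) ∞ (fun x => (Φ₁ x, Φ₂ x)) := h₁.prodMk h₂
  have hd : MDifferentiable IM (I.prod I) (fun x => (Φ₁ x, Φ₂ x)) := h.mdifferentiable (by simp)
  rw [extD_pullback h (isSmoothForm_sigmaTw B hκ₁)]
  have e := pullback_pullback (Ψ := twMult κ₁) ((contMDiff_twMult hκ₁).mdifferentiable (by simp)) hd
    (cartanForm B)
  rw [pullback_twMult_cartanForm hB hκ₁ hBκ₁, pullback_add, pullback_add] at e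
  refine e.symm.trans (congrArg₂ HAdd.hAdd (congrArg₂ HAdd.hAdd ?_ ?_) rfl)
  · exact pullback_pullback (Ψ := Prod.fst) mdifferentiable_fst hd _
  · exact pullback_pullback (Ψ := Prod.snd) mdifferentiable_snd hd _

/-- A tangent vector `w` mapped by `Φ₁` and `Φ₂` to the vector parts of `e^{κ₁}(ξ)` and `e^{κ₂}(ξ)`
satisfies the moment condition for the product map, with the correction term `ι_w (Φ₁, Φ₂)^* ς`. -/
theorem eMap_fusion (hB : IsInvariantForm B) (hκ₁ : IsLieAut I κ₁) (hκ₂ : IsLieAut I κ₂)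
    (hBκ₁ : InvariantUnder B κ₁) {Φ₁ Φ₂ : M → G} {x : M} (h₁ : MDifferentiableAt IM I Φ₁ x)
    (h₂ : MDifferentiableAt IM I Φ₂ x) (ξ : GroupLieAlgebra I G) {w : TangentSpace IM x}
    (hw₁ : mfderiv IM I Φ₁ x w = (eMap B κ₁ (Φ₁ x) ξ).1)
    (hw₂ : mfderiv IM I Φ₂ x w = (eMap B κ₂ (Φ₂ x) ξ).1) (v : TangentSpace IM x) :
    (eMap B (κ₁ * κ₂) (Φ₁ x * κ₁ (Φ₂ x)) ξ).2
        (mfderiv IM I (fun y => Φ₁ y * κ₁ (Φ₂ y)) x v) =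
      (eMap B κ₁ (Φ₁ x) ξ).2 (mfderiv IM I Φ₁ x v) + (eMap B κ₂ (Φ₂ x) ξ).2 (mfderiv IM I Φ₂ x v) +
        pullback (I := IM) (fun x => (Φ₁ x, Φ₂ x)) (sigmaTw B κ₁) x ![w, v] := by
  rw [pullback_sigmaTw_pair B hκ₁ h₁ h₂, hw₁, hw₂]
  exact eMap_mul_snd hB hκ₁ hκ₂ hBκ₁ _ _ ξ _ _ _ (thetaL_fusion hκ₁ h₁ h₂ v)

/-- Nondegeneracy of the fused form, reduced to that of `ϖ`: on the kernel of the fused moment map,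
contraction with the generating vectors of the first factor alone detects `θ^L(dΦ₁ v)`. -/
theorem fusion_nondegenerate (hB : IsInvariantForm B) (hκ₁ : IsLieAut I κ₁)
    (hBκ₁ : InvariantUnder B κ₁) {Φ₁ Φ₂ : M → G} {x : M} (h₁ : MDifferentiableAt IM I Φ₁ x)
    (h₂ : MDifferentiableAt IM I Φ₂ x) {ϖ : DiffForm IM M 2} {v : TangentSpace IM x}
    (hw : ∀ ξ : GroupLieAlgebra I G, ∃ w : TangentSpace IM x,
      mfderiv IM I Φ₁ x w = (eMap B κ₁ (Φ₁ x) ξ).1 ∧ mfderiv IM I Φ₂ x w = 0 ∧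
        ϖ x ![w, v] = (eMap B κ₁ (Φ₁ x) ξ).2 (mfderiv IM I Φ₁ x v))
    (hv : ∀ w, ϖ x ![v, w] +
      pullback (I := IM) (fun x => (Φ₁ x, Φ₂ x)) (sigmaTw B κ₁) x ![v, w] = 0)
    (hv' : mfderiv IM I (fun y => Φ₁ y * κ₁ (Φ₂ y)) x v = 0) :
    mfderiv IM I Φ₁ x v = 0 ∧ mfderiv IM I Φ₂ x v = 0 ∧ ∀ w, ϖ x ![v, w] = 0 := by
  have hpq : lieAut I κ₁ (thetaR I G (Φ₂ x) (mfderiv IM I Φ₂ x v)) =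
      -thetaL I G (Φ₁ x) (mfderiv IM I Φ₁ x v) := by
    have h := (thetaL_fusion hκ₁ h₁ h₂ v).symm.trans (congrArg _ hv')
    rw [map_zero] at h
    have h' := congrArg (adj I (κ₁ (Φ₂ x))) h
    rw [adj_adj_inv, map_zero] at h'
    exact eq_neg_of_add_eq_zero_right h'
  have hp : thetaL I G (Φ₁ x) (mfderiv IM I Φ₁ x v) = 0 := by
    refine hB.eq_of_forall fun ξ => ?_
    obtain ⟨w, hw₁, hw₂, hw₃⟩ := hw (lieAut I κ₁⁻¹ ξ)
    have h := hv w
    rw [form_swap (ϖ x), form_swap (pullback _ _ x), hw₃, pullback_sigmaTw_pair B hκ₁ h₁ h₂, hw₁,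
      hw₂] at h
    have h' := eMap_add_sigmaPair (κ₂ := 1) hB hκ₁ hBκ₁ (Φ₁ x) (Φ₂ x) (lieAut I κ₁⁻¹ ξ) 0
      (mfderiv IM I Φ₁ x v) (mfderiv IM I Φ₂ x v)
    rw [hpq, lieAut_apply_inv hκ₁] at h'
    simp only [map_zero, Prod.fst_zero, Prod.snd_zero, zero_apply, add_zero, sub_zero, zero_sub,
      map_add, map_neg, LinearMap.add_apply, LinearMap.neg_apply] at h'
    rw [map_zero, LinearMap.zero_apply, hB.comm]
    linarith
  have hX : mfderiv IM I Φ₁ x v = 0 := thetaL_injective _ (hp.trans (map_zero _).symm)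
  have hY : mfderiv IM I Φ₂ x v = 0 := by
    rw [hp, neg_zero] at hpq
    have h := congrArg (lieAut I κ₁⁻¹) hpq
    rw [lieAut_inv_apply hκ₁, map_zero, thetaR_eq_adj] at h
    have h' := congrArg (adj I (Φ₂ x)⁻¹) h
    rw [adj_inv_adj, map_zero] at h'
    exact thetaL_injective _ (h'.trans (map_zero _).symm)
  refine ⟨hX, hY, fun w => ?_⟩
  have h := hv w
  rwa [pullback_sigmaTw_pair B hκ₁ h₁ h₂, hX, hY, sigmaPair_zero_left, add_zero] at h

end FusionMaps

/-! ### Generating vector fields of quasi-Hamiltonian spaces -/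

section QuasiHamiltonian

variable {E : Type*} [NormedAddCommGroup E] [NormedSpace ℝ E] [FiniteDimensional ℝ E]
  {H : Type*} [TopologicalSpace H] {I : ModelWithCorners ℝ E H} [I.Boundaryless]
  {G : Type*} [TopologicalSpace G] [ChartedSpace H G] [Group G] [LieGroup I ∞ G]
  {B : LinearMap.BilinForm ℝ (GroupLieAlgebra I G)} {κ κ₁ κ₂ : MulAut G}
  {EM : Type*} [NormedAddCommGroup EM] [NormedSpace ℝ EM]
  {HM : Type*} [TopologicalSpace HM] {IM : ModelWithCorners ℝ EM HM}
  {M : Type*} [TopologicalSpace M] [ChartedSpace HM M] [IsManifold IM ∞ M] [MulAction G M]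
  {ϖ : DiffForm IM M 2} {Φ : M → G}

theorem mdifferentiableAt_orbit (hs : ContMDiffSMul I IM ∞ G M) (g : G) (x : M) :
    MDifferentiableAt I IM (fun g : G => g • x) g :=
  (hs.contMDiff_smul.comp (contMDiff_id.prodMk contMDiff_const)).mdifferentiableAt
    (n := ∞) (by simp)

/-- The velocity of `g ↦ Ad_g^κ(a)` at the unit is minus the vector part of `e^κ(ξ)` at `a`. -/
theorem mfderiv_twConj_orbit (hκ : IsLieAut I κ) (a : G) (ξ : GroupLieAlgebra I G) :
    (mfderiv I I (fun g : G => twConj κ g a) 1 ξ : E) = -(eMap B κ a ξ).1 := by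
  have h1 : twConj κ 1 a = a := by simp [twConj]
  refine thetaL_injective a ((thetaL_congr_point h1 _).symm.trans ?_)
  have hd : MDifferentiableAt I I (fun g : G => g * a) 1 := mdifferentiableAt_mulRight a 1
  have hd' : MDifferentiableAt I I (fun g : G => g⁻¹) 1 :=
    (contMDiff_inv I ∞).mdifferentiableAt (by simp)
  have h2 := thetaL_mul_aut (IM := I) hκ hd hd' ξ
  refine h2.trans ?_
  have e1 : thetaL I G (1 * a) (mfderiv I I (fun g : G => g * a) 1 ξ) = adj I a⁻¹ ξ :=
    (thetaL_congr_point (one_mul a) _).trans (thetaL_rightField a ξ)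
  have e2 : thetaL I G (1 : G)⁻¹ (mfderiv I I (fun g : G => g⁻¹) 1 ξ) = -ξ := by
    rw [thetaL_mfderiv_inv]
    exact congrArg Neg.neg (mfderiv_apply_of_eq_id (E := E) (by simp) (1 : G) ξ)
  have e3 := thetaL_eMap_fst B κ a ξ
  rw [e1, e2, inv_one, map_one, inv_one, adj_one, map_neg (lieAut I κ), map_neg, e3]
  abel

theorem IsTqHamiltonian.mdifferentiableAt (h : IsTqHamiltonian B κ ϖ Φ) (x : M) :
    MDifferentiableAt IM I Φ x := h.smooth_moment.mdifferentiableAt (by simp)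

/-- The moment map intertwines the generating vector fields: `Φ_* ξ_M` is the vector part of
`e^κ(ξ)`. -/
theorem IsTqHamiltonian.mfderiv_fundField (h : IsTqHamiltonian B κ ϖ Φ) (hκ : IsLieAut I κ)
    (ξ : GroupLieAlgebra I G) (x : M) :
    mfderiv IM I Φ x (fundField I IM ξ x) = (eMap B κ (Φ x) ξ).1 := by
  have h1 := mfderiv_chain (h := fun g : G => twConj κ g (Φ x)) (h.mdifferentiableAt x)
    (mdifferentiableAt_orbit h.smooth_action 1 x) (one_smul G x)
    (fun g => h.equivariant g x) ξ
  refine (map_neg (mfderiv IM I Φ x) _).trans ?_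
  exact (congrArg (fun w : E => -w)
    (h1.symm.trans (mfderiv_twConj_orbit (B := B) hκ (Φ x) ξ))).trans (neg_neg _)

theorem IsTqHamiltonian.form_fundField (h : IsTqHamiltonian B κ ϖ Φ)
    (ξ : GroupLieAlgebra I G) (x : M) (v : TangentSpace IM x) :
    ϖ x ![fundField I IM ξ x, v] = (eMap B κ (Φ x) ξ).2 (mfderiv IM I Φ x v) :=
  h.moment ξ x v

end QuasiHamiltonian

/-! ### Internal fusion -/

section InternalFusion

variable {E : Type*} [NormedAddCommGroup E] [NormedSpace ℝ E] [FiniteDimensional ℝ E]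
  {H : Type*} [TopologicalSpace H] {I : ModelWithCorners ℝ E H} [I.Boundaryless]
  {G : Type*} [TopologicalSpace G] [ChartedSpace H G] [Group G] [LieGroup I ∞ G]
  {B : LinearMap.BilinForm ℝ (GroupLieAlgebra I G)} {κ₁ κ₂ : MulAut G}
  {E' : Type*} [NormedAddCommGroup E'] [NormedSpace ℝ E'] [FiniteDimensional ℝ E']
  {H' : Type*} [TopologicalSpace H'] {J : ModelWithCorners ℝ E' H'} [J.Boundaryless]
  {K : Type*} [TopologicalSpace K] [ChartedSpace H' K] [Group K] [LieGroup J ∞ K]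
  {B' : LinearMap.BilinForm ℝ (GroupLieAlgebra J K)} {τ : MulAut K}
  {EM : Type*} [NormedAddCommGroup EM] [NormedSpace ℝ EM] [FiniteDimensional ℝ EM]
  {HM : Type*} [TopologicalSpace HM] {IM : ModelWithCorners ℝ EM HM} [IM.Boundaryless]
  {M : Type*} [TopologicalSpace M] [ChartedSpace HM M] [IsManifold IM ∞ M]
  [MulAction (G × G × K) M]

/-- The homomorphism `(g, k) ↦ (g, g, k)` defining the fused action is smooth. -/
theorem contMDiff_diag : ContMDiff (I.prod J) (I.prod (I.prod J)) ∞
    ((MonoidHom.fst G K).prod ((MonoidHom.fst G K).prod (MonoidHom.snd G K))) :=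
  contMDiff_fst.prodMk (contMDiff_fst.prodMk contMDiff_snd)

theorem mfderiv_diag (ξ : GroupLieAlgebra (I.prod J) (G × K)) :
    (mfderiv (I.prod J) (I.prod (I.prod J))
      ((MonoidHom.fst G K).prod ((MonoidHom.fst G K).prod (MonoidHom.snd G K))) 1 ξ : E × E × E') =
    (lieMk (I := I) (J := I.prod J) (lieFst I G J K ξ)
      (lieMk (lieFst I G J K ξ) (lieSnd I G J K ξ)) :
      GroupLieAlgebra (I.prod (I.prod J)) (G × G × K)) := by
  have hd := (contMDiff_diag (I := I) (J := J) (G := G) (K := K)).mdifferentiableAt (x := 1)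
    (by simp)
  have hd2 : MDifferentiableAt (I.prod J) (I.prod J) (fun z : G × K => (z.1, z.2)) 1 :=
    mdifferentiableAt_fst.prodMk mdifferentiableAt_snd
  have h1 := mfderiv_chain (h := (Prod.fst : G × K → G)) mdifferentiableAt_fst hd rfl
    (fun _ => rfl) ξ
  have h2 := mfderiv_chain (h := fun z : G × K => (z.1, z.2)) mdifferentiableAt_snd hd rfl
    (fun _ => rfl) ξ
  have h3 := mfderiv_apply_of_eq_id (I := I.prod J) (f := fun z : G × K => (z.1, z.2))
    (fun _ => rfl) 1 ξ
  refine lie_prod_ext (I := I) (J := I.prod J) (G := G) (K := G × K) ?_ ?_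
  · rw [lieFst_lieMk]
    exact h1.symm
  · rw [lieSnd_lieMk, lieMk_eta]
    exact h2.symm.trans h3

/-- The generating vector field of the fused action is that of the diagonal element of
`𝔤 ⊕ 𝔤 ⊕ 𝔨`. -/
theorem fundField_fusedAction (hs : ContMDiffSMul (I.prod (I.prod J)) IM ∞ (G × G × K) M)
    (ξ : GroupLieAlgebra (I.prod J) (G × K)) (x : M) :
    letI : MulAction (G × K) M := fusedAction G K M
    fundField (I.prod J) IM ξ x = fundField (I.prod (I.prod J)) IM
      (lieMk (lieFst I G J K ξ) (lieMk (lieFst I G J K ξ) (lieSnd I G J K ξ)) :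
        GroupLieAlgebra (I.prod (I.prod J)) (G × G × K)) x := by
  let _ : MulAction (G × K) M := fusedAction G K M
  have h := mfderiv_chain (h := fun z : G × K => z • x) (mdifferentiableAt_orbit hs 1 x)
    ((contMDiff_diag (I := I) (J := J) (G := G) (K := K)).mdifferentiableAt (x := 1) (by simp))
    (map_one _) (fun _ => rfl) ξ
  exact congrArg Neg.neg (h.trans (congrArg (mfderiv (I.prod (I.prod J)) IM
    (fun g : G × G × K => g • x) 1) (mfderiv_diag ξ)))

variable {ϖ : DiffForm IM M 2} {Φ : M → G × G × K}

theorem mfderiv_components (hΦ : ContMDiff IM (I.prod (I.prod J)) ∞ Φ) (x : M)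
    (v : TangentSpace IM x) :
    mfderiv IM I (fun y => (Φ y).1) x v = mfderiv (I.prod (I.prod J)) I Prod.fst (Φ x)
        (mfderiv IM (I.prod (I.prod J)) Φ x v) ∧
      mfderiv IM I (fun y => (Φ y).2.1) x v = mfderiv (I.prod J) I Prod.fst (Φ x).2
        (mfderiv (I.prod (I.prod J)) (I.prod J) Prod.snd (Φ x)
          (mfderiv IM (I.prod (I.prod J)) Φ x v)) ∧
      mfderiv IM J (fun y => (Φ y).2.2) x v = mfderiv (I.prod J) J Prod.snd (Φ x).2
        (mfderiv (I.prod (I.prod J)) (I.prod J) Prod.snd (Φ x)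
          (mfderiv IM (I.prod (I.prod J)) Φ x v)) := by
  have h : MDifferentiableAt IM (I.prod (I.prod J)) Φ x := hΦ.mdifferentiableAt (by simp)
  have h2 : MDifferentiableAt IM (I.prod J) (fun y => (Φ y).2) x :=
    (contMDiff_snd.comp hΦ).mdifferentiableAt (n := ∞) (by simp)
  refine ⟨mfderiv_fst_comp h v, ?_, ?_⟩
  · rw [mfderiv_fst_comp h2, mfderiv_snd_comp h]
  · rw [mfderiv_snd_comp h2, mfderiv_snd_comp h]

/-- The moment map condition for `G × G × K`, written out in components. -/
theorem IsTqHamiltonian.components (hB : IsInvariantForm B) (hB' : IsInvariantForm B')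
    (hκ₁ : IsLieAut I κ₁) (hκ₂ : IsLieAut I κ₂) (hτ : IsLieAut J τ)
    (h : IsTqHamiltonian (prodForm B (prodForm B B')) (prodAut κ₁ (prodAut κ₂ τ)) ϖ Φ)
    (x₁ x₂ : GroupLieAlgebra I G) (y : GroupLieAlgebra J K) (x : M) :
    let w := fundField (I.prod (I.prod J)) IM
      (lieMk x₁ (lieMk x₂ y) : GroupLieAlgebra (I.prod (I.prod J)) (G × G × K)) x
    mfderiv IM I (fun y => (Φ y).1) x w = (eMap B κ₁ (Φ x).1 x₁).1 ∧
      mfderiv IM I (fun y => (Φ y).2.1) x w = (eMap B κ₂ (Φ x).2.1 x₂).1 ∧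
      mfderiv IM J (fun y => (Φ y).2.2) x w = (eMap B' τ (Φ x).2.2 y).1 ∧
      ∀ v, ϖ x ![w, v] = (eMap B κ₁ (Φ x).1 x₁).2 (mfderiv IM I (fun y => (Φ y).1) x v) +
        ((eMap B κ₂ (Φ x).2.1 x₂).2 (mfderiv IM I (fun y => (Φ y).2.1) x v) +
          (eMap B' τ (Φ x).2.2 y).2 (mfderiv IM J (fun y => (Φ y).2.2) x v)) := by
  intro w
  have hκτ := hκ₂.prodAut hτ
  have hBB := hB.prodForm hB'
  have hw := mfderiv_components h.smooth_moment x w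
  have hT := h.mfderiv_fundField (hκ₁.prodAut hκτ) (lieMk x₁ (lieMk x₂ y)) x
  change mfderiv IM (I.prod (I.prod J)) Φ x w = _ at hT
  rw [hT, mfderiv_fst_eMap hB hBB hκ₁ hκτ, mfderiv_snd_eMap hB hBB hκ₁ hκτ,
    mfderiv_fst_eMap hB hB' hκ₂ hτ, mfderiv_snd_eMap hB hB' hκ₂ hτ, lieFst_lieMk, lieSnd_lieMk,
    lieFst_lieMk, lieSnd_lieMk] at hw
  refine ⟨hw.1, hw.2.1, hw.2.2, fun v => ?_⟩
  have hv := mfderiv_components h.smooth_moment x v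
  have hm := h.form_fundField (lieMk x₁ (lieMk x₂ y)) x v
  rw [eMap_prod_snd_apply hB hBB hκ₁ hκτ, eMap_prod_snd_apply hB hB' hκ₂ hτ, ← hv.1, ← hv.2.1,
    ← hv.2.2, lieFst_lieMk, lieSnd_lieMk, lieFst_lieMk, lieSnd_lieMk] at hm
  exact hm

/-- The fused form is `ϖ + (Φ₁, Φ₂)^* ς^{κ₁}`. -/
theorem sub_dotWedge_eq_add_pullback (hκ₁ : IsLieAut I κ₁) {Φ₁ Φ₂ : M → G}
    (h₁ : ContMDiff IM I ∞ Φ₁) (h₂ : ContMDiff IM I ∞ Φ₂) (ϖ : DiffForm IM M 2) :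
    ϖ - (1 / 2 : ℝ) • dotWedge B (pullback₁ (I' := I) Φ₁ (thetaL I G))
        (pullback₁ (I' := I) Φ₂ (pullback₁ (I := I) (I' := I) κ₁ (thetaR I G))) =
      ϖ + pullback (I := IM) (fun x => (Φ₁ x, Φ₂ x)) (sigmaTw B κ₁) := by
  rw [pullback_prodMk_sigmaTw B hκ₁ (h₁.mdifferentiable (by simp)) (h₂.mdifferentiable (by simp)),
    sub_eq_add_neg]

/-- Internal fusion of twisted quasi-Hamiltonian spaces. -/
theorem IsTqHamiltonian.fusion (hB : IsInvariantForm B) (hB' : IsInvariantForm B')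
    (hκ₁ : IsLieAut I κ₁) (hκ₂ : IsLieAut I κ₂) (hτ : IsLieAut J τ)
    (hBκ₁ : InvariantUnder B κ₁)
    (h : IsTqHamiltonian (prodForm B (prodForm B B')) (prodAut κ₁ (prodAut κ₂ τ)) ϖ Φ) :
    letI : MulAction (G × K) M := fusedAction G K M
    IsTqHamiltonian (prodForm B B') (prodAut (κ₁ * κ₂) τ)
      (ϖ - (1 / 2 : ℝ) • dotWedge B (pullback₁ (I' := I) (fun x => (Φ x).1) (thetaL I G))
        (pullback₁ (I' := I) (fun x => (Φ x).2.1) (pullback₁ (I := I) (I' := I) κ₁ (thetaR I G))))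
      (fun x => ((Φ x).1 * κ₁ (Φ x).2.1, (Φ x).2.2)) := by
  let _ : MulAction (G × K) M := fusedAction G K M
  have hs := h.smooth_action
  have h₁ : ContMDiff IM I ∞ (fun x => (Φ x).1) := contMDiff_fst.comp h.smooth_moment
  have h₂ : ContMDiff IM I ∞ (fun x => (Φ x).2.1) :=
    contMDiff_fst.comp (contMDiff_snd.comp h.smooth_moment)
  have h₃ : ContMDiff IM J ∞ (fun x => (Φ x).2.2) :=
    contMDiff_snd.comp (contMDiff_snd.comp h.smooth_moment)
  have hp : ContMDiff IM (I.prod I) ∞ (fun x => ((Φ x).1, (Φ x).2.1)) := h₁.prodMk h₂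
  have d₁ : MDifferentiable IM I (fun x => (Φ x).1) := h₁.mdifferentiable (by simp)
  have d₂ : MDifferentiable IM I (fun x => (Φ x).2.1) := h₂.mdifferentiable (by simp)
  have hf : ContMDiff IM I ∞ (fun x => (Φ x).1 * κ₁ (Φ x).2.1) := (contMDiff_twMult hκ₁).comp hp
  have hfus : ContMDiff IM (I.prod J) ∞ (fun x => ((Φ x).1 * κ₁ (Φ x).2.1, (Φ x).2.2)) :=
    hf.prodMk h₃
  have df (x : M) := hfus.mdifferentiableAt (x := x) (by simp)
  have hsig := (isSmoothForm_sigmaTw B hκ₁).pullback hp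
  rw [sub_dotWedge_eq_add_pullback hκ₁ h₁ h₂]
  refine ⟨MulAction.contMDiffSMul_compHom contMDiff_diag, h.smooth_form.add hsig, hfus, ?_, ?_, ?_,
    ?_, ?_⟩
  · intro g
    let g' : G × G × K := (g.1, g.1, g.2)
    have hg : MDifferentiable IM IM (fun x : M => g' • x) :=
      (hs.contMDiff_smul.comp (contMDiff_const.prodMk contMDiff_id)).mdifferentiable (n := ∞)
        (by simp)
    change pullback (fun x : M => g' • x) _ = _
    rw [pullback_add, h.invariant]
    congr 1
    refine (pullback_pullback (hp.mdifferentiable (by simp)) hg _).trans ?_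
    have e : (fun x => ((Φ (g' • x)).1, (Φ (g' • x)).2.1)) =
        fun x => (twConj κ₁ g.1 (Φ x).1, twConj κ₂ g.1 (Φ x).2.1) := by
      funext x
      rw [h.equivariant]
      rfl
    rw [e]
    exact pullback_twConj_sigmaTw hB hκ₁ κ₂ g.1 d₁ d₂
  · intro g x
    have e := h.equivariant (g.1, g.1, g.2) x
    refine Prod.ext ?_ ?_
    · refine Eq.trans ?_ (twMult_twConj κ₁ κ₂ g.1 (Φ x).1 (Φ x).2.1)
      exact congrArg (fun z : G × G × K => z.1 * κ₁ z.2.1) e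
    · exact congrArg (fun z : G × G × K => z.2.2) e
  · have hΦ : MDifferentiable IM (I.prod (I.prod J)) Φ := h.smooth_moment.mdifferentiable (by simp)
    have hΦ2 : MDifferentiable IM (I.prod J) (fun x => (Φ x).2) :=
      (contMDiff_snd.comp h.smooth_moment).mdifferentiable (n := ∞) (by simp)
    have hη := h.differential
    rw [cartanForm_prodForm hB (hB.prodForm hB'), cartanForm_prodForm hB hB', pullback_add] at hη
    have e1 := pullback_pullback (I' := I.prod (I.prod J)) (I'' := I) (Ψ := Prod.fst)
      mdifferentiable_fst hΦ (cartanForm B)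
    have e2 := pullback_pullback (I' := I.prod (I.prod J)) (I'' := I.prod J) (Ψ := Prod.snd)
      mdifferentiable_snd hΦ (pullback (I := I.prod J) Prod.fst (cartanForm B) +
        pullback (I := I.prod J) Prod.snd (cartanForm B'))
    rw [e1, e2, pullback_add] at hη
    have e3 := pullback_pullback (I' := I.prod J) (I'' := I) (Ψ := Prod.fst)
      mdifferentiable_fst hΦ2 (cartanForm B)
    have e4 := pullback_pullback (I' := I.prod J) (I'' := J) (Ψ := Prod.snd)
      mdifferentiable_snd hΦ2 (cartanForm B')
    rw [e3, e4] at hη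
    have hd : MDifferentiable IM (I.prod J) (fun x => ((Φ x).1 * κ₁ (Φ x).2.1, (Φ x).2.2)) := df
    have e5 := pullback_pullback (I' := I.prod J) (I'' := I) (Ψ := Prod.fst)
      mdifferentiable_fst hd (cartanForm B)
    have e6 := pullback_pullback (I' := I.prod J) (I'' := J) (Ψ := Prod.snd)
      mdifferentiable_snd hd (cartanForm B')
    rw [extD_add h.smooth_form hsig, hη, cartanForm_prodForm hB hB', pullback_add, e5, e6,
      pullback_fusion_cartanForm hB hκ₁ hBκ₁ h₁ h₂]
    abel
  · intro ξ x v
    rw [fundField_fusedAction hs]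
    obtain ⟨hw₁, hw₂, -, hw⟩ := h.components hB hB' hκ₁ hκ₂ hτ (lieFst I G J K ξ)
      (lieFst I G J K ξ) (lieSnd I G J K ξ) x
    change ϖ x ![_, v] + pullback _ _ x ![_, v] =
      (eMap (prodForm B B') (prodAut (κ₁ * κ₂) τ) ((Φ x).1 * κ₁ (Φ x).2.1, (Φ x).2.2) ξ).2
        (mfderiv IM (I.prod J) (fun x => ((Φ x).1 * κ₁ (Φ x).2.1, (Φ x).2.2)) x v)
    rw [eMap_prod_snd_apply hB hB' (hκ₁.mul hκ₂) hτ, hw]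
    have e1 := mfderiv_fst_comp (df x) v
    have e2 := mfderiv_snd_comp (df x) v
    have e3 := eMap_fusion hB hκ₁ hκ₂ hBκ₁ (d₁ x) (d₂ x) (lieFst I G J K ξ) hw₁ hw₂ v
    refine Eq.trans ?_ (congrArg₂ HAdd.hAdd
      (e3.symm.trans (congrArg (eMap B (κ₁ * κ₂) _ (lieFst I G J K ξ)).2 e1))
      (congrArg (eMap B' τ _ (lieSnd I G J K ξ)).2 e2))
    ring
  · intro x v hv hv'
    have e1 := (mfderiv_fst_comp (df x) v).trans ((congrArg _ hv').trans (map_zero _))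
    have e2 := (mfderiv_snd_comp (df x) v).trans ((congrArg _ hv').trans (map_zero _))
    have hv0 : mfderiv IM J (fun y => (Φ y).2.2) x v = 0 := e2
    have key := fusion_nondegenerate hB hκ₁ hBκ₁ (d₁ x) (d₂ x) (ϖ := ϖ) (v := v) (fun ξ => by
      -- the generating vectors of the first factor `G` alone
      obtain ⟨hw₁, hw₂, -, hw⟩ := h.components hB hB' hκ₁ hκ₂ hτ ξ 0 0 x
      refine ⟨_, hw₁, hw₂.trans ?_, (hw v).trans ?_⟩
      · rw [map_zero]; rfl
      · rw [hv0, map_zero, map_zero]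
        simp) hv e1
    obtain ⟨k1, k2, k3⟩ := key
    have hc := mfderiv_components h.smooth_moment x v
    refine h.nondegenerate x v k3 ?_
    refine tangent_prod_ext (hc.1.symm.trans (k1.trans (map_zero _).symm)) ?_
    refine tangent_prod_ext (hc.2.1.symm.trans (k2.trans ?_)) (hc.2.2.symm.trans (hv0.trans ?_)) <;>
    rw [map_zero, map_zero]

end InternalFusion

/-! ### Fusion products and inverses -/

section FusionProduct

variable {E : Type*} [NormedAddCommGroup E] [NormedSpace ℝ E] [FiniteDimensional ℝ E]
  {H : Type*} [TopologicalSpace H] {I : ModelWithCorners ℝ E H} [I.Boundaryless]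
  {G : Type*} [TopologicalSpace G] [ChartedSpace H G] [Group G] [LieGroup I ∞ G]
  {B : LinearMap.BilinForm ℝ (GroupLieAlgebra I G)} {κ κ₁ κ₂ : MulAut G}
  {E₁ : Type*} [NormedAddCommGroup E₁] [NormedSpace ℝ E₁] [FiniteDimensional ℝ E₁]
  {H₁ : Type*} [TopologicalSpace H₁] {I₁ : ModelWithCorners ℝ E₁ H₁} [I₁.Boundaryless]
  {M₁ : Type*} [TopologicalSpace M₁] [ChartedSpace H₁ M₁] [IsManifold I₁ ∞ M₁] [MulAction G M₁]
  {E₂ : Type*} [NormedAddCommGroup E₂] [NormedSpace ℝ E₂] [FiniteDimensional ℝ E₂]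
  {H₂ : Type*} [TopologicalSpace H₂] {I₂ : ModelWithCorners ℝ E₂ H₂} [I₂.Boundaryless]
  {M₂ : Type*} [TopologicalSpace M₂] [ChartedSpace H₂ M₂] [IsManifold I₂ ∞ M₂] [MulAction G M₂]

theorem mfderiv_fst_fundField (hs₁ : ContMDiffSMul I I₁ ∞ G M₁) (hs₂ : ContMDiffSMul I I₂ ∞ G M₂)
    (ξ : GroupLieAlgebra I G) (z : M₁ × M₂) :
    mfderiv (I₁.prod I₂) I₁ Prod.fst z (fundField I (I₁.prod I₂) ξ z) = fundField I I₁ ξ z.1 := by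
  have hd : MDifferentiableAt I (I₁.prod I₂) (fun g : G => g • z) 1 :=
    mdifferentiableAt_orbit inferInstance 1 z
  have h := mfderiv_chain (I := I) (h := fun g : G => g • z.1) (g := (Prod.fst : M₁ × M₂ → M₁))
    mdifferentiableAt_fst hd
    (one_smul G z) (fun _ => rfl) ξ
  exact (map_neg (mfderiv (I₁.prod I₂) I₁ Prod.fst z) _).trans (congrArg Neg.neg h.symm)

theorem mfderiv_snd_fundField (hs₁ : ContMDiffSMul I I₁ ∞ G M₁) (hs₂ : ContMDiffSMul I I₂ ∞ G M₂)
    (ξ : GroupLieAlgebra I G) (z : M₁ × M₂) :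
    mfderiv (I₁.prod I₂) I₂ Prod.snd z (fundField I (I₁.prod I₂) ξ z) = fundField I I₂ ξ z.2 := by
  have hd : MDifferentiableAt I (I₁.prod I₂) (fun g : G => g • z) 1 :=
    mdifferentiableAt_orbit inferInstance 1 z
  have h := mfderiv_chain (I := I) (h := fun g : G => g • z.2) (g := (Prod.snd : M₁ × M₂ → M₂))
    mdifferentiableAt_snd hd
    (one_smul G z) (fun _ => rfl) ξ
  exact (map_neg (mfderiv (I₁.prod I₂) I₂ Prod.snd z) _).trans (congrArg Neg.neg h.symm)

variable {ϖ₁ : DiffForm I₁ M₁ 2} {Φ₁ : M₁ → G} {ϖ₂ : DiffForm I₂ M₂ 2} {Φ₂ : M₂ → G}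

theorem mfderiv_comp_fst {z : M₁ × M₂} (h : MDifferentiableAt I₁ I Φ₁ z.1)
    (v : TangentSpace (I₁.prod I₂) z) :
    mfderiv (I₁.prod I₂) I (fun x : M₁ × M₂ => Φ₁ x.1) z v =
      mfderiv I₁ I Φ₁ z.1 (mfderiv (I₁.prod I₂) I₁ Prod.fst z v) :=
  mfderiv_chain h mdifferentiableAt_fst rfl (fun _ => rfl) v

theorem mfderiv_comp_snd {z : M₁ × M₂} (h : MDifferentiableAt I₂ I Φ₂ z.2)
    (v : TangentSpace (I₁.prod I₂) z) :
    mfderiv (I₁.prod I₂) I (fun x : M₁ × M₂ => Φ₂ x.2) z v =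
      mfderiv I₂ I Φ₂ z.2 (mfderiv (I₁.prod I₂) I₂ Prod.snd z v) :=
  mfderiv_chain h mdifferentiableAt_snd rfl (fun _ => rfl) v

/-- The fusion product of two twisted quasi-Hamiltonian spaces. -/
theorem IsTqHamiltonian.fusionProduct (hB : IsInvariantForm B) (hκ₁ : IsLieAut I κ₁)
    (hκ₂ : IsLieAut I κ₂) (hBκ₁ : InvariantUnder B κ₁) (h₁ : IsTqHamiltonian B κ₁ ϖ₁ Φ₁)
    (h₂ : IsTqHamiltonian B κ₂ ϖ₂ Φ₂) :
    IsTqHamiltonian (IM := I₁.prod I₂) (M := M₁ × M₂) B (κ₁ * κ₂)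
      (pullback Prod.fst ϖ₁ + pullback Prod.snd ϖ₂
        - (1 / 2 : ℝ) • dotWedge B (pullback₁ (I' := I) (fun x => Φ₁ x.1) (thetaL I G))
          (pullback₁ (I' := I) (fun x => Φ₂ x.2) (pullback₁ (I := I) (I' := I) κ₁ (thetaR I G))))
      (fun x => Φ₁ x.1 * κ₁ (Φ₂ x.2)) := by
  have hs₁ := h₁.smooth_action
  have hs₂ := h₂.smooth_action
  have c₁ : ContMDiff (I₁.prod I₂) I ∞ (fun x : M₁ × M₂ => Φ₁ x.1) :=
    h₁.smooth_moment.comp contMDiff_fst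
  have c₂ : ContMDiff (I₁.prod I₂) I ∞ (fun x : M₁ × M₂ => Φ₂ x.2) :=
    h₂.smooth_moment.comp contMDiff_snd
  have hp : ContMDiff (I₁.prod I₂) (I.prod I) ∞ (fun x : M₁ × M₂ => (Φ₁ x.1, Φ₂ x.2)) :=
    c₁.prodMk c₂
  have d₁ : MDifferentiable (I₁.prod I₂) I (fun x : M₁ × M₂ => Φ₁ x.1) :=
    c₁.mdifferentiable (by simp)
  have d₂ : MDifferentiable (I₁.prod I₂) I (fun x : M₁ × M₂ => Φ₂ x.2) :=
    c₂.mdifferentiable (by simp)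
  have hf : ContMDiff (I₁.prod I₂) I ∞ (fun x : M₁ × M₂ => Φ₁ x.1 * κ₁ (Φ₂ x.2)) :=
    (contMDiff_twMult hκ₁).comp hp
  have hsig := (isSmoothForm_sigmaTw B hκ₁).pullback hp
  have s₁ : IsSmoothForm (pullback (I := I₁.prod I₂) (Prod.fst : M₁ × M₂ → M₁) ϖ₁) :=
    h₁.smooth_form.pullback contMDiff_fst
  have s₂ : IsSmoothForm (pullback (I := I₁.prod I₂) (Prod.snd : M₁ × M₂ → M₂) ϖ₂) :=
    h₂.smooth_form.pullback contMDiff_snd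
  rw [sub_dotWedge_eq_add_pullback hκ₁ c₁ c₂]
  refine ⟨inferInstance, (s₁.add s₂).add hsig, hf, ?_, ?_, ?_, ?_, ?_⟩
  · intro g
    have g₁ : MDifferentiable I₁ I₁ (fun x : M₁ => g • x) :=
      (hs₁.contMDiff_smul.comp (contMDiff_const.prodMk contMDiff_id)).mdifferentiable (n := ∞)
        (by simp)
    have g₂ : MDifferentiable I₂ I₂ (fun x : M₂ => g • x) :=
      (hs₂.contMDiff_smul.comp (contMDiff_const.prodMk contMDiff_id)).mdifferentiable (n := ∞)
        (by simp)
    have hg : MDifferentiable (I₁.prod I₂) (I₁.prod I₂) (fun x : M₁ × M₂ => g • x) :=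
      (g₁.comp mdifferentiable_fst).prodMk (g₂.comp mdifferentiable_snd)
    rw [pullback_add, pullback_add]
    refine congrArg₂ HAdd.hAdd (congrArg₂ HAdd.hAdd ?_ ?_) ?_
    · refine (pullback_pullback (Ψ := Prod.fst) mdifferentiable_fst hg _).trans ?_
      refine (pullback_pullback (Φ := Prod.fst) g₁ mdifferentiable_fst _).symm.trans ?_
      rw [h₁.invariant]
    · refine (pullback_pullback (Ψ := Prod.snd) mdifferentiable_snd hg _).trans ?_
      refine (pullback_pullback (Φ := Prod.snd) g₂ mdifferentiable_snd _).symm.trans ?_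
      rw [h₂.invariant]
    · refine (pullback_pullback (hp.mdifferentiable (by simp)) hg _).trans ?_
      have e : (fun x : M₁ × M₂ => (Φ₁ (g • x).1, Φ₂ (g • x).2)) =
          fun x => (twConj κ₁ g (Φ₁ x.1), twConj κ₂ g (Φ₂ x.2)) := by
        funext x
        exact Prod.ext (h₁.equivariant g x.1) (h₂.equivariant g x.2)
      rw [e]
      exact pullback_twConj_sigmaTw hB hκ₁ κ₂ g d₁ d₂
  · intro g x
    change Φ₁ (g • x.1) * κ₁ (Φ₂ (g • x.2)) = _
    rw [h₁.equivariant, h₂.equivariant]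
    exact twMult_twConj κ₁ κ₂ g (Φ₁ x.1) (Φ₂ x.2)
  · rw [extD_add (s₁.add s₂) hsig, extD_add s₁ s₂, extD_pullback contMDiff_fst h₁.smooth_form,
      extD_pullback contMDiff_snd h₂.smooth_form, h₁.differential, h₂.differential,
      pullback_fusion_cartanForm hB hκ₁ hBκ₁ c₁ c₂]
    congr 2
    · exact pullback_pullback (h₁.smooth_moment.mdifferentiable (by simp)) mdifferentiable_fst _
    · exact pullback_pullback (h₂.smooth_moment.mdifferentiable (by simp)) mdifferentiable_snd _
  · intro ξ x v
    have e1 := mfderiv_comp_fst (I := I) (h₁.mdifferentiableAt x.1)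
      (fundField I (I₁.prod I₂) ξ x)
    have e2 := mfderiv_comp_snd (I := I) (h₂.mdifferentiableAt x.2)
      (fundField I (I₁.prod I₂) ξ x)
    rw [mfderiv_fst_fundField hs₁ hs₂, h₁.mfderiv_fundField hκ₁] at e1
    rw [mfderiv_snd_fundField hs₁ hs₂, h₂.mfderiv_fundField hκ₂] at e2
    change pullback Prod.fst ϖ₁ x ![_, v] + pullback Prod.snd ϖ₂ x ![_, v] +
      pullback _ (sigmaTw B κ₁) x ![_, v] = (eMap B (κ₁ * κ₂) (Φ₁ x.1 * κ₁ (Φ₂ x.2)) ξ).2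
        (mfderiv (I₁.prod I₂) I (fun x => Φ₁ x.1 * κ₁ (Φ₂ x.2)) x v)
    rw [eMap_fusion hB hκ₁ hκ₂ hBκ₁ (d₁ x) (d₂ x) ξ e1 e2 v, pullback_apply_two,
      pullback_apply_two, mfderiv_fst_fundField hs₁ hs₂, mfderiv_snd_fundField hs₁ hs₂,
      h₁.form_fundField, h₂.form_fundField, mfderiv_comp_fst (h₁.mdifferentiableAt x.1),
      mfderiv_comp_snd (h₂.mdifferentiableAt x.2)]
  · intro x v hv hv'
    -- the vectors generated by the first factor alone are tangent to `M₁`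
    have key := fusion_nondegenerate hB hκ₁ hBκ₁ (d₁ x) (d₂ x)
      (ϖ := pullback Prod.fst ϖ₁ + pullback Prod.snd ϖ₂) (v := v) (fun ξ => by
        obtain ⟨w, hw₁, hw₂⟩ := exists_tangent_prod (I := I₁) (J := I₂) x
          (fundField I I₁ ξ x.1) 0
        refine ⟨w, ?_, ?_, ?_⟩
        · rw [mfderiv_comp_fst (h₁.mdifferentiableAt x.1), hw₁, h₁.mfderiv_fundField hκ₁]
        · rw [mfderiv_comp_snd (h₂.mdifferentiableAt x.2), hw₂, map_zero]
        · change pullback Prod.fst ϖ₁ x ![w, v] + pullback Prod.snd ϖ₂ x ![w, v] = _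
          rw [pullback_apply_two, pullback_apply_two, hw₁, hw₂, h₁.form_fundField,
            mfderiv_comp_fst (h₁.mdifferentiableAt x.1),
            (ϖ₂ x.2).map_coord_zero (0 : Fin 2) rfl, add_zero]) hv hv'
    obtain ⟨k1, k2, k3⟩ := key
    have k3' (w : TangentSpace (I₁.prod I₂) x) :
        ϖ₁ x.1 ![mfderiv (I₁.prod I₂) I₁ Prod.fst x v, mfderiv (I₁.prod I₂) I₁ Prod.fst x w] +
          ϖ₂ x.2 ![mfderiv (I₁.prod I₂) I₂ Prod.snd x v,
            mfderiv (I₁.prod I₂) I₂ Prod.snd x w] = 0 := by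
      have h := k3 w
      change pullback Prod.fst ϖ₁ x ![v, w] + pullback Prod.snd ϖ₂ x ![v, w] = 0 at h
      rwa [pullback_apply_two, pullback_apply_two] at h
    have f1 : mfderiv (I₁.prod I₂) I₁ Prod.fst x v = 0 := by
      refine h₁.nondegenerate x.1 _ (fun X => ?_)
        ((mfderiv_comp_fst (h₁.mdifferentiableAt x.1) v).symm.trans k1)
      obtain ⟨w, hw₁, hw₂⟩ := exists_tangent_prod (I := I₁) (J := I₂) x X 0
      have h := k3' w
      rwa [hw₁, hw₂, (ϖ₂ x.2).map_coord_zero (1 : Fin 2) rfl, add_zero] at h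
    have f2 : mfderiv (I₁.prod I₂) I₂ Prod.snd x v = 0 := by
      refine h₂.nondegenerate x.2 _ (fun Y => ?_)
        ((mfderiv_comp_snd (h₂.mdifferentiableAt x.2) v).symm.trans k2)
      obtain ⟨w, hw₁, hw₂⟩ := exists_tangent_prod (I := I₁) (J := I₂) x 0 Y
      have h := k3' w
      rwa [hw₁, hw₂, (ϖ₁ x.1).map_coord_zero (1 : Fin 2) rfl, zero_add] at h
    exact tangent_prod_ext (f1.trans (map_zero _).symm) (f2.trans (map_zero _).symm)

variable {ϖ : DiffForm I₁ M₁ 2} {Φ : M₁ → G}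

/-- The inverse of a twisted quasi-Hamiltonian space. -/
theorem IsTqHamiltonian.inverse (hB : IsInvariantForm B) (hκ : IsLieAut I κ)
    (hBκ : InvariantUnder B κ) (h : IsTqHamiltonian B κ ϖ Φ) :
    IsTqHamiltonian B κ⁻¹ (-ϖ) (fun x => (κ⁻¹ : MulAut G) (Φ x)⁻¹) where
  smooth_action := h.smooth_action
  smooth_form := h.smooth_form.neg
  smooth_moment := (contMDiff_twInv hκ).comp h.smooth_moment
  invariant g := by rw [pullback_neg, h.invariant]
  equivariant g x := by
    rw [h.equivariant]
    exact twInv_twConj κ g (Φ x)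
  differential := by
    rw [extD_neg, h.differential]
    have e := pullback_pullback (Ψ := twInv κ) ((contMDiff_twInv hκ).mdifferentiable (by simp))
      (h.smooth_moment.mdifferentiable (by simp)) (cartanForm B)
    rw [pullback_twInv_cartanForm hB hκ hBκ, pullback_neg] at e
    exact e
  moment ξ x v := by
    have e := h.form_fundField ξ x v
    change -ϖ x ![_, v] = (eMap B κ⁻¹ (twInv κ (Φ x)) ξ).2
      (mfderiv I₁ I (fun x => twInv κ (Φ x)) x v)
    rw [e, eMap_twInv_snd hB hκ hBκ _ ξ _ _ (thetaL_inv_aut hκ (h.mdifferentiableAt x) v)]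
  nondegenerate x v hv hv' := by
    refine h.nondegenerate x v (fun w => neg_eq_zero.1 (hv w)) ?_
    have e := mfderiv_chain (h := fun x => twInv κ (Φ x))
      ((contMDiff_twInv hκ).mdifferentiableAt (by simp)) (h.mdifferentiableAt x) rfl
      (fun _ => rfl) v
    exact mfderiv_twInv_injective hκ (Φ x) (e.symm.trans (hv'.trans (map_zero _).symm))

end FusionProduct

end TqHam

end

theorem mainTheorem11
    -- the Lie group `G`, the inner product on its Lie algebra, and the twists
    {E : Type*} [NormedAddCommGroup E] [NormedSpace ℝ E] [FiniteDimensional ℝ E]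
    {H : Type*} [TopologicalSpace H] (I : ModelWithCorners ℝ E H) [I.Boundaryless]
    {G : Type*} [TopologicalSpace G] [ChartedSpace H G] [Group G] [LieGroup I ∞ G]
    (B : LinearMap.BilinForm ℝ (GroupLieAlgebra I G)) (hB : IsInvariantForm B)
    (κ κ₁ κ₂ : MulAut G) (hκ : IsLieAut I κ) (hκ₁ : IsLieAut I κ₁) (hκ₂ : IsLieAut I κ₂)
    (hBκ : InvariantUnder B κ) (hBκ₁ : InvariantUnder B κ₁) (hBκ₂ : InvariantUnder B κ₂)
    -- the second Lie group `K`, for internal fusion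
    {E' : Type*} [NormedAddCommGroup E'] [NormedSpace ℝ E'] [FiniteDimensional ℝ E']
    {H' : Type*} [TopologicalSpace H'] (J : ModelWithCorners ℝ E' H') [J.Boundaryless]
    {K : Type*} [TopologicalSpace K] [ChartedSpace H' K] [Group K] [LieGroup J ∞ K]
    (B' : LinearMap.BilinForm ℝ (GroupLieAlgebra J K)) (hB' : IsInvariantForm B')
    (τ : MulAut K) (hτ : IsLieAut J τ) (hBτ : InvariantUnder B' τ)
    -- a manifold `M` with an action of `G × G × K`
    {EM : Type*} [NormedAddCommGroup EM] [NormedSpace ℝ EM] [FiniteDimensional ℝ EM]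
    {HM : Type*} [TopologicalSpace HM] (IM : ModelWithCorners ℝ EM HM) [IM.Boundaryless]
    (M : Type*) [TopologicalSpace M] [ChartedSpace HM M] [IsManifold IM ∞ M]
    [MulAction (G × G × K) M]
    -- manifolds `M₁` and `M₂` with actions of `G`
    {E₁ : Type*} [NormedAddCommGroup E₁] [NormedSpace ℝ E₁] [FiniteDimensional ℝ E₁]
    {H₁ : Type*} [TopologicalSpace H₁] (I₁ : ModelWithCorners ℝ E₁ H₁) [I₁.Boundaryless]
    (M₁ : Type*) [TopologicalSpace M₁] [ChartedSpace H₁ M₁] [IsManifold I₁ ∞ M₁] [MulAction G M₁]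
    {E₂ : Type*} [NormedAddCommGroup E₂] [NormedSpace ℝ E₂] [FiniteDimensional ℝ E₂]
    {H₂ : Type*} [TopologicalSpace H₂] (I₂ : ModelWithCorners ℝ E₂ H₂) [I₂.Boundaryless]
    (M₂ : Type*) [TopologicalSpace M₂] [ChartedSpace H₂ M₂] [IsManifold I₂ ∞ M₂] [MulAction G M₂] :
    -- twisted multiplication
    ((∀ g a b : G, twMult κ₁ (twConj κ₁ g a, twConj κ₂ g b)
        = twConj (κ₁ * κ₂) g (twMult κ₁ (a, b))) ∧
      IsDiracMorphism
        (directSum (cartanDirac B κ₁) (cartanDirac B κ₂))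
        (pullback Prod.fst (cartanForm B) + pullback Prod.snd (cartanForm B))
        (cartanDirac B (κ₁ * κ₂)) (cartanForm B)
        (twMult κ₁) (sigmaTw B κ₁)) ∧
    -- twisted inversion
    ((∀ g a : G, twInv κ (twConj κ g a) = twConj κ⁻¹ g (twInv κ a)) ∧
      IsDiracMorphism
        (cartanDirac B κ) (cartanForm B)
        (transpose (cartanDirac B κ⁻¹)) (-cartanForm B)
        (twInv κ) 0) ∧
    -- internal fusion
    (∀ (ϖ : DiffForm IM M 2) (Φ : M → G × G × K),
      IsTqHamiltonian (prodForm B (prodForm B B')) (prodAut κ₁ (prodAut κ₂ τ)) ϖ Φ →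
      letI : MulAction (G × K) M := fusedAction G K M
      IsTqHamiltonian (prodForm B B') (prodAut (κ₁ * κ₂) τ)
        (ϖ - (1 / 2 : ℝ) • dotWedge B (pullback₁ (I' := I) (fun x => (Φ x).1) (thetaL I G))
          (pullback₁ (I' := I) (fun x => (Φ x).2.1) (pullback₁ (I := I) (I' := I) κ₁ (thetaR I G))))
        (fun x => ((Φ x).1 * κ₁ (Φ x).2.1, (Φ x).2.2))) ∧
    -- fusion product, with the diagonal action of `G` on `M₁ × M₂`
    (∀ (ϖ₁ : DiffForm I₁ M₁ 2) (Φ₁ : M₁ → G) (ϖ₂ : DiffForm I₂ M₂ 2) (Φ₂ : M₂ → G),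
      IsTqHamiltonian B κ₁ ϖ₁ Φ₁ → IsTqHamiltonian B κ₂ ϖ₂ Φ₂ →
      IsTqHamiltonian (IM := I₁.prod I₂) (M := M₁ × M₂) B (κ₁ * κ₂)
        (pullback Prod.fst ϖ₁ + pullback Prod.snd ϖ₂
          - (1 / 2 : ℝ) • dotWedge B (pullback₁ (I' := I) (fun x => Φ₁ x.1) (thetaL I G))
            (pullback₁ (I' := I) (fun x => Φ₂ x.2) (pullback₁ (I := I) (I' := I) κ₁ (thetaR I G))))
        (fun x => Φ₁ x.1 * κ₁ (Φ₂ x.2))) ∧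
    -- inversion
    (∀ (ϖ : DiffForm I₁ M₁ 2) (Φ : M₁ → G),
      IsTqHamiltonian B κ ϖ Φ →
      IsTqHamiltonian B κ⁻¹ (-ϖ) (fun x => (κ⁻¹ : MulAut G) (Φ x)⁻¹)) := by
  exact ⟨⟨twMult_twConj κ₁ κ₂, isDiracMorphism_twMult hB hκ₁ hκ₂ hBκ₁ hBκ₂⟩,
    ⟨twInv_twConj κ, isDiracMorphism_twInv hB hκ hBκ⟩,
    fun _ _ h => h.fusion hB hB' hκ₁ hκ₂ hτ hBκ₁,
    fun _ _ _ _ h₁ h₂ => h₁.fusionProduct hB hκ₁ hκ₂ hBκ₁ h₂,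
    fun _ _ h => h.inverse hB hκ hBκ⟩
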